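/- Let $n\ge 2$, let $\Omega,\Omega^*\subset\mathbb{R}^n$ be bounded domains, and let $f:\Omega\to\mathbb{R}$, $g:\Omega^*\to\mathbb{R}$ be functions with positive upper and lower bounds such that $f\in C^{1,1}_{\mathrm{loc}}(\Omega)$, $g\in C^{1,1}(\Omega^*)$ (that is, $g$ and $Dg$ are bounded and $Dg$ is Lipschitz on $\Omega^*$) and $\int_\Omega f\,dx=\int_{\Omega^*}g\,dy$. For $\varepsilon\in(0,1]$ let $c_\varepsilon(x,y)=\sqrt{\varepsilon^2+|x-y|^2}$. For a function $u$ on $\Omega$ with $|Du|<1$ put $$L=\frac{\varepsilon}{\sqrt{1-|Du|^2}},\qquad T(x)=x-L(x)Du(x),\qquad A_{ij}=\frac1L\big(\delta_{ij}-D_iu\,D_ju\big),\qquad w_{ij}=A_{ij}-D_{ij}u,$$ let $A^{ij}$ denote the entries of the inverse matrix of $(A_{ij})$, and let $$W=\sum_{\alpha,\beta=1}^n A^{\alpha\beta}w_{\alpha\beta}.$$ Then for every $\delta>0$ there is a constant $C$, depending on $n$, $\delta$, $f$ and $g$ (with their domains $\Omega$, $\Omega^*$) but not on $\varepsilon$ or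 $u$, with the following property. Let $\varepsilon\in(0,1]$ and let $u\in C^{3,1}_{\mathrm{loc}}(\Omega)$ be $c_\varepsilon$-concave, i.e. for every $x_0\in\Omega$ there are $y_0\in\mathbb{R}^n$ and $a\in\mathbb{R}$ such that $u(x_0)=c_\varepsilon(x_0,y_0)+a$ and $u(x)\le c_\varepsilon(x,y_0)+a$ for all $x\in\Omega$ (this implies $|Du|<1$). Suppose that $T(\Omega)\subset\Omega^*$ and $$\det (w_{ij})=\frac{\varepsilon^2}{L^{n+2}}\,\frac{f}{g\circ T}\qquad\text{in }\Omega.$$ Then $W(x)\le C$ for every $x\in\Omega$ with $\operatorname{dist}(x,\partial\Omega)\ge\delta$. -/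

import Mathlib

open MeasureTheory

noncomputable section

namespace MongeReg

/-- The Euclidean space `ℝⁿ`. -/
abbrev E (n : ℕ) := EuclideanSpace ℝ (Fin n)

/-- A bounded domain: a bounded, open, connected, nonempty set. -/
def IsBoundedDomain {n : ℕ} (Ω : Set (E n)) : Prop :=
  IsOpen Ω ∧ IsConnected Ω ∧ Bornology.IsBounded Ω

/-- `h ∈ C^{k,1}_loc(Ω)`: all derivatives up to order `k` exist and are continuous in `Ω`, and the
derivative of order `k` is Lipschitz near every point of `Ω` (used for open `Ω` only). -/
def IsCLip1Loc {n : ℕ} (k : ℕ) (Ω : Set (E n)) (h : E n → ℝ) : Prop :=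
  ContDiffOn ℝ k h Ω ∧ LocallyLipschitzOn Ω (iteratedFDeriv ℝ k h)

/-- `h ∈ C^{1,1}(Ω)` with finite norm: `h` is `C¹` in `Ω`, `h` and `Dh` are bounded on `Ω` and
`Dh` is Lipschitz on `Ω` (used for open `Ω` only). -/
def IsC11 {n : ℕ} (Ω : Set (E n)) (h : E n → ℝ) : Prop :=
  ContDiffOn ℝ 1 h Ω ∧
    (∃ K : ℝ, ∀ x ∈ Ω, |h x| ≤ K ∧ ‖fderiv ℝ h x‖ ≤ K) ∧
    ∃ K : NNReal, LipschitzOnWith K (fderiv ℝ h) Ω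

/-- `h` has positive lower and upper bounds on `Ω`. -/
def HasPosBounds {n : ℕ} (Ω : Set (E n)) (h : E n → ℝ) : Prop :=
  ∃ m M : ℝ, 0 < m ∧ ∀ x ∈ Ω, m ≤ h x ∧ h x ≤ M

/-- The cost `c_ε(x, y) = √(ε² + |x - y|²)`. -/
def cost {n : ℕ} (ε : ℝ) (x y : E n) : ℝ := √(ε ^ 2 + ‖x - y‖ ^ 2)

/-- `u` is `c`-concave in `Ω`: at every `x₀ ∈ Ω` it has a `c`-support function
`x ↦ c(x, y₀) + a`, which touches `u` from above at `x₀`. -/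
def IsCConcaveOn {n : ℕ} (c : E n → E n → ℝ) (Ω : Set (E n)) (u : E n → ℝ) : Prop :=
  ∀ x₀ ∈ Ω, ∃ y₀ : E n, ∃ a : ℝ, u x₀ = c x₀ y₀ + a ∧ ∀ x ∈ Ω, u x ≤ c x y₀ + a

/-- `L = ε / √(1 - |Du|²)`. -/
def L {n : ℕ} (ε : ℝ) (u : E n → ℝ) (x : E n) : ℝ := ε / √(1 - ‖gradient u x‖ ^ 2)

/-- The map `T = x - L Du`, i.e. the solution `y = T x` of `D_x c_ε(x, y) = Du(x)`. -/
def T {n : ℕ} (ε : ℝ) (u : E n → ℝ) (x : E n) : E n := x - L ε u x • gradient u x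

/-- The Hessian matrix `D_{ij} u`. -/
def hess {n : ℕ} (u : E n → ℝ) (x : E n) : Matrix (Fin n) (Fin n) ℝ :=
  Matrix.of fun i j =>
    fderiv ℝ (fun z => fderiv ℝ u z (EuclideanSpace.single i 1)) x (EuclideanSpace.single j 1)

/-- `A_{ij} = (δ_{ij} - D_i u D_j u) / L`, the matrix `D²_{xx} c_ε(x, T x)`. -/
def A {n : ℕ} (ε : ℝ) (u : E n → ℝ) (x : E n) : Matrix (Fin n) (Fin n) ℝ :=
  Matrix.of fun i j =>
    (1 / L ε u x) * ((if i = j then 1 else 0) - gradient u x i * gradient u x j)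

/-- `w_{ij} = A_{ij} - D_{ij} u`. -/
def w {n : ℕ} (ε : ℝ) (u : E n → ℝ) (x : E n) : Matrix (Fin n) (Fin n) ℝ :=
  A ε u x - hess u x

/-- `W = ∑_{α, β} A^{αβ} w_{αβ}`, where `A^{αβ}` are the entries of the inverse matrix of `A`. -/
def W {n : ℕ} (ε : ℝ) (u : E n → ℝ) (x : E n) : ℝ :=
  ∑ α, ∑ β, (A ε u x)⁻¹ α β * w ε u x α β

/-- `u` is a `C^{3,1}`, `c_ε`-concave solution in `Ω` of
`det w_{ij} = ε² / L^{n+2} * f / (g ∘ T)`, where `T` maps `Ω` into `Ωs`. -/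
structure IsPotential {n : ℕ} (ε : ℝ) (Ω Ωs : Set (E n)) (f g u : E n → ℝ) : Prop where
  regular : IsCLip1Loc 3 Ω u
  concave : IsCConcaveOn (cost ε) Ω u
  mapsTo : ∀ x ∈ Ω, T ε u x ∈ Ωs
  equation : ∀ x ∈ Ω,
    (w ε u x).det = ε ^ 2 / L ε u x ^ (n + 2) * (f x / g (T ε u x))

end MongeReg

end

/-! The estimate is of Pogorelov type: the maximum principle is applied to `ζ²W`, `ζ = r² - |x -
z|²`, on a ball of radius `r = δ/2` about the given point `z`.

Put `p = Du` and `s = √(1 - |p|²)`. In a basis `v_a` that is orthonormal for `I - p ⊗ p` and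
diagonalizes `D²u`, with `D²u(v_a, v_a) = s κ_a`, the form `L w` is diagonal with entries `λ_a = 1 -
ε κ_a`. Then `W = ∑ λ_a`, `DT v_a = λ_a v_a`, and the equation reads `∏ λ_a = f / (g ∘ T)`. The
`v_a` may be as long as `1/s`, but `ε/s = L = c_ε(x, Tx)` is bounded in terms of the two domains. In
the final estimates every frame vector is paired with a factor `ε`, and so the constants do not
depend on `ε`.

The logarithm of the equation is expanded to second order along each `v_c` and compared with `∑
(1/λ_c) ∂_{cc} W`. Concavity of `log det` disposes of the terms quadratic in `D³u`, the fourth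
derivatives cancel by symmetry, and the terms linear in `D³u` are absorbed by first derivatives of
`W` and of `log (f / g ∘ T)`. There remains (`trace_inequality`) the term `∑ κ_a κ_c (1 - λ_a/λ_c)`,
which times `ε²` equals `(P - n)(N - W) + (W - n)²` with `P = ∑ 1/λ_a` and `N = ∑ λ_a² ≥ W²/n`. At a
maximum of `ζ²W` the derivatives of `W` cost only `W/ζ` and `W/ζ²`. If `P` is large, the good term
dominates and bounds `ζ²W`; if `P` is bounded, the product equation bounds every `λ_a`
(`cutoff_trace_le`).

As `u` is only `C^{3,1}` and `f`, `g` only `C^{1,1}`, nothing can be differentiated often enough at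
the maximum itself. Jensen's lemma (`exists_touching_above`) supplies a nearby point where `D³u` is
differentiable and `ζ²W` is touched from above by an almost flat paraboloid; `log (f / g)` is
replaced by a lower barrier (`exists_jet_le_log_div`); derivatives are replaced by Peano expansions
`Jet`; and `log det` concavity is used as the minimality at `t = 0` of a function of one variable
(`directional_concavity`). -/

noncomputable section

namespace MongeReg

set_option maxSynthPendingDepth 3

open Filter Topology Asymptotics

/-! ### Calculus of second-order Peano expansions. -/

section Jets

variable {F G H : Type*} [NormedAddCommGroup F] [NormedSpace ℝ F] [NormedAddCommGroup G]
  [NormedSpace ℝ G] [NormedAddCommGroup H] [NormedSpace ℝ H]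

/-- Second order Peano expansion at `0`: `f t = a + t b + t² c / 2 + o(t²)`. -/
def Jet (f : ℝ → F) (a b c : F) : Prop :=
  (fun t => f t - (a + t • b + (t ^ 2 / 2) • c)) =o[𝓝 0] fun t : ℝ => t ^ 2

lemma Jet.congr_coeff {f : ℝ → F} {a b c a' b' c' : F} (h : Jet f a b c) (ha : a = a')
    (hb : b = b') (hc : c = c') : Jet f a' b' c' := by
  subst ha hb hc; exact h

lemma Jet.congr {f g : ℝ → F} {a b c : F} (h : Jet f a b c) (hfg : f =ᶠ[𝓝 0] g) :
    Jet g a b c := by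
  refine IsLittleO.congr' h ?_ EventuallyEq.rfl
  filter_upwards [hfg] with t ht
  rw [ht]

lemma Jet.add {f g : ℝ → F} {a b c a' b' c' : F} (hf : Jet f a b c) (hg : Jet g a' b' c') :
    Jet (fun t => f t + g t) (a + a') (b + b') (c + c') := by
  refine (IsLittleO.add hf hg).congr_left fun t => ?_
  simp only [smul_add]; abel

lemma Jet.clm (L : F →L[ℝ] G) {f : ℝ → F} {a b c : F} (hf : Jet f a b c) :
    Jet (fun t => L (f t)) (L a) (L b) (L c) := by
  refine ((L.isBigO_comp _ _).trans_isLittleO hf).congr_left fun t => ?_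
  simp

lemma Jet.neg {f : ℝ → F} {a b c : F} (hf : Jet f a b c) :
    Jet (fun t => -f t) (-a) (-b) (-c) := by
  simpa using hf.clm (-ContinuousLinearMap.id ℝ F)

lemma Jet.sub {f g : ℝ → F} {a b c a' b' c' : F} (hf : Jet f a b c) (hg : Jet g a' b' c') :
    Jet (fun t => f t - g t) (a - a') (b - b') (c - c') := by
  simpa only [sub_eq_add_neg] using hf.add hg.neg

lemma Jet.const (a : F) : Jet (fun _ => a) a 0 0 := by
  refine (isLittleO_zero _ _).congr_left fun t => ?_
  simp

lemma Jet.id : Jet (fun t : ℝ => t) 0 1 0 := by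
  refine (isLittleO_zero _ _).congr_left fun t => ?_
  simp

lemma Jet.line (x v : F) : Jet (fun t : ℝ => x + t • v) x v 0 := by
  refine (isLittleO_zero _ _).congr_left fun t => ?_
  simp

lemma Jet.sum {ι : Type*} (S : Finset ι) {f : ι → ℝ → F} {a b c : ι → F}
    (h : ∀ i ∈ S, Jet (f i) (a i) (b i) (c i)) :
    Jet (fun t => ∑ i ∈ S, f i t) (∑ i ∈ S, a i) (∑ i ∈ S, b i) (∑ i ∈ S, c i) := by
  refine (IsLittleO.sum h).congr_left fun t => ?_
  simp [Finset.sum_add_distrib, Finset.smul_sum, Finset.sum_sub_distrib]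

lemma Jet.isBigO_sub {f : ℝ → F} {a b c : F} (hf : Jet f a b c) :
    (fun t => f t - a) =O[𝓝 0] fun t : ℝ => t := by
  have h2 : (fun t : ℝ => t ^ 2) =O[𝓝 0] fun t : ℝ => t := by
    refine ((isLittleO_pow_id (by norm_num : 1 < 2)).isBigO)
  have h1 : (fun t : ℝ => t • b + (t ^ 2 / 2) • c) =O[𝓝 0] fun t : ℝ => t := by
    refine IsBigO.add ?_ ?_
    · have := (isBigO_refl (fun t : ℝ => t) (𝓝 0)).smul (isBigO_refl (fun _ : ℝ => b) (𝓝 0))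
      refine this.trans ?_
      refine IsBigO.of_bound ‖b‖ (Eventually.of_forall fun t => ?_)
      rw [norm_smul, mul_comm]
    · refine (IsBigO.of_bound (‖c‖ / 2) (Eventually.of_forall fun t => ?_) :
        (fun t : ℝ => (t ^ 2 / 2) • c) =O[𝓝 0] fun t : ℝ => t ^ 2).trans h2
      rw [norm_smul, norm_div]
      simp only [Real.norm_ofNat]
      apply le_of_eq; ring
  refine ((hf.isBigO.trans h2).add h1).congr_left fun t => ?_
  abel

lemma Jet.tendsto {f : ℝ → F} {a b c : F} (hf : Jet f a b c) : Tendsto f (𝓝 0) (𝓝 a) := by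
  have := hf.isBigO_sub.trans_tendsto tendsto_id
  simpa using this.add_const a

lemma Jet.apply_zero {f : ℝ → F} {a b c : F} (hf : Jet f a b c) : f 0 = a := by
  have h := hf.isBigO_sub.bound
  obtain ⟨C, hC⟩ := h
  have h0 := hC.self_of_nhds
  simp only [norm_zero, mul_zero] at h0
  exact sub_eq_zero.1 (norm_le_zero_iff.1 h0)

/-- Product rule for second order expansions. -/
lemma Jet.bilin (B : F →L[ℝ] G →L[ℝ] H) {f : ℝ → F} {g : ℝ → G} {a b c : F} {a' b' c' : G}
    (hf : Jet f a b c) (hg : Jet g a' b' c') :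
    Jet (fun t => B (f t) (g t)) (B a a') (B b a' + B a b')
      (B c a' + (2 : ℝ) • B b b' + B a c') := by
  set P : ℝ → F := fun t => a + t • b + (t ^ 2 / 2) • c with hP
  set Q : ℝ → G := fun t => a' + t • b' + (t ^ 2 / 2) • c' with hQ
  have hPc : Continuous P := by fun_prop
  have hgb : g =O[𝓝 0] fun _ => (1 : ℝ) := hg.tendsto.isBigO_one ℝ
  have hPb : P =O[𝓝 0] fun _ => (1 : ℝ) := (hPc.tendsto 0).isBigO_one ℝ
  have h1 : (fun t => B (f t - P t) (g t)) =o[𝓝 0] fun t : ℝ => t ^ 2 := by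
    have : (fun t => B (f t - P t) (g t)) =O[𝓝 0] fun t => ‖f t - P t‖ * ‖g t‖ :=
      IsBigO.of_bound ‖B‖ (Eventually.of_forall fun t => by
        simpa [mul_assoc] using B.le_opNorm₂ (f t - P t) (g t))
    refine this.trans_isLittleO ?_
    simpa using (IsLittleO.norm_left hf).mul_isBigO hgb.norm_left
  have h2 : (fun t => B (P t) (g t - Q t)) =o[𝓝 0] fun t : ℝ => t ^ 2 := by
    have : (fun t => B (P t) (g t - Q t)) =O[𝓝 0] fun t => ‖P t‖ * ‖g t - Q t‖ :=
      IsBigO.of_bound ‖B‖ (Eventually.of_forall fun t => by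
        simpa [mul_assoc] using B.le_opNorm₂ (P t) (g t - Q t))
    refine this.trans_isLittleO ?_
    simpa using hPb.norm_left.mul_isLittleO (IsLittleO.norm_left hg)
  -- The terms of degree three and four in the product of the two Taylor polynomials.
  have h3 : (fun t : ℝ => t ^ 3 • ((1 / 2 : ℝ) • (B b c' + B c b') + (t / 4) • B c c'))
      =o[𝓝 0] fun t : ℝ => t ^ 2 := by
    have hc : Continuous fun t : ℝ => (1 / 2 : ℝ) • (B b c' + B c b') + (t / 4) • B c c' := by
      fun_prop
    have := (isLittleO_pow_pow (𝕜 := ℝ) (by norm_num : 2 < 3)).smul_isBigO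
      ((hc.tendsto 0).isBigO_one ℝ)
    simpa using this
  refine ((h1.add h2).add h3).congr_left fun t => ?_
  simp only [hP, hQ, map_add, map_sub, map_smul, add_apply, sub_apply, smul_apply]
  module

lemma Jet.mul {f g : ℝ → ℝ} {a b c a' b' c' : ℝ} (hf : Jet f a b c) (hg : Jet g a' b' c') :
    Jet (fun t => f t * g t) (a * a') (b * a' + a * b') (c * a' + 2 * (b * b') + a * c') := by
  simpa using Jet.bilin (ContinuousLinearMap.mul ℝ ℝ) hf hg

lemma Jet.const_mul (k : ℝ) {f : ℝ → ℝ} {a b c : ℝ} (hf : Jet f a b c) :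
    Jet (fun t => k * f t) (k * a) (k * b) (k * c) := by
  simpa using (Jet.const k).mul hf

lemma Jet.smul {f : ℝ → ℝ} {g : ℝ → F} {a b c : ℝ} {a' b' c' : F} (hf : Jet f a b c)
    (hg : Jet g a' b' c') :
    Jet (fun t => f t • g t) (a • a') (b • a' + a • b') (c • a' + (2 : ℝ) • b • b' + a • c') := by
  simpa using Jet.bilin (ContinuousLinearMap.lsmul ℝ ℝ) hf hg

lemma Jet.inner {V : Type*} [NormedAddCommGroup V] [InnerProductSpace ℝ V] {f g : ℝ → V}
    {a b c a' b' c' : V} (hf : Jet f a b c) (hg : Jet g a' b' c') :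
    Jet (fun t => inner ℝ (f t) (g t)) (inner ℝ a a') (inner ℝ b a' + inner ℝ a b')
      (inner ℝ c a' + 2 * inner ℝ b b' + inner ℝ a c') := by
  exact Jet.bilin (innerSL ℝ (E := V)) hf hg

/-- Chain rule for second order expansions. -/
lemma Jet.comp {φ : ℝ → ℝ} {f : ℝ → ℝ} {a b c φ₀ φ₁ φ₂ : ℝ}
    (hφ : Jet (fun h => φ (a + h)) φ₀ φ₁ φ₂) (hf : Jet f a b c) :
    Jet (fun t => φ (f t)) φ₀ (φ₁ * b) (φ₁ * c + φ₂ * b ^ 2) := by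
  have hfa : Jet (fun t => f t - a) 0 b c := by simpa using hf.sub (Jet.const a)
  have ht : Tendsto (fun t => f t - a) (𝓝 0) (𝓝 0) := hfa.tendsto
  have h1 := hφ.comp_tendsto ht
  have h2 : (fun t => (f t - a) ^ 2) =O[𝓝 0] fun t : ℝ => t ^ 2 := hf.isBigO_sub.pow 2
  have h3 := h1.trans_isBigO h2
  have hsq : Jet (fun t => (f t - a) * (f t - a)) (0 * 0) (b * 0 + 0 * b)
    (c * 0 + 2 * (b * b) + 0 * c) := hfa.mul hfa
  have h4 := ((hfa.const_mul φ₁).add (hsq.const_mul (φ₂ / 2)))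
  have h5 := (Jet.const φ₀).add h4
  refine (IsLittleO.add h3 h5).congr_left fun t => ?_
  simp only [Function.comp, smul_eq_mul]
  ring_nf

/-- The derivative of the remainder is `o(t)`, so the mean value inequality makes the remainder
`o(t²)`. A second derivative is needed at the single point `0` only, which is all that is available
for `D²u`. -/
lemma Jet.of_hasDerivAt {f f' : ℝ → F} {c : F} (h : ∀ᶠ t in 𝓝 0, HasDerivAt f (f' t) t)
    (h' : HasDerivAt f' c 0) : Jet f (f 0) (f' 0) c := by
  rw [Jet, isLittleO_iff]
  intro ε hε
  have h1 := (hasDerivAt_iff_isLittleO.1 h')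
  have h2 := isLittleO_iff.1 h1 hε
  obtain ⟨δ, hδ, hb⟩ := Metric.eventually_nhds_iff.1 (h.and h2)
  refine Metric.eventually_nhds_iff.2 ⟨δ, hδ, fun t ht => ?_⟩
  set r : ℝ → F := fun t => f t - (f 0 + t • f' 0 + (t ^ 2 / 2) • c) with hr
  have hder : ∀ x ∈ Metric.closedBall (0 : ℝ) |t|,
      HasDerivWithinAt r (f' x - (f' 0 + x • c)) (Metric.closedBall (0 : ℝ) |t|) x := by
    intro x hx
    have hx' : dist x 0 < δ := lt_of_le_of_lt hx (by simpa [Real.dist_eq] using ht)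
    have hd1 := (hb hx').1
    have hd2 : HasDerivAt (fun t : ℝ => f 0 + t • f' 0 + (t ^ 2 / 2) • c)
        ((1 : ℝ) • f' 0 + ((2 * x ^ (2 - 1) * 1) / 2) • c) x := by
      have e1 := ((hasDerivAt_id x).smul_const (f' 0)).const_add (f 0)
      have e2 := (((hasDerivAt_id x).fun_pow 2).div_const 2).smul_const c
      simpa using e1.fun_add e2
    have := (hd1.sub hd2).hasDerivWithinAt (s := Metric.closedBall (0 : ℝ) |t|)
    refine this.congr_deriv ?_
    simp
  have hbound : ∀ x ∈ Metric.closedBall (0 : ℝ) |t|, ‖f' x - (f' 0 + x • c)‖ ≤ ε * |t| := by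
    intro x hx
    have hx' : dist x 0 < δ := lt_of_le_of_lt hx (by simpa [Real.dist_eq] using ht)
    have := (hb hx').2
    have hx2 : |x| ≤ |t| := by simpa [Real.dist_eq] using hx
    calc ‖f' x - (f' 0 + x • c)‖ = ‖f' x - f' 0 - (x - 0) • c‖ := by
          congr 1; rw [sub_zero]; abel
      _ ≤ ε * ‖x - 0‖ := this
      _ ≤ ε * |t| := by rw [sub_zero, Real.norm_eq_abs]; gcongr
  have hmv := (convex_closedBall (0 : ℝ) |t|).norm_image_sub_le_of_norm_hasDerivWithin_le
    hder hbound (x := 0) (y := t) (by simp) (by simp)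
  have hr0 : r 0 = 0 := by simp [hr]
  rw [hr0, sub_zero, sub_zero] at hmv
  calc ‖r t‖ ≤ ε * |t| * ‖t‖ := hmv
    _ = ε * ‖t ^ 2‖ := by rw [norm_pow, Real.norm_eq_abs]; ring

lemma Jet.rpow {f : ℝ → ℝ} {a b c : ℝ} (hf : Jet f a b c) (ha : 0 < a) (r : ℝ) :
    Jet (fun t => f t ^ r) (a ^ r) (r * a ^ (r - 1) * b)
      (r * a ^ (r - 1) * c + r * (r - 1) * a ^ (r - 2) * b ^ 2) := by
  refine Jet.comp (φ := fun x => x ^ r) ?_ hf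
  have hev : ∀ᶠ t in 𝓝 (0 : ℝ), 0 < a + t := by
    have : Tendsto (fun t : ℝ => a + t) (𝓝 0) (𝓝 (a + 0)) := tendsto_const_nhds.add tendsto_id
    rw [add_zero] at this
    exact this.eventually (lt_mem_nhds ha)
  have := Jet.of_hasDerivAt (f := fun t => (a + t) ^ r) (f' := fun t => r * (a + t) ^ (r - 1))
    (c := r * (r - 1) * a ^ (r - 2)) ?_ ?_
  · simpa using this
  · filter_upwards [hev] with t ht
    have h1 := ((hasDerivAt_id t).const_add a).rpow_const (p := r) (Or.inl ht.ne')
    simpa using h1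
  · have h1 := (((hasDerivAt_id (0 : ℝ)).const_add a).rpow_const (p := r - 1)
      (Or.inl (by simpa using ha.ne'))).const_mul r
    refine h1.congr_deriv ?_
    simp only [_root_.id, add_zero, one_mul]
    rw [show r - 1 - 1 = r - 2 by ring]; ring

lemma Jet.log {f : ℝ → ℝ} {a b c : ℝ} (hf : Jet f a b c) (ha : 0 < a) :
    Jet (fun t => Real.log (f t)) (Real.log a) (b / a) (c / a - (b / a) ^ 2) := by
  have key : Jet (fun t => Real.log (a + t)) (Real.log a) (a⁻¹) (-(a ^ 2)⁻¹) := by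
    have hev : ∀ᶠ t in 𝓝 (0 : ℝ), 0 < a + t := by
      have : Tendsto (fun t : ℝ => a + t) (𝓝 0) (𝓝 (a + 0)) :=
        tendsto_const_nhds.add tendsto_id
      rw [add_zero] at this
      exact this.eventually (lt_mem_nhds ha)
    have := Jet.of_hasDerivAt (f := fun t => Real.log (a + t)) (f' := fun t => (a + t)⁻¹)
      (c := -(a ^ 2)⁻¹) ?_ ?_
    · simpa using this
    · filter_upwards [hev] with t ht
      have h1 := ((hasDerivAt_id t).const_add a).log ht.ne'
      simpa using h1
    · have h1 := ((hasDerivAt_id (0 : ℝ)).const_add a).inv (by simpa using ha.ne')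
      refine h1.congr_deriv ?_
      simp [neg_div]
  refine (Jet.comp (φ := Real.log) key hf).congr_coeff rfl ?_ ?_
  · field_simp
  · field_simp; ring

/-- Necessary conditions at a minimum. -/
lemma Jet.minimum {f : ℝ → ℝ} {b c : ℝ} (hf : Jet f 0 b c) (h : ∀ᶠ t in 𝓝 0, 0 ≤ f t) :
    b = 0 ∧ 0 ≤ c := by
  have hf0 : f 0 = 0 := hf.apply_zero
  have hderiv : HasDerivAt f b 0 := by
    rw [hasDerivAt_iff_isLittleO]
    have h1 : (fun t : ℝ => t ^ 2) =o[𝓝 0] fun t : ℝ => t := isLittleO_pow_id (by norm_num)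
    have h2 := hf.isBigO.trans_isLittleO h1
    have h3 : (fun t : ℝ => (t ^ 2 / 2) • c) =o[𝓝 0] fun t : ℝ => t := by
      have := h1.const_mul_left (c / 2)
      refine this.congr_left fun t => ?_
      simp; ring
    have := h2.add h3
    simp only [sub_zero]
    refine this.congr_left fun t => ?_
    rw [hf0]; simp; ring
  have hmin : IsLocalMin f 0 := by
    filter_upwards [h] with t ht
    rwa [hf0]
  have hb : b = 0 := hmin.hasDerivAt_eq_zero hderiv
  refine ⟨hb, ?_⟩
  by_contra! hc
  subst hb
  -- With `b = 0` and `c < 0` this tolerance forces `f t ≤ c t² / 4 < 0` for small `t ≠ 0`.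
  have h1 := isLittleO_iff.1 hf (show (0 : ℝ) < -c / 4 by linarith)
  obtain ⟨δ, hδ, hb⟩ := Metric.eventually_nhds_iff.1 (h.and h1)
  have hd : dist (δ / 2) 0 < δ := by
    rw [Real.dist_eq, sub_zero, abs_of_pos (by linarith)]; linarith
  obtain ⟨h2, h3⟩ := hb hd
  rw [Real.norm_eq_abs, Real.norm_eq_abs] at h3
  have h4 := (abs_le.1 h3).2
  rw [abs_of_pos (by positivity : (0:ℝ) < (δ / 2) ^ 2)] at h4
  simp only [smul_eq_mul] at h4
  have : (0 : ℝ) < (δ / 2) ^ 2 := by positivity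
  nlinarith

end Jets

/-! ### Jensen's lemma on touching paraboloids. -/

section Touching

/-- A Lipschitz map sends null sets to null sets. -/
lemma volume_image_eq_zero_of_lipschitzOnWith {n : ℕ} {Φ : E n → E n} {K : NNReal} {s N : Set (E n)}
    (hΦ : LipschitzOnWith K Φ s) (hs : N ⊆ s) (hN : volume N = 0) : volume (Φ '' N) = 0 := by
  -- Hausdorff measure of dimension `n` and volume are both Haar measures, hence have the same null
  -- sets, and a Lipschitz map multiplies the former by at most a constant.
  have hH : Measure.IsAddHaarMeasure
      (μH[(Module.finrank ℝ (E n) : ℝ)] : Measure (E n)) := inferInstance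
  have hac : (μH[(Module.finrank ℝ (E n) : ℝ)] : Measure (E n)) ≪ volume :=
    Measure.absolutelyContinuous_isAddHaarMeasure _ _
  have hac' : volume ≪ (μH[(Module.finrank ℝ (E n) : ℝ)] : Measure (E n)) :=
    Measure.absolutelyContinuous_isAddHaarMeasure _ _
  refine hac' (le_antisymm ?_ zero_le)
  refine ((hΦ.mono hs).hausdorffMeasure_image_le (Nat.cast_nonneg _)).trans ?_
  rw [hac hN, mul_zero]

/-- Jensen's lemma: a `C^{1,1}` function is touched from above by flat paraboloids at points
arbitrarily close to a maximum point and outside of a given null set. -/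
lemma exists_touching_above {n : ℕ} {G : E n → ℝ} {x₀ : E n} {R : ℝ} (hR : 0 < R) {K : NNReal}
    (hd : ∀ x ∈ Metric.closedBall x₀ R, DifferentiableAt ℝ G x)
    (hL : LipschitzOnWith K (fderiv ℝ G) (Metric.closedBall x₀ R))
    (hmax : ∀ x ∈ Metric.closedBall x₀ R, G x ≤ G x₀) {N : Set (E n)} (hN : volume N = 0)
    {τ : ℝ} (hτ : 0 < τ) :
    ∃ x, x ∉ N ∧ dist x x₀ < τ ∧ ∃ γ : E n, ‖γ‖ ≤ τ ∧
      ∀ᶠ h in 𝓝 (0 : E n), G (x + h) ≤ G x + inner ℝ γ h + τ * ‖h‖ ^ 2 := by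
  -- The bound `τ / 2` puts the touching point within `τ` of `x₀`; the bound `1 / 3` makes the slope
  -- at most `τ r + 2 τ r ≤ τ`.
  set r : ℝ := min R (min (τ / 2) (1 / 3)) with hr
  have hr0 : 0 < r := by rw [hr]; positivity
  have hrR : r ≤ R := min_le_left _ _
  have hrτ : r < τ := lt_of_le_of_lt ((min_le_right _ _).trans (min_le_left _ _)) (by linarith)
  have hr3 : r ≤ 1 / 3 := (min_le_right _ _).trans (min_le_right _ _)
  have hsub : Metric.closedBall x₀ r ⊆ Metric.closedBall x₀ R :=
    Metric.closedBall_subset_closedBall hrR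
  set F : E n → E n → ℝ := fun p x => G x - τ * ‖x - x₀‖ ^ 2 - inner ℝ p (x - x₀) with hF
  -- the touching points
  have key : ∀ p : E n, ‖p‖ < τ * r → ∃ x ∈ Metric.ball x₀ r,
      ∀ y ∈ Metric.closedBall x₀ r, F p y ≤ F p x := by
    intro p hp
    have hcont : ContinuousOn (F p) (Metric.closedBall x₀ r) := by
      have hG : ContinuousOn G (Metric.closedBall x₀ r) := fun x hx =>
        (hd x (hsub hx)).continuousAt.continuousWithinAt
      refine (hG.sub ?_).sub ?_ <;> fun_prop
    obtain ⟨x, hx, hxm⟩ := (isCompact_closedBall x₀ r).exists_isMaxOn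
      ⟨x₀, Metric.mem_closedBall_self hr0.le⟩ hcont
    refine ⟨x, ?_, fun y hy => hxm hy⟩
    rw [Metric.mem_ball]
    -- On the sphere the penalty `τ r²` exceeds the largest gain `‖p‖ r` from the tilt, because `‖p‖
    -- < τ r`.
    refine lt_of_le_of_ne hx fun heq => ?_
    have h1 : F p x₀ ≤ F p x := hxm (Metric.mem_closedBall_self hr0.le)
    have h2 : ‖x - x₀‖ = r := by rw [← dist_eq_norm]; exact heq
    simp only [hF, h2, sub_self, norm_zero, inner_zero_right] at h1
    have h3 := hmax x (hsub hx)
    have h4 := (abs_le.1 (abs_real_inner_le_norm p (x - x₀))).1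
    rw [h2] at h4
    nlinarith [hr0]
  choose! X hXb hXm using key
  -- The gradient of the penalized function before tilting; it equals `p` at an interior maximum of
  -- `F p`.
  set Φ : E n → E n := fun x => (InnerProductSpace.toDual ℝ (E n)).symm (fderiv ℝ G x)
    - (2 * τ) • (x - x₀) with hΦ
  have hgrad : ∀ p : E n, ‖p‖ < τ * r → Φ (X p) = p := by
    intro p hp
    have hx := hXb p hp
    have hloc : IsLocalMax (F p) (X p) := by
      filter_upwards [Metric.isOpen_ball.mem_nhds hx] with y hy
      exact hXm p hp y (Metric.ball_subset_closedBall hy)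
    have hdG := (hd _ (hsub (Metric.ball_subset_closedBall hx))).hasFDerivAt
    have hdn : HasFDerivAt (fun x : E n => ‖x - x₀‖ ^ 2) (2 • (innerSL ℝ (X p - x₀))) (X p) := by
      have := ((hasFDerivAt_id (𝕜 := ℝ) (X p)).sub_const x₀).norm_sq
      simpa using this
    have hdi : HasFDerivAt (fun x : E n => inner ℝ p (x - x₀)) (innerSL ℝ p) (X p) := by
      have := ((innerSL ℝ p).hasFDerivAt (x := X p - x₀)).comp (X p)
        ((hasFDerivAt_id (𝕜 := ℝ) (X p)).sub_const x₀)
      exact this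
    have hdF := (hdG.sub (hdn.const_mul τ)).sub hdi
    have h0 := hloc.hasFDerivAt_eq_zero hdF
    have h1 : fderiv ℝ G (X p) = innerSL ℝ ((2 * τ) • (X p - x₀) + p) := by
      have : fderiv ℝ G (X p) = τ • (2 • (innerSL ℝ (X p - x₀))) + innerSL ℝ p := by
        rw [sub_sub, sub_eq_zero] at h0
        exact h0
      rw [this, map_add, map_smul]
      congr 1
      ext y
      simp; ring
    have h2 : (InnerProductSpace.toDual ℝ (E n)).symm (fderiv ℝ G (X p)) =
        (2 * τ) • (X p - x₀) + p := by
      rw [h1]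
      apply (InnerProductSpace.toDual ℝ (E n)).injective
      rw [LinearIsometryEquiv.apply_symm_apply]
      ext y
      simp
    simp only [hΦ, h2]
    abel
  have hΦL : LipschitzOnWith (K + Real.toNNReal (2 * τ)) Φ (Metric.closedBall x₀ r) := by
    refine LipschitzOnWith.of_dist_le_mul fun x hx y hy => ?_
    have h1 := hL.dist_le_mul x (hsub hx) y (hsub hy)
    have h2 : Φ x - Φ y = (InnerProductSpace.toDual ℝ (E n)).symm (fderiv ℝ G x - fderiv ℝ G y)
        - (2 * τ) • (x - y) := by
      simp only [hΦ, map_sub]; module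
    rw [dist_eq_norm, h2]
    refine (norm_sub_le _ _).trans ?_
    rw [LinearIsometryEquiv.norm_map, norm_smul, Real.norm_eq_abs, abs_of_pos (by linarith)]
    rw [dist_eq_norm] at h1
    rw [NNReal.coe_add, Real.coe_toNNReal _ (by linarith), add_mul, ← dist_eq_norm x y]
    gcongr
  -- Otherwise a ball of slopes, of positive volume, would lie in the image of a null set under the
  -- Lipschitz map `Φ`.
  obtain ⟨p, hp, hpN⟩ : ∃ p : E n, ‖p‖ < τ * r ∧ X p ∉ N := by
    by_contra! hcon
    have hz := volume_image_eq_zero_of_lipschitzOnWith hΦL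
      (N := N ∩ Metric.closedBall x₀ r) Set.inter_subset_right
      (measure_mono_null Set.inter_subset_left hN)
    have hsubset : Metric.ball (0 : E n) (τ * r) ⊆ Φ '' (N ∩ Metric.closedBall x₀ r) := by
      intro p hp
      rw [mem_ball_zero_iff] at hp
      exact ⟨X p, ⟨hcon p hp, Metric.ball_subset_closedBall (hXb p hp)⟩, hgrad p hp⟩
    exact (Metric.measure_ball_pos volume (0 : E n) (by positivity)).ne'
      (measure_mono_null hsubset hz)
  have hx := hXb p hp
  refine ⟨X p, hpN, lt_trans hx hrτ, p + (2 * τ) • (X p - x₀), ?_, ?_⟩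
  · have h1 : ‖X p - x₀‖ < r := by rw [← dist_eq_norm]; exact hx
    calc ‖p + (2 * τ) • (X p - x₀)‖ ≤ ‖p‖ + ‖(2 * τ) • (X p - x₀)‖ := norm_add_le _ _
      _ ≤ τ * r + 2 * τ * r := by
        rw [norm_smul, Real.norm_eq_abs, abs_of_pos (by linarith)]
        gcongr
      _ ≤ τ := by nlinarith
  · have hnear : ∀ᶠ h in 𝓝 (0 : E n), X p + h ∈ Metric.ball x₀ r := by
      have : Tendsto (fun h : E n => X p + h) (𝓝 0) (𝓝 (X p + 0)) :=
        tendsto_const_nhds.add tendsto_id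
      rw [add_zero] at this
      exact this.eventually (Metric.isOpen_ball.mem_nhds hx)
    filter_upwards [hnear] with h hh
    have h1 := hXm p hp _ (Metric.ball_subset_closedBall hh)
    simp only [hF] at h1
    have h2 : X p + h - x₀ = (X p - x₀) + h := by abel
    rw [h2, norm_add_sq_real, inner_add_right] at h1
    rw [inner_add_left, inner_smul_left]
    simp only [conj_trivial]
    linarith

end Touching

/-! ### Derivatives of `u` up to order four and their symmetries. -/

section Regularity

variable {V : Type*} [NormedAddCommGroup V] [InnerProductSpace ℝ V]

/-- First derivative. -/
abbrev D1 (u : V → ℝ) : V → V →L[ℝ] ℝ := fderiv ℝ u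
/-- Second derivative. -/
abbrev D2 (u : V → ℝ) : V → V →L[ℝ] V →L[ℝ] ℝ := fderiv ℝ (D1 u)
/-- Third derivative. -/
abbrev D3 (u : V → ℝ) : V → V →L[ℝ] V →L[ℝ] V →L[ℝ] ℝ := fderiv ℝ (D2 u)
/-- Fourth derivative. -/
abbrev D4 (u : V → ℝ) : V → V →L[ℝ] V →L[ℝ] V →L[ℝ] V →L[ℝ] ℝ := fderiv ℝ (D3 u)

lemma Jet.of_hasFDerivAt {F : Type*} [NormedAddCommGroup F] [NormedSpace ℝ F] {f : V → F}
    {f' : V → V →L[ℝ] F} {f'' : V →L[ℝ] V →L[ℝ] F} {x : V}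
    (h : ∀ᶠ y in 𝓝 x, HasFDerivAt f (f' y) y) (h' : HasFDerivAt f' f'' x) (v : V) :
    Jet (fun t : ℝ => f (x + t • v)) (f x) (f' x v) (f'' v v) := by
  have hl : ∀ t : ℝ, HasDerivAt (fun t : ℝ => x + t • v) v t := fun t => by
    simpa using ((hasDerivAt_id t).smul_const v).const_add x
  have htend : Tendsto (fun t : ℝ => x + t • v) (𝓝 0) (𝓝 x) := by
    have := (hl 0).continuousAt.tendsto
    simpa using this
  have := Jet.of_hasDerivAt (f := fun t : ℝ => f (x + t • v)) (f' := fun t => f' (x + t • v) v)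
    (c := f'' v v) ?_ ?_
  · simpa using this
  · filter_upwards [htend.eventually h] with t ht
    exact ht.comp_hasDerivAt t (hl t)
  · have h0 : HasFDerivAt f' f'' (x + (0 : ℝ) • v) := by simpa using h'
    have h1 := h0.comp_hasDerivAt (0 : ℝ) (hl 0)
    exact ((ContinuousLinearMap.apply ℝ F v).hasFDerivAt.comp_hasDerivAt (0 : ℝ) h1)

/-- Currying is an isometry, so Lipschitz hypotheses on `iteratedFDeriv` pass to nested `fderiv`. -/
lemma isometry_iteratedFDeriv_succ {F : Type*} [NormedAddCommGroup F] [NormedSpace ℝ F]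
    (k : ℕ) (f : V → F) (x y : V) :
    edist (iteratedFDeriv ℝ (k + 1) f x) (iteratedFDeriv ℝ (k + 1) f y) =
      edist (iteratedFDeriv ℝ k (fderiv ℝ f) x) (iteratedFDeriv ℝ k (fderiv ℝ f) y) := by
  rw [iteratedFDeriv_succ_eq_comp_right, iteratedFDeriv_succ_eq_comp_right]
  exact (continuousMultilinearCurryRightEquiv' ℝ k (V) F).symm.isometry.edist_eq _ _

lemma edist_iteratedFDeriv_zero {F : Type*} [NormedAddCommGroup F] [NormedSpace ℝ F]
    (f : V → F) (x y : V) :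
    edist (iteratedFDeriv ℝ 0 f x) (iteratedFDeriv ℝ 0 f y) = edist (f x) (f y) := by
  rw [iteratedFDeriv_zero_eq_comp]
  exact (continuousMultilinearCurryFin0 ℝ (V) F).symm.isometry.edist_eq _ _

lemma LocallyLipschitzOn.of_edist_eq {α β γ : Type*} [PseudoEMetricSpace α]
    [PseudoEMetricSpace β] [PseudoEMetricSpace γ] {s : Set α} {f : α → β} {g : α → γ}
    (hf : LocallyLipschitzOn s f) (h : ∀ x y, edist (f x) (f y) = edist (g x) (g y)) :
    LocallyLipschitzOn s g := by
  intro x hx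
  obtain ⟨K, t, ht, hK⟩ := hf hx
  exact ⟨K, t, ht, fun a ha b hb => by rw [← h]; exact hK ha hb⟩

lemma IsCLip1Loc.lipschitz_D3 {n : ℕ} {Ω : Set (E n)} {u : E n → ℝ} (hu : IsCLip1Loc 3 Ω u) :
    LocallyLipschitzOn Ω (D3 u) :=
  LocallyLipschitzOn.of_edist_eq hu.2 fun x y => by
    rw [isometry_iteratedFDeriv_succ, isometry_iteratedFDeriv_succ, isometry_iteratedFDeriv_succ,
      edist_iteratedFDeriv_zero]

lemma IsCLip1Loc.lipschitz_fderiv {n : ℕ} {Ω : Set (E n)} {f : E n → ℝ} (hf : IsCLip1Loc 1 Ω f) :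
    LocallyLipschitzOn Ω (fderiv ℝ f) :=
  LocallyLipschitzOn.of_edist_eq hf.2 fun x y => by
    rw [isometry_iteratedFDeriv_succ, edist_iteratedFDeriv_zero]

lemma hasFDerivAt_D3_apply {u : V → ℝ} {x : V} (h4 : DifferentiableAt ℝ (D3 u) x)
    (a b c : V) : HasFDerivAt (fun y => D3 u y a b c)
      (((ContinuousLinearMap.apply ℝ ℝ c).comp
        ((ContinuousLinearMap.apply ℝ (V →L[ℝ] ℝ) b).comp
          (ContinuousLinearMap.apply ℝ (V →L[ℝ] V →L[ℝ] ℝ) a))).comp (D4 u x)) x :=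
  ((ContinuousLinearMap.apply ℝ ℝ c).comp
        ((ContinuousLinearMap.apply ℝ (V →L[ℝ] ℝ) b).comp
          (ContinuousLinearMap.apply ℝ (V →L[ℝ] V →L[ℝ] ℝ) a))).hasFDerivAt.comp x
      h4.hasFDerivAt

section

variable {Ω : Set V} {u : V → ℝ} (hΩ : IsOpen Ω) (hu : ContDiffOn ℝ 3 u Ω)
include hΩ hu

lemma contDiffOn_D1 : ContDiffOn ℝ 2 (D1 u) Ω :=
  hu.fderiv_of_isOpen hΩ (by norm_num)

lemma contDiffOn_D2 : ContDiffOn ℝ 1 (D2 u) Ω :=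
  (contDiffOn_D1 hΩ hu).fderiv_of_isOpen hΩ (by norm_num)

lemma hasFDerivAt_D0 {x : V} (hx : x ∈ Ω) : HasFDerivAt u (D1 u x) x :=
  ((hu.contDiffAt (hΩ.mem_nhds hx)).differentiableAt (by norm_num)).hasFDerivAt

lemma hasFDerivAt_D1 {x : V} (hx : x ∈ Ω) : HasFDerivAt (D1 u) (D2 u x) x :=
  (((contDiffOn_D1 hΩ hu).contDiffAt (hΩ.mem_nhds hx)).differentiableAt (by norm_num)).hasFDerivAt

lemma hasFDerivAt_D2 {x : V} (hx : x ∈ Ω) : HasFDerivAt (D2 u) (D3 u x) x :=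
  (((contDiffOn_D2 hΩ hu).contDiffAt (hΩ.mem_nhds hx)).differentiableAt (by norm_num)).hasFDerivAt

lemma D2_symm {x : V} (hx : x ∈ Ω) (a b : V) : D2 u x a b = D2 u x b a :=
  second_derivative_symmetric_of_eventually (f := u) (f' := D1 u) (𝕜 := ℝ)
    (by filter_upwards [hΩ.mem_nhds hx] with y hy using hasFDerivAt_D0 hΩ hu hy)
    (hasFDerivAt_D1 hΩ hu hx) a b

lemma D3_symm₁₂ {x : V} (hx : x ∈ Ω) (a b c : V) :
    D3 u x a b c = D3 u x b a c := by
  have := second_derivative_symmetric_of_eventually (f := D1 u) (f' := D2 u) (𝕜 := ℝ)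
    (by filter_upwards [hΩ.mem_nhds hx] with y hy using hasFDerivAt_D1 hΩ hu hy)
    (hasFDerivAt_D2 hΩ hu hx) a b
  rw [this]

lemma D3_symm₂₃ {x : V} (hx : x ∈ Ω) (a b c : V) :
    D3 u x a b c = D3 u x a c b := by
  have h : ∀ b c : V, HasFDerivAt (fun y => D2 u y b c)
      (((ContinuousLinearMap.apply ℝ ℝ c).comp
        (ContinuousLinearMap.apply ℝ (V →L[ℝ] ℝ) b)).comp (D3 u x)) x := fun b c =>
    ((ContinuousLinearMap.apply ℝ ℝ c).comp
        (ContinuousLinearMap.apply ℝ (V →L[ℝ] ℝ) b)).hasFDerivAt.comp x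
      (hasFDerivAt_D2 hΩ hu hx)
  have he : (fun y => D2 u y b c) =ᶠ[𝓝 x] fun y => D2 u y c b := by
    filter_upwards [hΩ.mem_nhds hx] with y hy using D2_symm hΩ hu hy b c
  have := ((h b c).congr_of_eventuallyEq he.symm).unique (h c b)
  simpa using congrArg (fun L => L a) this

lemma D4_symm₁₂ {x : V} (hx : x ∈ Ω) (h4 : DifferentiableAt ℝ (D3 u) x)
    (a b c d : V) : D4 u x a b c d = D4 u x b a c d := by
  have := second_derivative_symmetric_of_eventually (f := D2 u) (f' := D3 u) (𝕜 := ℝ)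
    (by filter_upwards [hΩ.mem_nhds hx] with y hy using hasFDerivAt_D2 hΩ hu hy)
    h4.hasFDerivAt a b
  rw [this]

lemma D4_symm₂₃ {x : V} (hx : x ∈ Ω) (h4 : DifferentiableAt ℝ (D3 u) x)
    (a b c d : V) : D4 u x a b c d = D4 u x a c b d := by
  have he : (fun y => D3 u y b c d) =ᶠ[𝓝 x] fun y => D3 u y c b d := by
    filter_upwards [hΩ.mem_nhds hx] with y hy using D3_symm₁₂ hΩ hu hy b c d
  have := ((hasFDerivAt_D3_apply h4 b c d).congr_of_eventuallyEq he.symm).unique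
    (hasFDerivAt_D3_apply h4 c b d)
  simpa using congrArg (fun L => L a) this

lemma D4_symm₃₄ {x : V} (hx : x ∈ Ω) (h4 : DifferentiableAt ℝ (D3 u) x)
    (a b c d : V) : D4 u x a b c d = D4 u x a b d c := by
  have he : (fun y => D3 u y b c d) =ᶠ[𝓝 x] fun y => D3 u y b d c := by
    filter_upwards [hΩ.mem_nhds hx] with y hy using D3_symm₂₃ hΩ hu hy b c d
  have := ((hasFDerivAt_D3_apply h4 b c d).congr_of_eventuallyEq he.symm).unique
    (hasFDerivAt_D3_apply h4 b d c)
  simpa using congrArg (fun L => L a) this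

/-- With this symmetry the fourth derivatives in the twice expanded equation match those in `∑
(1/λ_c) ∂_{cc} W`. -/
lemma D4_swap {x : V} (hx : x ∈ Ω) (h4 : DifferentiableAt ℝ (D3 u) x)
    (a c : V) : D4 u x c c a a = D4 u x a a c c := by
  rw [D4_symm₂₃ hΩ hu hx h4, D4_symm₁₂ hΩ hu hx h4, D4_symm₃₄ hΩ hu hx h4,
    D4_symm₂₃ hΩ hu hx h4]

lemma jet_D1 {x : V} (hx : x ∈ Ω) (v : V) :
    Jet (fun t : ℝ => D1 u (x + t • v)) (D1 u x) (D2 u x v) (D3 u x v v) :=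
  Jet.of_hasFDerivAt (by filter_upwards [hΩ.mem_nhds hx] with y hy using hasFDerivAt_D1 hΩ hu hy)
    (hasFDerivAt_D2 hΩ hu hx) v

lemma jet_D2 {x : V} (hx : x ∈ Ω) (h4 : DifferentiableAt ℝ (D3 u) x) (v : V) :
    Jet (fun t : ℝ => D2 u (x + t • v)) (D2 u x) (D3 u x v) (D4 u x v v) :=
  Jet.of_hasFDerivAt (by filter_upwards [hΩ.mem_nhds hx] with y hy using hasFDerivAt_D2 hΩ hu hy)
    h4.hasFDerivAt v

end

lemma IsCLip1Loc.exists_lipschitz_D3 {n : ℕ} {Ω : Set (E n)} {u : E n → ℝ} (hΩ : IsOpen Ω)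
    (hu : IsCLip1Loc 3 Ω u) {x : E n} (hx : x ∈ Ω) :
    ∃ R > 0, Metric.closedBall x R ⊆ Ω ∧ ∃ K, LipschitzOnWith K (D3 u) (Metric.closedBall x R) := by
  obtain ⟨K, t, ht, hK⟩ := hu.lipschitz_D3 hx
  have ht' : t ∩ Ω ∈ 𝓝 x := by
    rw [hΩ.nhdsWithin_eq hx] at ht
    exact inter_mem ht (hΩ.mem_nhds hx)
  obtain ⟨R, hR, hsub⟩ := Metric.nhds_basis_closedBall.mem_iff.1 ht'
  exact ⟨R, hR, hsub.trans Set.inter_subset_right, K, hK.mono (hsub.trans Set.inter_subset_left)⟩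

lemma volume_not_differentiableAt {n : ℕ} {F : Type*} [NormedAddCommGroup F] [NormedSpace ℝ F]
    [FiniteDimensional ℝ F] {f : E n → F} {x : E n} {R : ℝ} {K : NNReal}
    (hf : LipschitzOnWith K f (Metric.closedBall x R)) :
    volume {y | y ∈ Metric.ball x R ∧ ¬ DifferentiableAt ℝ f y} = 0 := by
  have h := (hf.mono Metric.ball_subset_closedBall).ae_differentiableWithinAt_of_mem
    (μ := (volume : Measure (E n)))
  rw [ae_iff] at h
  refine measure_mono_null (fun y hy => ?_) h
  simp only [Set.mem_ofPred_eq, Classical.not_imp]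
  exact ⟨hy.1, fun hd => hy.2 (hd.differentiableAt (Metric.isOpen_ball.mem_nhds hy.1))⟩

end Regularity

/-! ### First- and second-order conditions from `c_ε`-concavity. -/

section Concavity

variable {n : ℕ}

lemma inner_gradient (u : E n → ℝ) (x v : E n) : inner ℝ (gradient u x) v = D1 u x v := by
  rw [gradient, InnerProductSpace.toDual_symm_apply]

lemma jet_cost {ε : ℝ} (hε : 0 < ε) (x y v : E n) :
    Jet (fun t : ℝ => cost ε (x + t • v) y) (cost ε x y) (inner ℝ (x - y) v / cost ε x y)
      (‖v‖ ^ 2 / cost ε x y - inner ℝ (x - y) v ^ 2 / cost ε x y ^ 3) := by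
  have hl := Jet.line (x - y) v
  have h1 := (Jet.const (ε ^ 2)).add (hl.inner hl)
  have hpos : 0 < ε ^ 2 + inner ℝ (x - y) (x - y) := by
    rw [real_inner_self_eq_norm_sq]; positivity
  have hc : (ε ^ 2 + inner ℝ (x - y) (x - y)) ^ (1 / 2 : ℝ) = cost ε x y := by
    rw [real_inner_self_eq_norm_sq, cost, Real.sqrt_eq_rpow]
  have hcpos : 0 < cost ε x y := by rw [← hc]; positivity
  have hsq : ε ^ 2 + inner ℝ (x - y) (x - y) = cost ε x y ^ 2 := by
    rw [cost, Real.sq_sqrt (by positivity), real_inner_self_eq_norm_sq]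
  have e1 : (ε ^ 2 + inner ℝ (x - y) (x - y)) ^ (1 / 2 - 1 : ℝ) = (cost ε x y)⁻¹ := by
    rw [hsq, ← Real.rpow_natCast, ← Real.rpow_mul hcpos.le,
      show ((2 : ℕ) : ℝ) * (1 / 2 - 1) = -1 by norm_num, Real.rpow_neg_one]
  have e2 : (ε ^ 2 + inner ℝ (x - y) (x - y)) ^ (1 / 2 - 2 : ℝ) = (cost ε x y ^ 3)⁻¹ := by
    rw [hsq, ← Real.rpow_natCast, ← Real.rpow_mul hcpos.le,
      show ((2 : ℕ) : ℝ) * (1 / 2 - 2) = -((3 : ℕ) : ℝ) by norm_num, Real.rpow_neg hcpos.le,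
      Real.rpow_natCast]
  refine ((h1.rpow hpos (1 / 2)).congr ?_).congr_coeff hc ?_ ?_
  · refine Eventually.of_forall fun t => ?_
    simp only
    rw [cost, Real.sqrt_eq_rpow, real_inner_self_eq_norm_sq,
      show x + t • v - y = x - y + t • v by abel]
  · rw [e1, real_inner_comm v (x - y)]
    field_simp; ring
  · rw [e1, e2, real_inner_comm v (x - y), real_inner_self_eq_norm_sq]
    simp only [inner_zero_left, inner_zero_right]
    field_simp; ring

/-- Consequences of the first and second order conditions at a contact point. -/
lemma IsCConcaveOn.contact {ε : ℝ} (hε : 0 < ε) {Ω : Set (E n)} (hΩ : IsOpen Ω) {u : E n → ℝ}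
    (hu : ContDiffOn ℝ 3 u Ω) (hc : IsCConcaveOn (cost ε) Ω u) {x : E n} (hx : x ∈ Ω) :
    ‖gradient u x‖ < 1 ∧ L ε u x = cost ε x (T ε u x) ∧
      ∀ v, L ε u x * D2 u x v v ≤ ‖v‖ ^ 2 - inner ℝ (gradient u x) v ^ 2 := by
  obtain ⟨y, a, h0, hle⟩ := hc x hx
  set c := cost ε x y with hcdef
  have hsq : c ^ 2 = ε ^ 2 + ‖x - y‖ ^ 2 := by rw [hcdef, cost, Real.sq_sqrt (by positivity)]
  have hcpos : 0 < c := by rw [hcdef, cost]; positivity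
  have hmin : ∀ v, inner ℝ (x - y) v / c + -(D1 u x v) = 0 ∧
      0 ≤ (‖v‖ ^ 2 / c - inner ℝ (x - y) v ^ 2 / c ^ 3) + -(D2 u x v v) := by
    intro v
    have hju : Jet (fun t : ℝ => u (x + t • v)) (u x) (D1 u x v) (D2 u x v v) :=
      Jet.of_hasFDerivAt
        (by filter_upwards [hΩ.mem_nhds hx] with z hz using hasFDerivAt_D0 hΩ hu hz)
        (hasFDerivAt_D1 hΩ hu hx) v
    have hj := ((jet_cost hε x y v).add hju.neg).add (Jet.const a)
    have hj' : Jet (fun t : ℝ => cost ε (x + t • v) y + -u (x + t • v) + a) 0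
        (inner ℝ (x - y) v / c + -(D1 u x v))
        ((‖v‖ ^ 2 / c - inner ℝ (x - y) v ^ 2 / c ^ 3) + -(D2 u x v v)) :=
      hj.congr_coeff (by rw [h0]; ring) (by rw [add_zero]) (by rw [add_zero])
    refine hj'.minimum ?_
    have htend : Tendsto (fun t : ℝ => x + t • v) (𝓝 0) (𝓝 x) := (Jet.line x v).tendsto
    filter_upwards [htend.eventually (hΩ.mem_nhds hx)] with t ht
    linarith [hle _ ht]
  have hp : gradient u x = c⁻¹ • (x - y) := by
    refine ext_inner_right ℝ fun v => ?_
    rw [inner_gradient, inner_smul_left]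
    have := (hmin v).1
    simp only [conj_trivial]
    rw [inv_mul_eq_div]; linarith
  -- From this identity `L = c`, and then `T x` is the contact parameter `y`.
  have hnorm : 1 - ‖gradient u x‖ ^ 2 = ε ^ 2 / c ^ 2 := by
    rw [hp, norm_smul, mul_pow, norm_inv, Real.norm_eq_abs, abs_of_pos hcpos]
    field_simp; linarith
  have hL : L ε u x = c := by
    rw [L, hnorm, ← div_pow, Real.sqrt_sq (by positivity)]
    field_simp
  have hT : T ε u x = y := by
    rw [T, hL, hp, smul_smul, mul_inv_cancel₀ hcpos.ne', one_smul]; abel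
  refine ⟨?_, by rw [hL, hT], fun v => ?_⟩
  · have : 0 < 1 - ‖gradient u x‖ ^ 2 := by rw [hnorm]; positivity
    nlinarith [norm_nonneg (gradient u x)]
  · have := (hmin v).2
    rw [hL, hp, inner_smul_left]
    simp only [conj_trivial]
    have h3 : c * (‖v‖ ^ 2 / c - inner ℝ (x - y) v ^ 2 / c ^ 3) =
        ‖v‖ ^ 2 - (c⁻¹ * inner ℝ (x - y) v) ^ 2 := by field_simp
    rw [← h3]
    exact mul_le_mul_of_nonneg_left (by linarith) hcpos.le

end Concavity

/-! ### Frames adapted to `I - Du ⊗ Du` and `D²u`. -/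

section Frames

variable {n : ℕ}

lemma inner_eq_sum (y z : E n) : inner ℝ y z = ∑ i, y i * z i := by
  rw [PiLp.inner_apply]
  exact Finset.sum_congr rfl fun i _ => mul_comm _ _

/-- A basis which is orthonormal for `⟪·, ·⟫ - p ⊗ p` and diagonalizes the bilinear form `M`. -/
structure IsFrame (p : E n) (s : ℝ) (M : E n →L[ℝ] E n →L[ℝ] ℝ) (v : Fin n → E n)
    (κ : Fin n → ℝ) : Prop where
  orth : ∀ a b, inner ℝ (v a) (v b) - inner ℝ p (v a) * inner ℝ p (v b) = if a = b then 1 else 0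
  diag : ∀ a b, M (v a) (v b) = s * (if a = b then κ a else 0)
  -- The inverse of `I - p ⊗ p` is `I + Q ⊗ Q` with `Q = s⁻¹ p`, and it equals `∑ v_a ⊗ v_a`.
  complete : ∀ y z, inner ℝ y z =
    ∑ a, inner ℝ y (v a) * inner ℝ z (v a) - inner ℝ (s⁻¹ • p) y * inner ℝ (s⁻¹ • p) z
  det : (Matrix.of fun i a => v a i).det ^ 2 * s ^ 2 = 1

lemma exists_isFrame {p : E n} {s : ℝ} (hs : 0 < s) (hsp : ‖p‖ ^ 2 = 1 - s ^ 2)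
    (M : E n →L[ℝ] E n →L[ℝ] ℝ) (hM : ∀ y z, M y z = M z y) :
    ∃ v κ, IsFrame p s M v κ := by
  -- With this `c` the map `R = I + c p ⊗ p` is `(I - p ⊗ p)^(-1/2)`: its eigenvalue on `p` is `1 +
  -- c |p|² = 1/s`. The frame is the image under `R` of an orthonormal eigenbasis of `R M R`.
  set c : ℝ := 1 / (s * (1 + s)) with hc
  have hcs : 1 + c * (1 - s ^ 2) = s⁻¹ := by rw [hc]; field_simp; ring
  have hcc : 2 * c + c ^ 2 * (1 - s ^ 2) = (s ^ 2)⁻¹ := by rw [hc]; field_simp; ring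
  set R : E n →ₗ[ℝ] E n := LinearMap.id + c • (innerₛₗ ℝ p).smulRight p with hR
  have hRa : ∀ y, R y = y + (c * inner ℝ p y) • p := fun y => by
    simp [hR, smul_smul]
  have hpp : inner ℝ p p = 1 - s ^ 2 := by rw [real_inner_self_eq_norm_sq, hsp]
  have hRsymm : ∀ y z, inner ℝ (R y) z = inner ℝ y (R z) := fun y z => by
    rw [hRa, hRa, inner_add_left, inner_add_right, inner_smul_left, inner_smul_right]
    simp only [conj_trivial]
    rw [real_inner_comm p y]; ring
  have hRR : ∀ y z, inner ℝ (R y) (R z) =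
      inner ℝ y z + (s ^ 2)⁻¹ * (inner ℝ p y * inner ℝ p z) := fun y z => by
    rw [hRa, hRa]
    simp only [inner_add_left, inner_add_right, inner_smul_left, inner_smul_right, conj_trivial]
    rw [real_inner_comm p y, hpp, ← hcc]; ring
  have hpR : ∀ y, inner ℝ p (R y) = s⁻¹ * inner ℝ p y := fun y => by
    rw [hRa, inner_add_right, inner_smul_right, hpp, ← hcs]; ring
  set S : E n →ₗ[ℝ] E n := LinearMap.comp R
    (((InnerProductSpace.toDual ℝ (E n)).symm.toLinearEquiv.toLinearMap.comp
      (M : E n →ₗ[ℝ] E n →L[ℝ] ℝ)).comp R) with hS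
  have hSi : ∀ y z, inner ℝ (S y) z = M (R y) (R z) := fun y z => by
    simp only [hS, LinearMap.comp_apply]
    rw [hRsymm]
    exact InnerProductSpace.toDual_symm_apply
  have hsym : S.IsSymmetric := fun y z => by
    rw [hSi, real_inner_comm, hSi, hM]
  have hfin : Module.finrank ℝ (E n) = n := by simp
  set b := hsym.eigenvectorBasis hfin with hb
  have hbe : ∀ a a', inner ℝ (b a) (b a') = if a = a' then (1 : ℝ) else 0 := fun a a' =>
    orthonormal_iff_ite.1 b.orthonormal a a'
  have horth : ∀ a a', inner ℝ (R (b a)) (R (b a')) -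
      inner ℝ p (R (b a)) * inner ℝ p (R (b a')) = if a = a' then 1 else 0 := fun a a' => by
    rw [hRR, hpR, hpR, hbe]; field_simp; ring
  refine ⟨fun a => R (b a), fun a => s⁻¹ * hsym.eigenvalues hfin a, horth, ?_, ?_, ?_⟩
  · intro a a'
    rw [← hSi, hb, hsym.apply_eigenvectorBasis, ← hb, inner_smul_left, hbe]
    simp only [RCLike.ofReal_real_eq_id, id_eq, conj_trivial]
    split_ifs
    · field_simp
    · simp
  · intro y z
    have h1 : ∑ a, inner ℝ y (R (b a)) * inner ℝ z (R (b a)) = inner ℝ (R y) (R z) := by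
      rw [← b.sum_inner_mul_inner]
      refine Finset.sum_congr rfl fun a _ => ?_
      rw [← hRsymm, ← hRsymm, real_inner_comm (R z)]
    rw [h1, hRR, inner_smul_left, inner_smul_left]
    simp only [conj_trivial]
    field_simp; ring
  · set Q : Matrix (Fin n) (Fin n) ℝ := Matrix.of fun i a => R (b a) i with hQ
    set r : Fin n → ℝ := fun a => inner ℝ p (R (b a)) with hr
    -- By orthonormality for `I - p ⊗ p`, the Gram matrix is a rank-one perturbation of the
    -- identity, with determinant `1 + |r|² = s⁻²`.
    have hG : Q.transpose * Q =
        1 + Matrix.replicateCol Unit r * Matrix.replicateRow Unit r := by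
      ext a a'
      have h1 : (Q.transpose * Q) a a' = inner ℝ (R (b a)) (R (b a')) := by
        rw [inner_eq_sum, Matrix.mul_apply]
        rfl
      have h2 : (Matrix.replicateCol Unit r * Matrix.replicateRow Unit r) a a' = r a * r a' := by
        simp [Matrix.mul_apply]
      rw [h1, Matrix.add_apply, h2, Matrix.one_apply, ← horth a a', hr]
      simp only [sub_add_cancel]
    have hd := congrArg Matrix.det hG
    rw [Matrix.det_mul, Matrix.det_transpose,
      Matrix.det_one_add_replicateCol_mul_replicateRow] at hd
    have hrr : r ⬝ᵥ r = (s ^ 2)⁻¹ * (1 - s ^ 2) := by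
      have : r ⬝ᵥ r = ∑ a, (s⁻¹ * inner ℝ p (b a)) * (s⁻¹ * inner ℝ (b a) p) := by
        rw [dotProduct]
        refine Finset.sum_congr rfl fun a _ => ?_
        rw [hr]; simp only; rw [hpR, real_inner_comm p (b a)]
      rw [this]
      have h2 := b.sum_inner_mul_inner p p
      rw [hpp] at h2
      rw [← h2, Finset.mul_sum]
      refine Finset.sum_congr rfl fun a _ => ?_
      field_simp
    rw [hrr] at hd
    rw [sq, hd]; field_simp; ring

end Frames

/-! ### Coordinate formulas for `w`, its determinant and `W`. -/

section Formulas

variable {n : ℕ}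

lemma bilin_eq_sum (M : E n →L[ℝ] E n →L[ℝ] ℝ) (y z : E n) :
    M y z = ∑ i, ∑ j, y i * z j *
      M (EuclideanSpace.single i 1) (EuclideanSpace.single j 1) := by
  have h : ∀ y : E n, y = ∑ i, y i • EuclideanSpace.single i (1 : ℝ) := fun y => by
    have := (EuclideanSpace.basisFun (Fin n) ℝ).sum_repr y
    simpa using this.symm
  conv_lhs => rw [h y, h z]
  simp only [map_sum, map_smul, sum_apply, smul_apply, smul_eq_mul, Finset.mul_sum, mul_assoc]
  rw [Finset.sum_comm]
  exact Finset.sum_congr rfl fun i _ => Finset.sum_congr rfl fun j _ => by ring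

lemma hess_apply {u : E n → ℝ} {x : E n} (h : HasFDerivAt (D1 u) (D2 u x) x) (i j : Fin n) :
    hess u x i j = D2 u x (EuclideanSpace.single j 1) (EuclideanSpace.single i 1) := by
  have h1 : HasFDerivAt (fun z => fderiv ℝ u z (EuclideanSpace.single i 1))
      ((ContinuousLinearMap.apply ℝ ℝ (EuclideanSpace.single i (1 : ℝ) : E n)).comp (D2 u x)) x :=
    (ContinuousLinearMap.apply ℝ ℝ (EuclideanSpace.single i (1 : ℝ) : E n)).hasFDerivAt.comp x h
  rw [hess, Matrix.of_apply, h1.fderiv]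
  rfl

/-- The bilinear form `L w`. -/
def Bform (ε : ℝ) (u : E n → ℝ) (x y z : E n) : ℝ :=
  inner ℝ y z - D1 u x y * D1 u x z - L ε u x * D2 u x y z

lemma L_pos {ε : ℝ} (hε : 0 < ε) {u : E n → ℝ} {x : E n} (h : ‖gradient u x‖ < 1) :
    0 < L ε u x := by
  have : 0 < 1 - ‖gradient u x‖ ^ 2 := by nlinarith [norm_nonneg (gradient u x)]
  rw [L]; positivity

lemma sum_w_eq_Bform {ε : ℝ} {u : E n → ℝ} {x : E n} (h : HasFDerivAt (D1 u) (D2 u x) x)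
    (hL : L ε u x ≠ 0) (y z : E n) :
    ∑ i, ∑ j, y i * w ε u x i j * z j = (L ε u x)⁻¹ * Bform ε u x z y := by
  have h1 : ∑ i, ∑ j, y i * z j * (if i = j then (1 : ℝ) else 0) = inner ℝ z y := by
    rw [inner_eq_sum]
    simp [mul_comm]
  have hg : ∀ y : E n, D1 u x y = ∑ i, y i * gradient u x i := fun y => by
    rw [← inner_gradient, inner_eq_sum]
    exact Finset.sum_congr rfl fun i _ => mul_comm _ _
  have h2 : ∑ i, ∑ j, y i * z j * (gradient u x i * gradient u x j) = D1 u x z * D1 u x y := by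
    rw [hg z, hg y, mul_comm, Finset.sum_mul_sum]
    exact Finset.sum_congr rfl fun i _ => Finset.sum_congr rfl fun j _ => by ring
  have h3 : ∑ i, ∑ j, y i * z j * hess u x i j = D2 u x z y := by
    rw [bilin_eq_sum, Finset.sum_comm]
    exact Finset.sum_congr rfl fun i _ => Finset.sum_congr rfl fun j _ => by
      rw [hess_apply h]; ring
  rw [Bform, ← h1, ← h2, ← h3]
  simp only [Finset.mul_sum, ← Finset.sum_sub_distrib]
  refine Finset.sum_congr rfl fun i _ => Finset.sum_congr rfl fun j _ => ?_
  rw [w, Matrix.sub_apply, A, Matrix.of_apply]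
  field_simp

lemma det_Bform {ε : ℝ} {u : E n → ℝ} {x : E n} (h : HasFDerivAt (D1 u) (D2 u x) x)
    (hL : L ε u x ≠ 0) (v : Fin n → E n) :
    (Matrix.of fun a b => Bform ε u x (v a) (v b)).det =
      L ε u x ^ n * (w ε u x).det * (Matrix.of fun i a => v a i).det ^ 2 := by
  set Q : Matrix (Fin n) (Fin n) ℝ := Matrix.of fun i a => v a i with hQ
  have : (Matrix.of fun a b => Bform ε u x (v a) (v b)).transpose =
      L ε u x • (Q.transpose * w ε u x * Q) := by
    ext a b
    rw [Matrix.smul_apply, Matrix.transpose_apply, Matrix.of_apply, Matrix.mul_apply]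
    have := sum_w_eq_Bform h hL (v a) (v b)
    rw [eq_inv_mul_iff_mul_eq₀ hL] at this
    rw [← this, smul_eq_mul, Finset.sum_comm]
    congr 1
    refine Finset.sum_congr rfl fun j _ => ?_
    rw [Matrix.mul_apply, Finset.sum_mul]
    rfl
  rw [← Matrix.det_transpose, this, Matrix.det_smul, Matrix.det_mul, Matrix.det_mul,
    Matrix.det_transpose, Fintype.card_fin]
  ring

/-- Sherman–Morrison: the inverse of `A` is `L (I + σ⁻¹ Du ⊗ Du)` with `σ = 1 - |Du|²`. -/
lemma W_eq {ε : ℝ} (hε : 0 < ε) {u : E n → ℝ} {x : E n} (h : HasFDerivAt (D1 u) (D2 u x) x)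
    (hp : ‖gradient u x‖ < 1) :
    W ε u x = n - L ε u x * (∑ i, D2 u x (EuclideanSpace.single i 1) (EuclideanSpace.single i 1)
      + D2 u x (gradient u x) (gradient u x) / (1 - ‖gradient u x‖ ^ 2)) := by
  set l := L ε u x with hl
  have hL : l ≠ 0 := (L_pos hε hp).ne'
  set σ := 1 - ‖gradient u x‖ ^ 2 with hσ
  have hσ0 : σ ≠ 0 := by
    have : 0 < 1 - ‖gradient u x‖ ^ 2 := by nlinarith [norm_nonneg (gradient u x)]
    exact this.ne'
  set P : Fin n → ℝ := fun i => gradient u x i with hP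
  have hPP : P ⬝ᵥ P = 1 - σ := by
    rw [hσ, sub_sub_cancel, ← real_inner_self_eq_norm_sq, inner_eq_sum]; rfl
  have hA : A ε u x = l⁻¹ • (1 - Matrix.vecMulVec P P) := by
    ext i j
    simp [A, Matrix.vecMulVec_apply, Matrix.one_apply, hP, hl]
  set I : Matrix (Fin n) (Fin n) ℝ := l • (1 + σ⁻¹ • Matrix.vecMulVec P P) with hI
  have hAI : A ε u x * I = 1 := by
    rw [hA, hI, smul_mul_smul_comm, inv_mul_cancel₀ hL, one_smul, mul_add, mul_one,
      mul_smul_comm, sub_mul, one_mul, Matrix.vecMulVec_mul_vecMulVec, hPP]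
    ext i j
    simp [Matrix.vecMulVec_apply]
    field_simp; ring
  have hinv : (A ε u x)⁻¹ = I := Matrix.inv_eq_right_inv hAI
  have hIA : ∑ α, ∑ β, I α β * A ε u x α β = n := by
    have h1 : (I * (A ε u x).transpose).trace = n := by
      have : (A ε u x).transpose = A ε u x := by
        rw [hA]; ext i j; simp [Matrix.vecMulVec_apply, Matrix.one_apply, eq_comm, mul_comm]
      rw [this, mul_eq_one_comm.1 hAI, Matrix.trace_one, Fintype.card_fin]
    rw [← h1, Matrix.trace]
    refine Finset.sum_congr rfl fun α _ => ?_
    rw [Matrix.diag_apply, Matrix.mul_apply]; rfl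
  have hIh : ∑ α, ∑ β, I α β * hess u x α β =
      l * (∑ i, D2 u x (EuclideanSpace.single i 1) (EuclideanSpace.single i 1)
      + D2 u x (gradient u x) (gradient u x) / σ) := by
    rw [bilin_eq_sum (D2 u x) (gradient u x), Finset.sum_comm, Finset.sum_div,
      ← Finset.sum_add_distrib, Finset.mul_sum]
    refine Finset.sum_congr rfl fun β _ => ?_
    have : D2 u x (EuclideanSpace.single β 1) (EuclideanSpace.single β 1) =
        ∑ α, (if α = β then (1 : ℝ) else 0) * hess u x α β := by
      simp [hess_apply h]
    rw [this, Finset.sum_div, ← Finset.sum_add_distrib, Finset.mul_sum]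
    refine Finset.sum_congr rfl fun α _ => ?_
    rw [hI, Matrix.smul_apply, Matrix.add_apply, Matrix.smul_apply, Matrix.one_apply,
      Matrix.vecMulVec_apply, hess_apply h, smul_eq_mul, smul_eq_mul]
    field_simp
    simp only [hP]
    ring
  rw [← hIh, ← hIA, W, hinv]
  simp only [w, Matrix.sub_apply, mul_sub, Finset.sum_sub_distrib]

end Formulas

/-! ### Linear algebra in an adapted frame. -/

section FrameCalculus

variable {n : ℕ} {p : E n} {s : ℝ} {M : E n →L[ℝ] E n →L[ℝ] ℝ} {v : Fin n → E n} {κ : Fin n → ℝ}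

lemma IsFrame.expand (F : IsFrame p s M v κ) (y : E n) :
    y = ∑ a, inner ℝ y (v a) • v a - inner ℝ (s⁻¹ • p) y • (s⁻¹ • p) := by
  refine ext_inner_right ℝ fun z => ?_
  rw [F.complete y z, inner_sub_left, sum_inner, real_inner_smul_left (s⁻¹ • p)]
  congr 1
  exact Finset.sum_congr rfl fun a _ => by rw [real_inner_smul_left, real_inner_comm z (v a)]

/-- Expand the slope `Q = s⁻¹ p` itself and use `1 + |Q|² = s⁻²`. The coefficients `q_a = s ⟪p,
v_a⟫` carry all dependence on the slope in the later formulas. -/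
lemma IsFrame.slope_eq (F : IsFrame p s M v κ) (hs : 0 < s) (hsp : ‖p‖ ^ 2 = 1 - s ^ 2) :
    s⁻¹ • p = ∑ a, (s * inner ℝ p (v a)) • v a := by
  have h := F.expand (s⁻¹ • p)
  have h1 : inner ℝ (s⁻¹ • p) (s⁻¹ • p) = (s ^ 2)⁻¹ - 1 := by
    rw [inner_smul_left, inner_smul_right, real_inner_self_eq_norm_sq, hsp]
    simp only [conj_trivial]
    field_simp
  rw [h1] at h
  have h2 : ∑ a, inner ℝ (s⁻¹ • p) (v a) • v a = (s ^ 2)⁻¹ • ∑ a, (s * inner ℝ p (v a)) • v a := by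
    rw [Finset.smul_sum]
    refine Finset.sum_congr rfl fun a _ => ?_
    rw [inner_smul_left, smul_smul]
    simp only [conj_trivial]
    congr 1; field_simp
  rw [h2] at h
  have h3 : (s ^ 2)⁻¹ • (s⁻¹ • p) = (s ^ 2)⁻¹ • ∑ a, (s * inner ℝ p (v a)) • v a := by
    rw [sub_smul, one_smul] at h
    have h4 := sub_eq_iff_eq_add.1 (show s⁻¹ • p - s⁻¹ • p = 0 from sub_self _)
    generalize (s ^ 2)⁻¹ • (s⁻¹ • p) = X at h ⊢
    generalize (s ^ 2)⁻¹ • ∑ a, (s * inner ℝ p (v a)) • v a = Y at h ⊢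
    have : s⁻¹ • p = Y - X + s⁻¹ • p := by rw [sub_add]; exact h
    have h5 : Y - X = 0 := by simpa using this.symm
    exact (sub_eq_zero.1 h5).symm
  have h6 : (s ^ 2)⁻¹ ≠ 0 := by positivity
  exact (smul_right_injective _ h6) h3

/-- At the base point the subtracted term cancels the `Du`-term of `W_eq`, which turns `W` into a
trace over the frame. -/
lemma IsFrame.trace (F : IsFrame p s M v κ) (N : E n →L[ℝ] E n →L[ℝ] ℝ) :
    ∑ i, N (EuclideanSpace.single i 1) (EuclideanSpace.single i 1) =
      ∑ a, N (v a) (v a) - N (s⁻¹ • p) (s⁻¹ • p) := by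
  have h : ∀ i j, ∑ a, v a i * v a j - (s⁻¹ • p) i * (s⁻¹ • p) j =
      if i = j then (1 : ℝ) else 0 := fun i j => by
    have := F.complete (EuclideanSpace.single i 1) (EuclideanSpace.single j 1)
    simp only [EuclideanSpace.inner_single_left, EuclideanSpace.inner_single_right, map_one,
      one_mul, PiLp.single_apply, conj_trivial] at this
    rw [← this]
    simp only [eq_comm]
  have h1 : ∑ a, N (v a) (v a) = ∑ i, ∑ j, (∑ a, v a i * v a j) *
      N (EuclideanSpace.single i 1) (EuclideanSpace.single j 1) := by
    simp only [bilin_eq_sum N (v _) (v _), Finset.sum_mul]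
    rw [Finset.sum_comm]
    exact Finset.sum_congr rfl fun i _ => Finset.sum_comm
  rw [h1, bilin_eq_sum N (s⁻¹ • p), ← Finset.sum_sub_distrib]
  refine Finset.sum_congr rfl fun i _ => ?_
  rw [← Finset.sum_sub_distrib]
  simp only [← sub_mul, h]
  simp

lemma IsFrame.M_slope (F : IsFrame p s M v κ) (hs : 0 < s) (hsp : ‖p‖ ^ 2 = 1 - s ^ 2)
    (c : Fin n) : M (v c) (s⁻¹ • p) = s * κ c * (s * inner ℝ p (v c)) := by
  rw [F.slope_eq hs hsp, map_sum]
  simp only [map_smul, F.diag, smul_eq_mul]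
  simp; ring

lemma IsFrame.M_apply (F : IsFrame p s M v κ) (hs : 0 < s) (hsp : ‖p‖ ^ 2 = 1 - s ^ 2)
    (c : Fin n) (y : E n) : M (v c) y =
      s * κ c * (inner ℝ (v c) y - s * inner ℝ p (v c) * inner ℝ (s⁻¹ • p) y) := by
  conv_lhs => rw [F.expand y]
  rw [map_sub, map_sum, map_smul, F.M_slope hs hsp]
  simp only [map_smul, F.diag, smul_eq_mul]
  simp only [mul_ite, mul_zero, Finset.sum_ite_eq, Finset.mem_univ, if_true]
  rw [real_inner_comm y (v c)]; ring

lemma IsFrame.M_slope_apply (F : IsFrame p s M v κ) (hs : 0 < s) (hsp : ‖p‖ ^ 2 = 1 - s ^ 2)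
    (y : E n) : M (s⁻¹ • p) y = s * (∑ a, κ a * (s * inner ℝ p (v a)) * inner ℝ (v a) y
      - (∑ a, κ a * (s * inner ℝ p (v a)) ^ 2) * inner ℝ (s⁻¹ • p) y) := by
  conv_lhs => rw [F.slope_eq hs hsp]
  rw [map_sum, sum_apply, Finset.sum_mul, ← Finset.sum_sub_distrib, Finset.mul_sum]
  refine Finset.sum_congr rfl fun a _ => ?_
  rw [map_smul, smul_apply, F.M_apply hs hsp, smul_eq_mul]
  ring

lemma IsFrame.M_slope_slope (F : IsFrame p s M v κ) (hs : 0 < s) (hsp : ‖p‖ ^ 2 = 1 - s ^ 2) :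
    M (s⁻¹ • p) (s⁻¹ • p) = s * ∑ a, κ a * (s * inner ℝ p (v a)) ^ 2 := by
  have h : ∀ y, M (s⁻¹ • p) y = ∑ a, (s * inner ℝ p (v a)) * M (v a) y := fun y => by
    conv_lhs => rw [F.slope_eq hs hsp]
    rw [map_sum, sum_apply]
    exact Finset.sum_congr rfl fun a _ => by rw [map_smul, smul_apply, smul_eq_mul]
  rw [h, Finset.mul_sum]
  refine Finset.sum_congr rfl fun a _ => ?_
  rw [F.M_slope hs hsp]
  ring

end FrameCalculus

/-! ### Expansions of `Du`, `1 - |Du|²`, its power `-1/2` and `L w` along frame vectors. -/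

section GradientJets

variable {n : ℕ} {Ω : Set (E n)} {u : E n → ℝ}

/-- Riesz representation. -/
abbrev riesz (l : E n →L[ℝ] ℝ) : E n := (InnerProductSpace.toDual ℝ (E n)).symm l

/-- The Riesz representation as a continuous linear map. -/
def rieszL (n : ℕ) : (E n →L[ℝ] ℝ) →L[ℝ] E n :=
  LinearMap.mkContinuous
    { toFun := riesz
      map_add' := fun a b => map_add _ a b
      map_smul' := fun a b => by simp [riesz] } 1 fun l => by simp

lemma rieszL_apply (l : E n →L[ℝ] ℝ) : rieszL n l = riesz l := rfl

lemma inner_riesz (l : E n →L[ℝ] ℝ) (y : E n) : inner ℝ (riesz l) y = l y :=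
  InnerProductSpace.toDual_symm_apply

lemma Jet.apply {F G : Type*} [NormedAddCommGroup F] [NormedSpace ℝ F] [NormedAddCommGroup G]
    [NormedSpace ℝ G] {f : ℝ → F →L[ℝ] G} {g : ℝ → F} {a b c : F →L[ℝ] G} {a' b' c' : F}
    (hf : Jet f a b c) (hg : Jet g a' b' c') :
    Jet (fun t => f t (g t)) (a a') (b a' + a b') (c a' + (2 : ℝ) • b b' + a c') := by
  simpa using Jet.bilin (ContinuousLinearMap.id ℝ (F →L[ℝ] G)) hf hg

lemma jet_gradient (hΩ : IsOpen Ω) (hu : ContDiffOn ℝ 3 u Ω) {x : E n} (hx : x ∈ Ω) (v : E n) :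
    Jet (fun t : ℝ => gradient u (x + t • v)) (gradient u x) (riesz (D2 u x v))
      (riesz (D3 u x v v)) :=
  (jet_D1 hΩ hu hx v).clm
    (rieszL n)

lemma jet_D1_apply (hΩ : IsOpen Ω) (hu : ContDiffOn ℝ 3 u Ω) {x : E n} (hx : x ∈ Ω) (v y : E n) :
    Jet (fun t : ℝ => D1 u (x + t • v) y) (D1 u x y) (D2 u x v y) (D3 u x v v y) :=
  (jet_D1 hΩ hu hx v).clm (ContinuousLinearMap.apply ℝ ℝ y)

lemma jet_D2_apply (hΩ : IsOpen Ω) (hu : ContDiffOn ℝ 3 u Ω) {x : E n} (hx : x ∈ Ω)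
    (h4 : DifferentiableAt ℝ (D3 u) x) (v y z : E n) :
    Jet (fun t : ℝ => D2 u (x + t • v) y z) (D2 u x y z) (D3 u x v y z) (D4 u x v v y z) :=
  (jet_D2 hΩ hu hx h4 v).clm ((ContinuousLinearMap.apply ℝ ℝ z).comp
    (ContinuousLinearMap.apply ℝ (E n →L[ℝ] ℝ) y))

/-- `1 - |Du|²`. -/
def sig (u : E n → ℝ) (x : E n) : ℝ := 1 - ‖gradient u x‖ ^ 2

lemma sig_pos {x : E n} (h : ‖gradient u x‖ < 1) : 0 < sig u x := by
  rw [sig]; nlinarith [norm_nonneg (gradient u x)]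

/-- `(1 - |Du|²)^(-1/2)`. -/
def rho (u : E n → ℝ) (x : E n) : ℝ := sig u x ^ (-1 / 2 : ℝ)

lemma rho_eq {x : E n} {s : ℝ} (hs : 0 < s) (hσ : sig u x = s ^ 2) : rho u x = s⁻¹ := by
  rw [rho, hσ, ← Real.rpow_natCast, ← Real.rpow_mul hs.le,
    show ((2 : ℕ) : ℝ) * (-1 / 2) = -1 by norm_num, Real.rpow_neg_one]

lemma L_eq_rho {ε : ℝ} {x : E n} (h : ‖gradient u x‖ < 1) : L ε u x = ε * rho u x := by
  have hs := Real.sqrt_pos.2 (sig_pos h)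
  rw [rho_eq hs (Real.sq_sqrt (sig_pos h).le).symm, L, sig, div_eq_mul_inv]

lemma rho_sq {x : E n} (h : ‖gradient u x‖ < 1) : rho u x ^ 2 = (sig u x)⁻¹ := by
  have hs := Real.sqrt_pos.2 (sig_pos h)
  rw [rho_eq hs (Real.sq_sqrt (sig_pos h).le).symm, inv_pow, Real.sq_sqrt (sig_pos h).le]

section Direction

variable (hΩ : IsOpen Ω) (hu : ContDiffOn ℝ 3 u Ω) {x : E n} (hx : x ∈ Ω) {s : ℝ} (hs : 0 < s)
  (hσ : sig u x = s ^ 2) {v : Fin n → E n} {κ : Fin n → ℝ}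
  (F : IsFrame (gradient u x) s (D2 u x) v κ)
include hΩ hu hx hs hσ F

omit hΩ hu hx hs F in
lemma norm_gradient_sq : ‖gradient u x‖ ^ 2 = 1 - s ^ 2 := by rw [← hσ, sig]; ring

omit hΩ hu hx in
lemma riesz_D2_frame (c : Fin n) : riesz (D2 u x (v c)) =
    (s * κ c) • (v c - (s * inner ℝ (gradient u x) (v c)) • (s⁻¹ • gradient u x)) := by
  refine ext_inner_right ℝ fun y => ?_
  rw [inner_riesz, F.M_apply hs (norm_gradient_sq hσ), real_inner_smul_left (v c - _),
    inner_sub_left, real_inner_smul_left (s⁻¹ • gradient u x)]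

lemma jet_sig (c : Fin n) : Jet (fun t : ℝ => sig u (x + t • v c)) (s ^ 2)
    (-2 * s ^ 2 * κ c * (s * inner ℝ (gradient u x) (v c)))
    (-2 * s ^ 2 * κ c ^ 2 * (1 - (s * inner ℝ (gradient u x) (v c)) ^ 2)
      - 2 * s * D3 u x (v c) (v c) (s⁻¹ • gradient u x)) := by
  have hsp := norm_gradient_sq hσ
  have hg := jet_gradient hΩ hu hx (v c)
  have hpq : gradient u x = s • (s⁻¹ • gradient u x) := by
    rw [smul_smul, mul_inv_cancel₀ hs.ne', one_smul]
  have e1 : inner ℝ (riesz (D2 u x (v c))) (gradient u x) =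
      s ^ 2 * κ c * (s * inner ℝ (gradient u x) (v c)) := by
    rw [inner_riesz]
    conv_lhs => rw [hpq]
    rw [map_smul, F.M_slope hs hsp, smul_eq_mul]; ring
  have e2 : inner ℝ (riesz (D3 u x (v c) (v c))) (gradient u x) =
      s * D3 u x (v c) (v c) (s⁻¹ • gradient u x) := by
    rw [inner_riesz]
    conv_lhs => rw [hpq]
    rw [map_smul, smul_eq_mul]
  have e3 : inner ℝ (riesz (D2 u x (v c))) (riesz (D2 u x (v c))) =
      s ^ 2 * κ c ^ 2 * (1 - (s * inner ℝ (gradient u x) (v c)) ^ 2) := by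
    rw [inner_riesz, riesz_D2_frame hs hσ F, map_smul, map_sub, map_smul, F.M_slope hs hsp, F.diag]
    simp only [smul_eq_mul, if_true]
    ring
  refine (((Jet.const 1).sub (hg.inner hg)).congr ?_).congr_coeff ?_ ?_ ?_
  · refine Eventually.of_forall fun t => ?_
    simp only [sig, real_inner_self_eq_norm_sq]
  · rw [real_inner_self_eq_norm_sq, hsp]; ring
  · rw [real_inner_comm (riesz _) (gradient u x), e1]; ring
  · rw [real_inner_comm (riesz _) (gradient u x), e2, e3]; ring

lemma jet_rho (c : Fin n) : Jet (fun t : ℝ => rho u (x + t • v c)) s⁻¹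
    (s⁻¹ * κ c * (s * inner ℝ (gradient u x) (v c)))
    (s⁻¹ * (s⁻¹ * D3 u x (v c) (v c) (s⁻¹ • gradient u x)
      + κ c ^ 2 * (1 + 2 * (s * inner ℝ (gradient u x) (v c)) ^ 2))) := by
  have h := (jet_sig hΩ hu hx hs hσ F c).rpow (by positivity) (-1 / 2)
  have e : ∀ (k : ℕ) (r : ℝ), 2 * r = -(k : ℝ) → (s ^ 2) ^ r = (s ^ k)⁻¹ := fun k r hr => by
    rw [← Real.rpow_natCast s 2, ← Real.rpow_mul hs.le, Nat.cast_ofNat, hr, Real.rpow_neg hs.le,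
      Real.rpow_natCast]
  have e0 := e 1 (-1 / 2) (by norm_num)
  have e1 := e 3 (-1 / 2 - 1) (by norm_num)
  have e2 := e 5 (-1 / 2 - 2) (by norm_num)
  refine h.congr_coeff ?_ ?_ ?_
  · rw [e0, pow_one]
  · rw [e1]; field_simp
  · rw [e1, e2]; field_simp; ring

lemma jet_Bform {ε : ℝ} (hp : ∀ y ∈ Ω, ‖gradient u y‖ < 1) (h4 : DifferentiableAt ℝ (D3 u) x)
    (c : Fin n) (y z : E n) :
    Jet (fun t : ℝ => Bform ε u (x + t • v c) y z) (Bform ε u x y z)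
      (-(D2 u x (v c) y * D1 u x z + D1 u x y * D2 u x (v c) z)
        - ε * (s⁻¹ * κ c * (s * inner ℝ (gradient u x) (v c)) * D2 u x y z
          + s⁻¹ * D3 u x (v c) y z))
      (-(D3 u x (v c) (v c) y * D1 u x z + 2 * (D2 u x (v c) y * D2 u x (v c) z)
          + D1 u x y * D3 u x (v c) (v c) z)
        - ε * (s⁻¹ * (s⁻¹ * D3 u x (v c) (v c) (s⁻¹ • gradient u x)
            + κ c ^ 2 * (1 + 2 * (s * inner ℝ (gradient u x) (v c)) ^ 2)) * D2 u x y z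
          + 2 * (s⁻¹ * κ c * (s * inner ℝ (gradient u x) (v c)) * D3 u x (v c) y z)
          + s⁻¹ * D4 u x (v c) (v c) y z)) := by
  have hj := ((Jet.const (inner ℝ y z)).sub
    ((jet_D1_apply hΩ hu hx (v c) y).mul (jet_D1_apply hΩ hu hx (v c) z))).sub
    (((jet_rho hΩ hu hx hs hσ F c).const_mul ε).mul (jet_D2_apply hΩ hu hx h4 (v c) y z))
  have htend : Tendsto (fun t : ℝ => x + t • v c) (𝓝 0) (𝓝 x) := (Jet.line x (v c)).tendsto
  refine (hj.congr ?_).congr_coeff ?_ ?_ ?_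
  · filter_upwards [htend.eventually (hΩ.mem_nhds hx)] with t ht
    rw [Bform, L_eq_rho (hp _ ht)]
  · rw [Bform, L_eq_rho (hp _ hx), rho_eq hs hσ]
  · ring
  · ring

end Direction

end GradientJets

/-! ### Expansions of `T` and `W` along frame vectors. -/

section TraceJets

variable {n : ℕ} {Ω : Set (E n)} {u : E n → ℝ}

/-- The algebra behind the expansion of `D²u(Du, Du)` along `v_c`: here `y` is the slope `s⁻¹ Du`,
`z` is `v_c`, `q` is `q_c`, and the indexed letters are the coefficients of `D²u` and `Du`. -/
lemma quadratic_jet_coeffs {M M₁ M₂ : E n →L[ℝ] E n →L[ℝ] ℝ} {p p₁ p₂ y z : E n}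
    {s k q K R : ℝ} (hp : p = s • y) (hp₁ : p₁ = (s * k) • (z - q • y))
    (hM : ∀ a b, M a b = M b a) (hM₁ : ∀ a b, M₁ a b = M₁ b a) (hyy : M y y = s * K)
    (hzy : M z y = s * k * q) (hzz : M z z = s * k) (hR : M y p₂ = s * R) :
    M p p = s ^ 3 * K ∧
    (M₁ p + M p₁) p + (M p) p₁ = s ^ 2 * M₁ y y + 2 * s ^ 3 * k * (k * q - q * K) ∧
    (M₂ p + (2 : ℝ) • M₁ p₁ + M p₂) p + (2 : ℝ) • (M₁ p + M p₁) p₁ + (M p) p₂ =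
      s ^ 2 * M₂ y y + 4 * s ^ 2 * k * (M₁ z y - q * M₁ y y) + 2 * s ^ 2 * R
        + 2 * s ^ 3 * k ^ 2 * (k - 2 * k * q ^ 2 + q ^ 2 * K) := by
  have hyz : M y z = s * k * q := by rw [hM, hzy]
  have hR' : M p₂ y = s * R := by rw [hM, hR]
  have h1 := hM₁ y z
  subst hp hp₁
  simp only [map_smul, map_sub, add_apply, smul_apply, sub_apply, smul_eq_mul, hyy, hzy, hzz,
    hyz, hR, hR', h1]
  refine ⟨by ring, by ring, by ring⟩

section Direction

variable (hΩ : IsOpen Ω) (hu : ContDiffOn ℝ 3 u Ω) {x : E n} (hx : x ∈ Ω) {s : ℝ} (hs : 0 < s)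
  (hσ : sig u x = s ^ 2) {v : Fin n → E n} {κ : Fin n → ℝ}
  (F : IsFrame (gradient u x) s (D2 u x) v κ) {ε : ℝ} (hε : 0 < ε)
  (hp : ∀ y ∈ Ω, ‖gradient u y‖ < 1)
include hΩ hu hx hs hσ F hp

/-- The frame consists of eigenvectors of `DT`. At second order the slope components of `D³u` coming
from `L` and from `Du` cancel, which leaves only contractions with frame vectors. -/
lemma jet_T (c : Fin n) : Jet (fun t : ℝ => T ε u (x + t • v c)) (T ε u x)
    ((1 - ε * κ c) • v c)
    (-ε • (κ c ^ 2 • (s⁻¹ • gradient u x)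
      + (2 * κ c ^ 2 * (s * inner ℝ (gradient u x) (v c))) • v c
      + ∑ a, (s⁻¹ * D3 u x (v c) (v c) (v a)) • v a)) := by
  have hsp := norm_gradient_sq hσ
  have hj := (Jet.line x (v c)).sub (((jet_rho hΩ hu hx hs hσ F c).const_mul ε).smul
    (jet_gradient hΩ hu hx (v c)))
  have htend : Tendsto (fun t : ℝ => x + t • v c) (𝓝 0) (𝓝 x) := (Jet.line x (v c)).tendsto
  have hpy : gradient u x = s • (s⁻¹ • gradient u x) := by
    rw [smul_smul, mul_inv_cancel₀ hs.ne', one_smul]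
  have hp2 : riesz (D3 u x (v c) (v c)) = ∑ a, D3 u x (v c) (v c) (v a) • v a
      - D3 u x (v c) (v c) (s⁻¹ • gradient u x) • (s⁻¹ • gradient u x) := by
    have := F.expand (riesz (D3 u x (v c) (v c)))
    rw [real_inner_comm (riesz _) (s⁻¹ • gradient u x)] at this
    simpa only [inner_riesz] using this
  have hp2' : s⁻¹ • riesz (D3 u x (v c) (v c)) = ∑ a, (s⁻¹ * D3 u x (v c) (v c) (v a)) • v a
      - (s⁻¹ * D3 u x (v c) (v c) (s⁻¹ • gradient u x)) • (s⁻¹ • gradient u x) := by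
    rw [hp2, smul_sub, Finset.smul_sum, smul_smul]
    simp only [smul_smul]
  have hp1 := riesz_D2_frame hs hσ F c
  refine (hj.congr ?_).congr_coeff ?_ ?_ ?_
  · filter_upwards [htend.eventually (hΩ.mem_nhds hx)] with t ht
    rw [T, L_eq_rho (hp _ ht)]
  · rw [T, L_eq_rho (hp _ hx), rho_eq hs hσ]
  · rw [hp1]
    generalize s * inner ℝ (gradient u x) (v c) = q
    match_scalars
    · field_simp
    · field_simp
      ring
  · have e : (ε * s⁻¹) • riesz (D3 u x (v c) (v c)) = ε • (s⁻¹ • riesz (D3 u x (v c) (v c))) := by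
      rw [smul_smul]
    rw [e, hp2', hp1]
    generalize s * inner ℝ (gradient u x) (v c) = q
    generalize ∑ a, (s⁻¹ * D3 u x (v c) (v c) (v a)) • v a = S
    generalize D3 u x (v c) (v c) (s⁻¹ • gradient u x) = U
    match_scalars
    all_goals field_simp
    all_goals ring

-- The expansion is made in fixed Euclidean coordinates; only its coefficients at `t = 0` are
-- converted to the frame, by `IsFrame.trace`.
include hε in
lemma jet_W (h4 : DifferentiableAt ℝ (D3 u) x) (c : Fin n) :
    Jet (fun t : ℝ => W ε u (x + t • v c)) (n - ε * ∑ a, κ a)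
      (-ε * (∑ a, s⁻¹ * D3 u x (v c) (v a) (v a)
        + κ c * (s * inner ℝ (gradient u x) (v c)) * ∑ a, κ a
        + 2 * κ c ^ 2 * (s * inner ℝ (gradient u x) (v c))))
      (-ε * (∑ a, s⁻¹ * D4 u x (v c) (v c) (v a) (v a)
        + 2 * κ c * (s * inner ℝ (gradient u x) (v c)) * ∑ a, s⁻¹ * D3 u x (v c) (v a) (v a)
        + (∑ a, κ a + 4 * κ c) * (s⁻¹ * D3 u x (v c) (v c) (s⁻¹ • gradient u x))
        + 2 * ∑ b, κ b * (s * inner ℝ (gradient u x) (v b)) * (s⁻¹ * D3 u x (v c) (v c) (v b))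
        + κ c ^ 2 * (∑ a, κ a) * (1 + 2 * (s * inner ℝ (gradient u x) (v c)) ^ 2)
        + κ c ^ 3 * (2 + 8 * (s * inner ℝ (gradient u x) (v c)) ^ 2)
        + 2 * κ c ^ 2 * ∑ a, κ a * (s * inner ℝ (gradient u x) (v a)) ^ 2)) := by
  have hsp := norm_gradient_sq hσ
  have hg := jet_gradient hΩ hu hx (v c)
  have hρ := jet_rho hΩ hu hx hs hσ F c
  have hΔ := Jet.sum Finset.univ fun i _ => jet_D2_apply hΩ hu hx h4 (v c)
    (EuclideanSpace.single i 1) (EuclideanSpace.single i 1)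
  have hE := ((jet_D2 hΩ hu hx h4 (v c)).apply hg).apply hg
  have hj := (Jet.const (n : ℝ)).sub ((hρ.const_mul ε).mul (hΔ.add ((hρ.mul hρ).mul hE)))
  have htend : Tendsto (fun t : ℝ => x + t • v c) (𝓝 0) (𝓝 x) := (Jet.line x (v c)).tendsto
  have hpy : gradient u x = s • (s⁻¹ • gradient u x) := by
    rw [smul_smul, mul_inv_cancel₀ hs.ne', one_smul]
  have hR : D2 u x (s⁻¹ • gradient u x) (riesz (D3 u x (v c) (v c))) =
      s * (∑ b, κ b * (s * inner ℝ (gradient u x) (v b)) * D3 u x (v c) (v c) (v b)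
      - (∑ a, κ a * (s * inner ℝ (gradient u x) (v a)) ^ 2)
        * D3 u x (v c) (v c) (s⁻¹ • gradient u x)) := by
    rw [F.M_slope_apply hs hsp, real_inner_comm (riesz _) (s⁻¹ • gradient u x), inner_riesz]
    congr 2
    exact Finset.sum_congr rfl fun a _ => by rw [real_inner_comm (riesz _) (v a), inner_riesz]
  obtain ⟨hE0, hE1, hE2⟩ := quadratic_jet_coeffs (M := D2 u x) (M₁ := D3 u x (v c))
    (M₂ := D4 u x (v c) (v c)) hpy (riesz_D2_frame hs hσ F c) (D2_symm hΩ hu hx)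
    (D3_symm₂₃ hΩ hu hx (v c)) (F.M_slope_slope hs hsp) (F.M_slope hs hsp c)
    (by rw [F.diag, if_pos rfl]) hR
  have hdiag : ∑ a, D2 u x (v a) (v a) = s * ∑ a, κ a := by
    rw [Finset.mul_sum]
    exact Finset.sum_congr rfl fun a _ => by rw [F.diag, if_pos rfl]
  have hκs : ∑ b, κ b * (s * inner ℝ (gradient u x) (v b)) * (s⁻¹ * D3 u x (v c) (v c) (v b)) =
      s⁻¹ * ∑ b, κ b * (s * inner ℝ (gradient u x) (v b)) * D3 u x (v c) (v c) (v b) := by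
    rw [Finset.mul_sum]
    exact Finset.sum_congr rfl fun a _ => by ring
  refine (hj.congr ?_).congr_coeff ?_ ?_ ?_
  · filter_upwards [htend.eventually (hΩ.mem_nhds hx)] with t ht
    rw [W_eq hε (hasFDerivAt_D1 hΩ hu ht) (hp _ ht), L_eq_rho (hp _ ht), ← sq, rho_sq (hp _ ht),
      sig, div_eq_inv_mul]
  · rw [F.trace, hE0, F.M_slope_slope hs hsp, hdiag]
    field_simp; ring
  · rw [F.trace, F.trace, hE0, hE1, F.M_slope_slope hs hsp, hdiag, ← Finset.mul_sum]
    generalize s * inner ℝ (gradient u x) (v c) = q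
    field_simp; ring
  · rw [F.trace, F.trace, F.trace, hE0, hE1, hE2, F.M_slope_slope hs hsp, hdiag, hκs,
      ← Finset.mul_sum, ← Finset.mul_sum]
    generalize s * inner ℝ (gradient u x) (v c) = q
    field_simp; ring

end Direction

end TraceJets

/-! ### Concavity of `log det` and the determinant of a perturbed frame. -/

section LogDet

variable {n : ℕ}

/-- The tangent plane inequality for the concave function `log det` at a diagonal matrix. -/
lemma log_det_le {S : Matrix (Fin n) (Fin n) ℝ} (hS : S.PosSemidef) (hdet : 0 < S.det)
    {l : Fin n → ℝ} (hl : ∀ a, 0 < l a) :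
    Real.log S.det ≤ ∑ a, (S a a * (l a)⁻¹ + (-1 + Real.log (l a))) := by
  -- Congruence by this matrix moves the base point to the identity, where the claim is `log t ≤ t -
  -- 1` summed over eigenvalues.
  set R : Matrix (Fin n) (Fin n) ℝ := Matrix.diagonal fun a => (√(l a))⁻¹ with hR
  set S' := R.conjTranspose * S * R with hS'
  have hps : S'.PosSemidef := hS.conjTranspose_mul_mul_same R
  have hRc : R.conjTranspose = R := by
    rw [hR, Matrix.diagonal_conjTranspose]; simp
  have hdR : R.det ^ 2 = (∏ a, l a)⁻¹ := by
    rw [hR, Matrix.det_diagonal, ← Finset.prod_pow, ← Finset.prod_inv_distrib]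
    exact Finset.prod_congr rfl fun a _ => by rw [inv_pow, Real.sq_sqrt (hl a).le]
  have hdS : S'.det = S.det * (∏ a, l a)⁻¹ := by
    rw [hS', hRc, Matrix.det_mul, Matrix.det_mul, ← hdR]; ring
  have hprod : 0 < ∏ a, l a := Finset.prod_pos fun a _ => hl a
  have hdS0 : 0 < S'.det := by rw [hdS]; positivity
  have htr : S'.trace = ∑ a, S a a * (l a)⁻¹ := by
    rw [Matrix.trace]
    refine Finset.sum_congr rfl fun a _ => ?_
    rw [Matrix.diag_apply, hS', hRc, hR, Matrix.mul_diagonal, Matrix.diagonal_mul]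
    have := Real.sq_sqrt (hl a).le
    have h2 := Real.sqrt_pos.2 (hl a)
    have h3 : (√(l a))⁻¹ * (√(l a))⁻¹ = (l a)⁻¹ := by rw [← mul_inv, ← sq, this]
    rw [← h3]; ring
  have hev : ∀ i, 0 < hps.1.eigenvalues i := by
    have h1 := hps.1.det_eq_prod_eigenvalues
    intro i
    refine lt_of_le_of_ne (hps.eigenvalues_nonneg i) fun h0 => ?_
    rw [h1] at hdS0
    refine hdS0.ne' (Finset.prod_eq_zero (Finset.mem_univ i) ?_)
    simpa using h0.symm
  have hlog : Real.log S'.det ≤ S'.trace - n := by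
    rw [hps.1.det_eq_prod_eigenvalues, hps.1.trace_eq_sum_eigenvalues]
    simp only [RCLike.ofReal_real_eq_id, id_eq]
    rw [Real.log_prod fun i _ => (hev i).ne']
    have : (n : ℝ) = ∑ _i : Fin n, (1 : ℝ) := by simp
    rw [this, ← Finset.sum_sub_distrib]
    exact Finset.sum_le_sum fun i _ => Real.log_le_sub_one_of_pos (hev i)
  rw [hdS, Real.log_mul hdet.ne' (inv_ne_zero hprod.ne'), Real.log_inv,
    Real.log_prod fun a _ => (hl a).ne', htr] at hlog
  have : ∑ a, (S a a * (l a)⁻¹ + (-1 + Real.log (l a))) =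
      ∑ a, S a a * (l a)⁻¹ - n + ∑ a, Real.log (l a) := by
    rw [Finset.sum_add_distrib, Finset.sum_add_distrib]
    simp; ring
  rw [this]; linarith

/-- The matrix determinant lemma for the moving frame of `directional_concavity`; it is exact in
`τ`, so no expansion of the determinant is needed. -/
lemma det_add_column (v : Fin n → E n) {y : E n} {q : Fin n → ℝ} (hy : y = ∑ a, q a • v a)
    (c : Fin n) (τ : ℝ) :
    (Matrix.of fun i a => (v a + (if a = c then τ else 0) • y) i).det =
      (Matrix.of fun i a => v a i).det * (1 + τ * q c) := by
  have h : (Matrix.of fun i a => (v a + (if a = c then τ else 0) • y) i) =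
      (Matrix.of fun i a => v a i) * (1 + Matrix.replicateCol Unit q *
        Matrix.replicateRow Unit fun a => if a = c then τ else 0) := by
    ext i a
    have hyi : y i = ∑ b, v b i * q b := by
      rw [hy, WithLp.ofLp_sum, Finset.sum_apply]
      exact Finset.sum_congr rfl fun b _ => by simp [mul_comm]
    rw [mul_add, mul_one, Matrix.add_apply, Matrix.mul_apply, Matrix.of_apply, Matrix.of_apply]
    simp only [PiLp.add_apply, PiLp.smul_apply, smul_eq_mul, Matrix.mul_apply, Finset.univ_unique,
      Finset.sum_singleton, Matrix.replicateCol_apply, Matrix.replicateRow_apply, Matrix.of_apply]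
    rw [hyi, Finset.mul_sum]
    congr 1
    exact Finset.sum_congr rfl fun b _ => by ring
  rw [h, Matrix.det_mul, Matrix.det_one_add_replicateCol_mul_replicateRow]
  congr 2
  simp [dotProduct]

lemma Bform_sum (ε : ℝ) (u : E n → ℝ) (x : E n) (z : Fin n → ℝ) (y : Fin n → E n) :
    Bform ε u x (∑ a, z a • y a) (∑ a, z a • y a) =
      ∑ a, ∑ b, z a * z b * Bform ε u x (y a) (y b) := by
  have e1 : inner ℝ (∑ a, z a • y a) (∑ a, z a • y a) =
      ∑ a, ∑ b, z a * z b * inner ℝ (y a) (y b) := by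
    simp only [sum_inner, inner_sum, real_inner_smul_left, real_inner_smul_right, mul_assoc]
    rw [Finset.sum_comm]
    exact Finset.sum_congr rfl fun a _ => Finset.sum_congr rfl fun b _ => by ring
  have e2 : D1 u x (∑ a, z a • y a) * D1 u x (∑ a, z a • y a) =
      ∑ a, ∑ b, z a * z b * (D1 u x (y a) * D1 u x (y b)) := by
    rw [map_sum, Finset.sum_mul_sum]
    simp only [map_smul, smul_eq_mul]
    exact Finset.sum_congr rfl fun a _ => Finset.sum_congr rfl fun b _ => by ring
  have e3 : D2 u x (∑ a, z a • y a) (∑ a, z a • y a) =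
      ∑ a, ∑ b, z a * z b * D2 u x (y a) (y b) := by
    simp only [map_sum, sum_apply, map_smul, smul_apply, smul_eq_mul, Finset.mul_sum]
    rw [Finset.sum_comm]
    exact Finset.sum_congr rfl fun a _ => Finset.sum_congr rfl fun b _ => by ring
  rw [Bform, e1, e2, e3]
  simp only [Finset.mul_sum, ← Finset.sum_sub_distrib, Bform]
  exact Finset.sum_congr rfl fun a _ => Finset.sum_congr rfl fun b _ => by ring

lemma posSemidef_Bform {ε : ℝ} {u : E n → ℝ} {x : E n} (hs : ∀ a b, D2 u x a b = D2 u x b a)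
    (h : ∀ z, 0 ≤ Bform ε u x z z) (y : Fin n → E n) :
    (Matrix.of fun a b => Bform ε u x (y a) (y b)).PosSemidef := by
  refine Matrix.PosSemidef.of_dotProduct_mulVec_nonneg ?_ fun z => ?_
  · ext a b
    rw [Matrix.conjTranspose_apply, Matrix.of_apply, Matrix.of_apply, star_trivial, Bform, Bform,
      hs (y b), real_inner_comm (y a)]; ring
  · have := h (∑ a, z a • y a)
    rw [Bform_sum] at this
    refine this.trans_eq (Eq.symm ?_)
    rw [star_trivial, dotProduct]
    refine Finset.sum_congr rfl fun a _ => ?_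
    rw [Matrix.mulVec, dotProduct, Finset.mul_sum]
    exact Finset.sum_congr rfl fun b _ => by rw [Matrix.of_apply]; ring

lemma Bform_add_smul {ε : ℝ} {u : E n → ℝ} {x : E n} (hs : ∀ a b, D2 u x a b = D2 u x b a)
    (y z : E n) (τ : ℝ) : Bform ε u x (y + τ • z) (y + τ • z) =
      Bform ε u x y y + 2 * (τ * Bform ε u x z y) + τ * τ * Bform ε u x z z := by
  simp only [Bform, inner_add_left, inner_add_right, real_inner_smul_left, real_inner_smul_right,
    map_add, map_smul, add_apply, smul_apply, smul_eq_mul]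
  rw [hs y z, real_inner_comm z y]; ring

end LogDet

/-! ### Values of `L w` on the frame and the slope. -/

section FrameValues

variable {n : ℕ} {u : E n → ℝ} {x : E n} {s : ℝ} (hs : 0 < s)
  (hσ : sig u x = s ^ 2) {v : Fin n → E n} {κ : Fin n → ℝ}
  (F : IsFrame (gradient u x) s (D2 u x) v κ) {ε : ℝ} (hL : L ε u x = ε * s⁻¹)
include hs

omit hs in
include hσ in
lemma D1_slope : D1 u x (s⁻¹ • gradient u x) = s⁻¹ * (1 - s ^ 2) := by
  rw [← inner_gradient, inner_smul_right, real_inner_self_eq_norm_sq, norm_gradient_sq hσ]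

lemma D1_frame {v : Fin n → E n} (a : Fin n) :
    D1 u x (v a) = s⁻¹ * (s * inner ℝ (gradient u x) (v a)) := by
  rw [← inner_gradient]; field_simp

include F

include hL

lemma Bform_frame (a b : Fin n) :
    Bform ε u x (v a) (v b) = if a = b then 1 - ε * κ a else 0 := by
  rw [Bform, hL, F.diag, ← inner_gradient, ← inner_gradient, F.orth]
  split_ifs
  · field_simp
  · ring

include hσ

lemma Bform_slope_frame (c : Fin n) : Bform ε u x (s⁻¹ • gradient u x) (v c) =
    (s * inner ℝ (gradient u x) (v c)) * (1 - ε * κ c) := by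
  have hsp := norm_gradient_sq hσ
  have h1 : D2 u x (s⁻¹ • gradient u x) (v c) = s * κ c * (s * inner ℝ (gradient u x) (v c)) := by
    rw [F.M_slope_apply hs hsp]
    have h := F.M_slope_apply hs hsp (v c)
    conv_lhs => rw [← F.M_slope_apply hs hsp (v c), F.slope_eq hs hsp]
    rw [map_sum, sum_apply]
    simp only [map_smul, smul_apply, F.diag, smul_eq_mul]
    simp; ring
  rw [Bform, hL, h1, D1_slope hσ, D1_frame hs, inner_smul_left]
  simp only [conj_trivial]
  field_simp; ring

lemma Bform_slope_slope : Bform ε u x (s⁻¹ • gradient u x) (s⁻¹ • gradient u x) =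
    1 - s ^ 2 - ε * ∑ a, κ a * (s * inner ℝ (gradient u x) (v a)) ^ 2 := by
  have hsp := norm_gradient_sq hσ
  rw [Bform, hL, F.M_slope_slope hs hsp, D1_slope hσ, inner_smul_left, inner_smul_right,
    real_inner_self_eq_norm_sq, hsp]
  simp only [conj_trivial]
  field_simp; ring

end FrameValues

/-! ### The equation expanded to second order along one frame vector. -/

section Directional

variable {n : ℕ} {Ω : Set (E n)} {u : E n → ℝ}
variable (hΩ : IsOpen Ω) (hu : ContDiffOn ℝ 3 u Ω) {x : E n} (hx : x ∈ Ω) {s : ℝ} (hs : 0 < s)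
  (hσ : sig u x = s ^ 2) {v : Fin n → E n} {κ : Fin n → ℝ}
  (F : IsFrame (gradient u x) s (D2 u x) v κ) {ε : ℝ} (hε : 0 < ε)
  (hp : ∀ y ∈ Ω, ‖gradient u y‖ < 1)
  (hB : ∀ y ∈ Ω, ∀ z, 0 ≤ Bform ε u y z z) {φ : E n → ℝ} (hφ : ∀ y ∈ Ω, 0 < φ y)
  (heq : ∀ y ∈ Ω, (w ε u y).det = ε ^ 2 / L ε u y ^ (n + 2) * φ y)
include hΩ hu hx hs hσ F hε hp hB hφ heq

-- Of the factor `L^(n+2)` in the equation, `L^n` is used up by passing from `w` to `L w`; what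
-- remains is `ε² / L² = 1 - |Du|²`.
omit hx hs hσ F hB hφ in
lemma det_Bform_eq {y : E n} (hy : y ∈ Ω) (v : Fin n → E n) :
    (Matrix.of fun a b => Bform ε u y (v a) (v b)).det =
      sig u y * φ y * (Matrix.of fun i a => v a i).det ^ 2 := by
  have hL := L_pos hε (hp y hy)
  rw [det_Bform (hasFDerivAt_D1 hΩ hu hy) hL.ne', heq y hy]
  have h1 : sig u y = ε ^ 2 / L ε u y ^ 2 := by
    rw [L_eq_rho (hp y hy), mul_pow, rho_sq (hp y hy)]
    have := sig_pos (hp y hy)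
    field_simp
  rw [h1, pow_add]
  field_simp

lemma lam_pos (a : Fin n) : 0 < 1 - ε * κ a := by
  have hL : L ε u x = ε * s⁻¹ := by rw [L_eq_rho (hp x hx), rho_eq hs hσ]
  have h0 : ∀ a, 0 ≤ 1 - ε * κ a := fun a => by
    have := hB x hx (v a)
    rwa [Bform_frame hs F hL, if_pos rfl] at this
  have hd := det_Bform_eq hΩ hu hε hp heq hx v
  have hdiag : (Matrix.of fun a b => Bform ε u x (v a) (v b)) =
      Matrix.diagonal fun a => 1 - ε * κ a := by
    ext a b
    rw [Matrix.of_apply, Bform_frame hs F hL, Matrix.diagonal_apply]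
  rw [hdiag, Matrix.det_diagonal, hσ] at hd
  refine lt_of_le_of_ne (h0 a) fun h => ?_
  rw [Finset.prod_eq_zero (Finset.mem_univ a) h.symm] at hd
  have h2 := F.det
  have h3 := hφ x hx
  have : s ^ 2 * φ x * (Matrix.of fun i a => v a i).det ^ 2 = φ x := by
    calc _ = φ x * ((Matrix.of fun i a => v a i).det ^ 2 * s ^ 2) := by ring
      _ = φ x := by rw [h2, mul_one]
  rw [this] at hd
  exact h3.ne hd

omit hB hφ in
lemma prod_lam : ∏ a, (1 - ε * κ a) = φ x := by
  have hL : L ε u x = ε * s⁻¹ := by rw [L_eq_rho (hp x hx), rho_eq hs hσ]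
  have hd := det_Bform_eq hΩ hu hε hp heq hx v
  have hdiag : (Matrix.of fun a b => Bform ε u x (v a) (v b)) =
      Matrix.diagonal fun a => 1 - ε * κ a := by
    ext a b
    rw [Matrix.of_apply, Bform_frame hs F hL, Matrix.diagonal_apply]
  rw [hdiag, Matrix.det_diagonal, hσ] at hd
  rw [hd]
  calc _ = φ x * ((Matrix.of fun i a => v a i).det ^ 2 * s ^ 2) := by ring
    _ = φ x := by rw [F.det, mul_one]

omit hΩ hu hx hs hσ F hε hp hB hφ heq in
lemma sum_ite_add_mul (c : Fin n) (X : ℝ) (Y Z : Fin n → ℝ) :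
    ∑ a, ((if a = c then X else 0) + Y a) * Z a = X * Z c + ∑ a, Y a * Z a := by
  simp [add_mul, Finset.sum_add_distrib]

/-- First and second order consequences, along a frame vector, of the concavity of `log det`. -/
lemma directional_concavity (h4 : DifferentiableAt ℝ (D3 u) x) (c : Fin n) {ψ : ℝ → ℝ}
    {φ₁ φ₂ : ℝ} (hψ : Jet ψ (Real.log (φ x)) φ₁ φ₂)
    (hle : ∀ᶠ t in 𝓝 (0 : ℝ), ψ t ≤ Real.log (φ (x + t • v c))) :
    φ₁ = ∑ a, (-ε * (κ c * (s * inner ℝ (gradient u x) (v c)) * κ a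
        + s⁻¹ * D3 u x (v c) (v a) (v a))) * (1 - ε * κ a)⁻¹
        - 2 * ε * κ c ^ 2 * (s * inner ℝ (gradient u x) (v c)) * (1 - ε * κ c)⁻¹ ∧
    φ₂ ≤ ∑ a, (-2 * (s * inner ℝ (gradient u x) (v a)) * (s⁻¹ * D3 u x (v c) (v c) (v a))
        - ε * ((s⁻¹ * D3 u x (v c) (v c) (s⁻¹ • gradient u x)
            + κ c ^ 2 * (1 + 2 * (s * inner ℝ (gradient u x) (v c)) ^ 2)) * κ a
          + 2 * (κ c * (s * inner ℝ (gradient u x) (v c)) * (s⁻¹ * D3 u x (v c) (v a) (v a)))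
          + s⁻¹ * D4 u x (v c) (v c) (v a) (v a))) * (1 - ε * κ a)⁻¹
        + (-2 * s ^ 2 * κ c ^ 2
          - 4 * κ c ^ 2 * ((s * inner ℝ (gradient u x) (v c)) ^ 2 + (1 - s ^ 2))
          - 4 * ε * κ c ^ 3 * (s * inner ℝ (gradient u x) (v c)) ^ 2
          - 4 * ε * κ c * (s⁻¹ * D3 u x (v c) (v c) (s⁻¹ • gradient u x))
          + 2 * κ c ^ 2 * (1 - s ^ 2 - ε * ∑ a, κ a * (s * inner ℝ (gradient u x) (v a)) ^ 2))
          * (1 - ε * κ c)⁻¹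
        + 2 * κ c ^ 2 * (1 + 2 * (s * inner ℝ (gradient u x) (v c)) ^ 2)
        + 2 * (s⁻¹ * D3 u x (v c) (v c) (s⁻¹ • gradient u x)) := by
  have hsp := norm_gradient_sq hσ
  have hL : L ε u x = ε * s⁻¹ := by rw [L_eq_rho (hp x hx), rho_eq hs hσ]
  have hlam := lam_pos hΩ hu hx hs hσ F hε hp hB hφ heq
  set q : Fin n → ℝ := fun a => s * inner ℝ (gradient u x) (v a) with hq
  set y : E n := s⁻¹ • gradient u x with hy
  set d : ℝ := (Matrix.of fun i a => v a i).det with hd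
  have hd0 : d ≠ 0 := fun h => by
    have := F.det
    rw [← hd, h] at this
    simp at this
  -- The correction of the single vector `v c` keeps the frame orthonormal, to first order in `t`,
  -- for the form `I - Du ⊗ Du` at `x + t v_c`.
  set V : ℝ → Fin n → E n := fun t a => v a + (if a = c then t * κ c else 0) • y with hV
  set S : ℝ → Matrix (Fin n) (Fin n) ℝ :=
    fun t => Matrix.of fun a b => Bform ε u (x + t • v c) (V t a) (V t b) with hS
  have htend : Tendsto (fun t : ℝ => x + t • v c) (𝓝 0) (𝓝 x) := (Jet.line x (v c)).tendsto
  have hevΩ : ∀ᶠ t in 𝓝 (0 : ℝ), x + t • v c ∈ Ω := htend.eventually (hΩ.mem_nhds hx)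
  have hJlin : Jet (fun t : ℝ => 1 + t * κ c * q c) 1 (κ c * q c) 0 :=
    ((Jet.const 1).add ((Jet.id.mul (Jet.const (κ c))).mul (Jet.const (q c)))).congr_coeff
      (by ring) (by ring) (by ring)
  have hevlin : ∀ᶠ t in 𝓝 (0 : ℝ), 0 < 1 + t * κ c * q c :=
    hJlin.tendsto.eventually (lt_mem_nhds one_pos)
  have hyq : y = ∑ a, q a • v a := F.slope_eq hs hsp
  have hdet : ∀ᶠ t in 𝓝 (0 : ℝ), 0 < (S t).det ∧ Real.log (S t).det =
      Real.log (sig u (x + t • v c)) + 2 * Real.log (1 + t * κ c * q c) + Real.log (d ^ 2)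
        + Real.log (φ (x + t • v c)) := by
    filter_upwards [hevΩ, hevlin] with t ht htl
    have h1 : (S t).det = sig u (x + t • v c) * φ (x + t • v c) *
        (d * (1 + t * κ c * q c)) ^ 2 := by
      rw [hS, hd, ← det_add_column v hyq c]
      exact det_Bform_eq hΩ hu hε hp heq ht (V t)
    have h2 := sig_pos (hp _ ht)
    have h3 := hφ _ ht
    refine ⟨by rw [h1]; positivity, ?_⟩
    rw [h1, mul_pow, Real.log_mul (by positivity) (by positivity), Real.log_mul h2.ne' h3.ne',
      Real.log_mul (by positivity) (by positivity),
      show Real.log ((1 + t * κ c * q c) ^ 2) = 2 * Real.log (1 + t * κ c * q c) by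
        rw [Real.log_pow]; norm_num]
    ring
  -- The tangent plane at the diagonal matrix sees only the diagonal of `S t`, so no products of
  -- third derivatives arise from off-diagonal entries. The expression vanishes at `t = 0`, hence it
  -- has a minimum there.
  have hnonneg : ∀ᶠ t in 𝓝 (0 : ℝ), 0 ≤ ∑ a, (S t a a * (1 - ε * κ a)⁻¹
      + (-1 + Real.log (1 - ε * κ a))) - (Real.log (sig u (x + t • v c))
        + 2 * Real.log (1 + t * κ c * q c) + Real.log (d ^ 2)) - ψ t := by
    filter_upwards [hevΩ, hdet, hle] with t ht h1 h2
    have h3 := log_det_le (posSemidef_Bform (D2_symm hΩ hu ht) (hB _ ht) (V t)) h1.1 hlam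
    have h4 := h1.2
    simp only [hS] at h4 ⊢
    rw [h4] at h3
    linarith
  -- expansions of the diagonal entries
  have hτ : ∀ a, Jet (fun t : ℝ => if a = c then t * κ c else 0) 0
      (if a = c then κ c else 0) 0 := fun a => by
    by_cases hac : a = c
    · simp only [hac, if_true]
      exact (Jet.id.mul (Jet.const (κ c))).congr_coeff (by ring) (by ring) (by ring)
    · simp only [hac, if_false]
      exact Jet.const 0
  have hSa : ∀ a, Jet (fun t => S t a a) (1 - ε * κ a)
      ((if a = c then (-2 * κ c * q c + 2 * κ c * (q c * (1 - ε * κ c))) else 0)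
        - ε * (κ c * q c * κ a + s⁻¹ * D3 u x (v c) (v a) (v a)))
      ((-2 * q a * (s⁻¹ * D3 u x (v c) (v c) (v a))
        - ε * ((s⁻¹ * D3 u x (v c) (v c) y + κ c ^ 2 * (1 + 2 * q c ^ 2)) * κ a
          + 2 * (κ c * q c * (s⁻¹ * D3 u x (v c) (v a) (v a)))
          + s⁻¹ * D4 u x (v c) (v c) (v a) (v a)))
        + (if a = c then (-2 * s ^ 2 * κ c ^ 2 - 4 * κ c ^ 2 * (q c ^ 2 + (1 - s ^ 2))
          - 4 * ε * κ c ^ 3 * q c ^ 2 - 4 * ε * κ c * (s⁻¹ * D3 u x (v c) (v c) y)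
          + 2 * κ c ^ 2 * (1 - s ^ 2 - ε * ∑ a, κ a * q a ^ 2)) else 0)) := by
    intro a
    have hj1 := jet_Bform hΩ hu hx hs hσ F (ε := ε) hp h4 c (v a) (v a)
    have hj2 := jet_Bform hΩ hu hx hs hσ F (ε := ε) hp h4 c y (v a)
    have hj3 := jet_Bform hΩ hu hx hs hσ F (ε := ε) hp h4 c y y
    have hj := (hj1.add (((hτ a).mul hj2).const_mul 2)).add (((hτ a).mul (hτ a)).mul hj3)
    have hca : D2 u x (v c) (v a) = if a = c then s * κ c else 0 := by
      rw [F.diag]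
      by_cases h : a = c
      · simp [h]
      · simp [h, Ne.symm h]
    refine (hj.congr ?_).congr_coeff ?_ ?_ ?_
    · filter_upwards [hevΩ] with t ht
      exact (Bform_add_smul (D2_symm hΩ hu ht) _ _ _).symm
    · rw [Bform_frame hs F hL, if_pos rfl]; ring
    · rw [Bform_slope_frame hs hσ F hL, hca, F.diag, if_pos rfl, D1_frame hs]
      rw [show s * inner ℝ (gradient u x) (v c) = q c from rfl,
        show s * inner ℝ (gradient u x) (v a) = q a from rfl]
      by_cases h : a = c
      · subst h
        simp only [if_true]
        field_simp; ring
      · simp only [h, if_false]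
        field_simp; ring
    · rw [Bform_slope_frame hs hσ F hL, Bform_slope_slope hs hσ F hL, hca, F.diag, if_pos rfl,
        D1_frame hs, D1_slope hσ, ← D2_symm hΩ hu hx (v a) y, F.M_slope hs hsp,
        F.M_slope hs hsp, D3_symm₂₃ hΩ hu hx (v c) y (v a)]
      rw [show s * inner ℝ (gradient u x) (v c) = q c from rfl,
        show s * inner ℝ (gradient u x) (v a) = q a from rfl, ← hy]
      rw [show ∑ a, κ a * (s * inner ℝ (gradient u x) (v a)) ^ 2 = ∑ a, κ a * q a ^ 2 from rfl]
      by_cases h : a = c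
      · subst h
        simp only [if_true]
        field_simp; ring
      · simp only [h, if_false]
        field_simp; ring
  have hjS := Jet.sum Finset.univ fun a _ =>
    ((hSa a).mul (Jet.const (1 - ε * κ a)⁻¹)).add (Jet.const (-1 + Real.log (1 - ε * κ a)))
  have hjσ := (jet_sig hΩ hu hx hs hσ F c).log (by positivity)
  have hjl := (hJlin.log one_pos).const_mul 2
  have hj := (hjS.sub ((hjσ.add hjl).add (Jet.const (Real.log (d ^ 2))))).sub hψ
  have hzero : ∑ a, ((1 - ε * κ a) * (1 - ε * κ a)⁻¹ + (-1 + Real.log (1 - ε * κ a)))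
      - (Real.log (s ^ 2) + 2 * Real.log 1 + Real.log (d ^ 2)) - Real.log (φ x) = 0 := by
    have h1 : ∑ a, ((1 - ε * κ a) * (1 - ε * κ a)⁻¹ + (-1 + Real.log (1 - ε * κ a))) =
        Real.log (φ x) := by
      rw [← prod_lam hΩ hu hx hs hσ F hε hp heq, Real.log_prod fun a _ => (hlam a).ne']
      refine Finset.sum_congr rfl fun a _ => ?_
      rw [mul_inv_cancel₀ (hlam a).ne']; ring
    have h2 : Real.log (s ^ 2) + Real.log (d ^ 2) = 0 := by
      rw [← Real.log_mul (by positivity) (by positivity), mul_comm, F.det, Real.log_one]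
    rw [h1, Real.log_one]; linarith
  obtain ⟨hfst, hsnd⟩ := (hj.congr_coeff hzero rfl rfl).minimum hnonneg
  constructor
  · have e : ∀ i, ((if i = c then -2 * κ c * q c + 2 * κ c * (q c * (1 - ε * κ c)) else 0)
        - ε * (κ c * q c * κ i + s⁻¹ * D3 u x (v c) (v i) (v i))) * (1 - ε * κ i)⁻¹
          + (1 - ε * κ i) * 0 + 0 =
        ((if i = c then -2 * κ c * q c + 2 * κ c * (q c * (1 - ε * κ c)) else 0)
        + (-ε * (κ c * q c * κ i + s⁻¹ * D3 u x (v c) (v i) (v i)))) * (1 - ε * κ i)⁻¹ :=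
      fun i => by ring
    rw [Finset.sum_congr rfl fun i _ => e i, sum_ite_add_mul] at hfst
    change φ₁ = ∑ a, (-ε * (κ c * q c * κ a + s⁻¹ * D3 u x (v c) (v a) (v a))) * (1 - ε * κ a)⁻¹
      - 2 * ε * κ c ^ 2 * q c * (1 - ε * κ c)⁻¹
    have e1 : -2 * s ^ 2 * κ c * (s * inner ℝ (gradient u x) (v c)) / s ^ 2 = -2 * κ c * q c := by
      rw [hq]; field_simp
    rw [e1] at hfst
    linear_combination -hfst
  · have e : ∀ i, ((-2 * q i * (s⁻¹ * D3 u x (v c) (v c) (v i))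
        - ε * ((s⁻¹ * D3 u x (v c) (v c) y + κ c ^ 2 * (1 + 2 * q c ^ 2)) * κ i
          + 2 * (κ c * q c * (s⁻¹ * D3 u x (v c) (v i) (v i)))
          + s⁻¹ * D4 u x (v c) (v c) (v i) (v i)))
        + (if i = c then (-2 * s ^ 2 * κ c ^ 2 - 4 * κ c ^ 2 * (q c ^ 2 + (1 - s ^ 2))
          - 4 * ε * κ c ^ 3 * q c ^ 2 - 4 * ε * κ c * (s⁻¹ * D3 u x (v c) (v c) y)
          + 2 * κ c ^ 2 * (1 - s ^ 2 - ε * ∑ a, κ a * q a ^ 2)) else 0)) * (1 - ε * κ i)⁻¹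
        + 2 * (((if i = c then -2 * κ c * q c + 2 * κ c * (q c * (1 - ε * κ c)) else 0)
        - ε * (κ c * q c * κ i + s⁻¹ * D3 u x (v c) (v i) (v i))) * 0)
          + (1 - ε * κ i) * 0 + 0 =
        ((if i = c then (-2 * s ^ 2 * κ c ^ 2 - 4 * κ c ^ 2 * (q c ^ 2 + (1 - s ^ 2))
          - 4 * ε * κ c ^ 3 * q c ^ 2 - 4 * ε * κ c * (s⁻¹ * D3 u x (v c) (v c) y)
          + 2 * κ c ^ 2 * (1 - s ^ 2 - ε * ∑ a, κ a * q a ^ 2)) else 0)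
        + (-2 * q i * (s⁻¹ * D3 u x (v c) (v c) (v i))
        - ε * ((s⁻¹ * D3 u x (v c) (v c) y + κ c ^ 2 * (1 + 2 * q c ^ 2)) * κ i
          + 2 * (κ c * q c * (s⁻¹ * D3 u x (v c) (v i) (v i)))
          + s⁻¹ * D4 u x (v c) (v c) (v i) (v i)))) * (1 - ε * κ i)⁻¹ :=
      fun i => by ring
    rw [Finset.sum_congr rfl fun i _ => e i, sum_ite_add_mul] at hsnd
    have e1 : -2 * s ^ 2 * κ c * (s * inner ℝ (gradient u x) (v c)) / s ^ 2 = -2 * κ c * q c := by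
      rw [hq]; field_simp
    have e2 : (-2 * s ^ 2 * κ c ^ 2 * (1 - (s * inner ℝ (gradient u x) (v c)) ^ 2)
        - 2 * s * D3 u x (v c) (v c) (s⁻¹ • gradient u x)) / s ^ 2 =
        -2 * κ c ^ 2 * (1 - q c ^ 2) - 2 * (s⁻¹ * D3 u x (v c) (v c) y) := by
      rw [hq, hy]; field_simp
    rw [e1, e2] at hsnd
    refine le_of_sub_nonneg (hsnd.trans_eq ?_)
    change _ = ∑ a, (-2 * q a * (s⁻¹ * D3 u x (v c) (v c) (v a))
        - ε * ((s⁻¹ * D3 u x (v c) (v c) y + κ c ^ 2 * (1 + 2 * q c ^ 2)) * κ a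
          + 2 * (κ c * q c * (s⁻¹ * D3 u x (v c) (v a) (v a)))
          + s⁻¹ * D4 u x (v c) (v c) (v a) (v a))) * (1 - ε * κ a)⁻¹
        + (-2 * s ^ 2 * κ c ^ 2 - 4 * κ c ^ 2 * (q c ^ 2 + (1 - s ^ 2))
          - 4 * ε * κ c ^ 3 * q c ^ 2 - 4 * ε * κ c * (s⁻¹ * D3 u x (v c) (v c) y)
          + 2 * κ c ^ 2 * (1 - s ^ 2 - ε * ∑ a, κ a * q a ^ 2)) * (1 - ε * κ c)⁻¹
        + 2 * κ c ^ 2 * (1 + 2 * q c ^ 2) + 2 * (s⁻¹ * D3 u x (v c) (v c) y) - φ₂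
    ring

end Directional

/-! ### Summation over the frame: elimination of third and fourth derivatives. -/

section Algebra

/-- The differential inequality for the trace `W`, in terms of the frame components. -/
lemma trace_inequality {n : ℕ} {ε s : ℝ} {q κ U φ₁ φ₂ W₁ W₂ : Fin n → ℝ}
    {t : Fin n → Fin n → Fin n → ℝ} {r : Fin n → Fin n → ℝ}
    (h₁₂ : ∀ a b c, t a b c = t b a c) (h₂₃ : ∀ a b c, t a b c = t a c b)
    (hr : ∀ a c, r a c = r c a) (hU : ∀ c, U c = ∑ b, q b * t c c b)
    (hlam : ∀ a, 0 < 1 - ε * κ a)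
    (hW₁ : ∀ c, W₁ c = -ε * (∑ a, t c a a + κ c * q c * ∑ a, κ a + 2 * κ c ^ 2 * q c))
    (hW₂ : ∀ c, W₂ c = -ε * (∑ a, r c a + 2 * κ c * q c * ∑ a, t c a a
        + (∑ a, κ a + 4 * κ c) * U c + 2 * ∑ b, κ b * q b * t c c b
        + κ c ^ 2 * (∑ a, κ a) * (1 + 2 * q c ^ 2) + κ c ^ 3 * (2 + 8 * q c ^ 2)
        + 2 * κ c ^ 2 * ∑ a, κ a * q a ^ 2))
    (hφ₁ : ∀ c, φ₁ c = ∑ a, (-ε * (κ c * q c * κ a + t c a a)) * (1 - ε * κ a)⁻¹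
        - 2 * ε * κ c ^ 2 * q c * (1 - ε * κ c)⁻¹)
    (hφ₂ : ∀ c, φ₂ c ≤ ∑ a, (-2 * q a * t c c a
        - ε * ((U c + κ c ^ 2 * (1 + 2 * q c ^ 2)) * κ a + 2 * (κ c * q c * t c a a)
          + r c a)) * (1 - ε * κ a)⁻¹
        + (-2 * s ^ 2 * κ c ^ 2 - 4 * κ c ^ 2 * (q c ^ 2 + (1 - s ^ 2))
          - 4 * ε * κ c ^ 3 * q c ^ 2 - 4 * ε * κ c * U c
          + 2 * κ c ^ 2 * (1 - s ^ 2 - ε * ∑ a, κ a * q a ^ 2)) * (1 - ε * κ c)⁻¹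
        + 2 * κ c ^ 2 * (1 + 2 * q c ^ 2) + 2 * U c) :
    ∑ c, φ₂ c + (∑ a, κ a) * ∑ c, q c * φ₁ c
        - (∑ c, κ c * (1 - ε * κ c)⁻¹) * ∑ c, q c * W₁ c
        + ∑ c, ∑ a, κ a * κ c * (1 - (1 - ε * κ a) * (1 - ε * κ c)⁻¹)
      ≤ ∑ c, W₂ c * (1 - ε * κ c)⁻¹ := by
  set i : Fin n → ℝ := fun c => (1 - ε * κ c)⁻¹ with hi
  have hil : ∀ c, i c * (1 - ε * κ c) = 1 := fun c => inv_mul_cancel₀ (hlam c).ne'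
  set H := ∑ a, κ a with hH
  set K := ∑ a, κ a * q a ^ 2 with hK
  set Z := ∑ a, κ a ^ 2 with hZ
  set Y := ∑ a, κ a ^ 2 * q a ^ 2 with hY
  set X := ∑ a, U a with hX
  set S : Fin n → ℝ := fun c => ∑ a, t c a a with hS
  set R : Fin n → ℝ := fun c => ∑ a, r c a with hR
  set Q : Fin n → ℝ := fun c => ∑ b, κ b * q b * t c c b with hQ
  have hcyc : ∀ a c, t a a c = t c a a := fun a c => by rw [h₂₃, h₁₂]
  have hqS : ∑ c, q c * S c = X := by
    simp only [hS, hX, hU, Finset.mul_sum]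
    rw [Finset.sum_comm]
    exact Finset.sum_congr rfl fun a _ => Finset.sum_congr rfl fun b _ => by rw [hcyc]
  have hF₁ : ∑ c, q c * φ₁ c =
      ∑ c, (-ε * (i c * (K * κ c + U c)) - 2 * ε * κ c ^ 2 * q c ^ 2 * i c) := by
    have e : ∀ c, q c * φ₁ c = ∑ a, q c * ((-ε * (κ c * q c * κ a + t c a a)) * i a)
        - 2 * ε * κ c ^ 2 * q c ^ 2 * i c := fun c => by
      rw [hφ₁, mul_sub, Finset.mul_sum]; ring
    simp only [e, Finset.sum_sub_distrib]
    congr 1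
    rw [Finset.sum_comm]
    refine Finset.sum_congr rfl fun a _ => ?_
    rw [hU, hK, Finset.sum_mul, ← Finset.sum_add_distrib, Finset.mul_sum, Finset.mul_sum]
    exact Finset.sum_congr rfl fun c _ => by rw [hcyc a c]; ring
  have hw₁ : ∑ c, q c * W₁ c = -ε * (X + K * H + 2 * Y) := by
    rw [← hqS, hK, hY, Finset.sum_mul, Finset.mul_sum, ← Finset.sum_add_distrib,
      ← Finset.sum_add_distrib, Finset.mul_sum]
    exact Finset.sum_congr rfl fun c _ => by rw [hW₁]; ring
  have hF₂ : ∑ c, φ₂ c ≤ ∑ c, (i c * (-2 * q c * S c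
      - ε * (κ c * (X + (Z + 2 * Y)) + 2 * Q c + R c)
      + (-2 * s ^ 2 * κ c ^ 2 - 4 * κ c ^ 2 * (q c ^ 2 + (1 - s ^ 2))
          - 4 * ε * κ c ^ 3 * q c ^ 2 - 4 * ε * κ c * U c
          + 2 * κ c ^ 2 * (1 - s ^ 2 - ε * K))) + 2 * κ c ^ 2 * (1 + 2 * q c ^ 2) + 2 * U c) := by
    -- Exchanging the two indices moves the weight `1/λ` onto the direction of differentiation; this
    -- uses the full symmetry of `t` and that of `r`.
    have hswap : ∑ c, ∑ a, (-2 * q a * t c c a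
        - ε * ((U c + κ c ^ 2 * (1 + 2 * q c ^ 2)) * κ a + 2 * (κ c * q c * t c a a)
          + r c a)) * i a
        = ∑ c, i c * (-2 * q c * S c - ε * (κ c * (X + (Z + 2 * Y)) + 2 * Q c + R c)) := by
      rw [Finset.sum_comm]
      refine Finset.sum_congr rfl fun a _ => ?_
      have e : ∀ c, (-2 * q a * t c c a
          - ε * ((U c + κ c ^ 2 * (1 + 2 * q c ^ 2)) * κ a + 2 * (κ c * q c * t c a a)
            + r c a)) * i a = -2 * q a * i a * t a c c
          - ε * i a * κ a * U c - ε * i a * κ a * κ c ^ 2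
          - 2 * ε * i a * κ a * (κ c ^ 2 * q c ^ 2) - 2 * ε * i a * (κ c * q c * t a a c)
          - ε * i a * r a c := fun c => by
        rw [hcyc c a, hcyc a c, hr c a]; ring
      rw [Finset.sum_congr rfl fun c _ => e c]
      simp only [Finset.sum_sub_distrib, ← Finset.mul_sum]
      rw [← hX, ← hZ, ← hY]
      simp only [hS, hQ, hR]
      ring
    refine (Finset.sum_le_sum fun c _ => hφ₂ c).trans_eq ?_
    simp only [mul_add (i _), Finset.sum_add_distrib] at hswap ⊢
    rw [hswap]
    simp only [hi, mul_comm (1 - ε * κ _)⁻¹, add_mul, Finset.sum_add_distrib]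
  rw [hF₁, hw₁]
  -- A termwise identity from `i (1 - ε κ) = 1`. The last bracket vanishes only after summation over
  -- `c`, by `hqS`.
  have hterm : ∀ c, W₂ c * i c = (i c * (-2 * q c * S c
      - ε * (κ c * (X + (Z + 2 * Y)) + 2 * Q c + R c)
      + (-2 * s ^ 2 * κ c ^ 2 - 4 * κ c ^ 2 * (q c ^ 2 + (1 - s ^ 2))
          - 4 * ε * κ c ^ 3 * q c ^ 2 - 4 * ε * κ c * U c
          + 2 * κ c ^ 2 * (1 - s ^ 2 - ε * K))) + 2 * κ c ^ 2 * (1 + 2 * q c ^ 2) + 2 * U c)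
      + H * (-ε * (i c * (K * κ c + U c)) - 2 * ε * κ c ^ 2 * q c ^ 2 * i c)
      - κ c * i c * (-ε * (X + K * H + 2 * Y))
      + κ c * (H - (H - ε * Z) * i c) + (2 * (q c * S c) - 2 * U c) := fun c => by
    rw [hW₂]
    linear_combination (2 * q c * S c + κ c * H + 2 * κ c ^ 2 + 4 * κ c ^ 2 * q c ^ 2) * hil c
  have hcurv : ∀ c, ∑ a, κ a * κ c * (1 - (1 - ε * κ a) * i c) =
      κ c * (H - (H - ε * Z) * i c) := fun c => by
    rw [hH, hZ, Finset.mul_sum, ← Finset.sum_sub_distrib, Finset.sum_mul,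
      ← Finset.sum_sub_distrib, Finset.mul_sum]
    exact Finset.sum_congr rfl fun a _ => by ring
  rw [Finset.sum_congr rfl fun c _ => hterm c, Finset.sum_congr rfl fun c _ => hcurv c]
  simp only [Finset.sum_add_distrib, Finset.sum_sub_distrib, ← Finset.mul_sum, ← Finset.sum_mul]
    at hF₂ ⊢
  rw [hqS]
  linarith

end Algebra

/-! ### `ζ²W` is of class `C^{1,1}`. -/

section Regularity

lemma exists_lipschitzOnWith_comp {α β γ : Type*} [PseudoEMetricSpace α] [PseudoEMetricSpace β]
    [PseudoEMetricSpace γ] {f : α → β} {g : β → γ} {x : α}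
    (hf : ∃ K, ∃ s ∈ 𝓝 x, LipschitzOnWith K f s)
    (hg : ∃ K, ∃ s ∈ 𝓝 (f x), LipschitzOnWith K g s) :
    ∃ K, ∃ s ∈ 𝓝 x, LipschitzOnWith K (fun y => g (f y)) s := by
  obtain ⟨K, s, hs, hK⟩ := hf
  obtain ⟨K', t, ht, hK'⟩ := hg
  have hc : ContinuousAt f x := hK.continuousOn.continuousAt hs
  refine ⟨K' * K, s ∩ f ⁻¹' t, inter_mem hs (hc ht), ?_⟩
  exact hK'.comp (hK.mono Set.inter_subset_left) fun y hy => hy.2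

variable {V X : Type*} [NormedAddCommGroup V] [NormedSpace ℝ V] [NormedAddCommGroup X]
  [NormedSpace ℝ X]

/-- The composition of a `C²` function with a `C^{1,1}` map is of class `C^{1,1}`. -/
lemma exists_lipschitzOnWith_fderiv_comp {Ψ : X → ℝ} {J : V → X} {J' : V → V →L[ℝ] X} {x : V}
    (hΨ : ContDiffAt ℝ 2 Ψ (J x)) (hJ : ∀ᶠ y in 𝓝 x, HasFDerivAt J (J' y) y)
    (hJ' : ∃ K, ∃ s ∈ 𝓝 x, LipschitzOnWith K J' s) :
    (∀ᶠ y in 𝓝 x, DifferentiableAt ℝ (fun y => Ψ (J y)) y) ∧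
      ∃ K, ∃ s ∈ 𝓝 x, LipschitzOnWith K (fderiv ℝ fun y => Ψ (J y)) s := by
  have hJ1 : ContDiffAt ℝ 1 J x := by
    obtain ⟨K, s, hs, hK⟩ := hJ'
    rw [contDiffAt_one_iff]
    exact ⟨J', s ∩ {y | HasFDerivAt J (J' y) y}, inter_mem hs hJ,
      hK.continuousOn.mono Set.inter_subset_left, fun y hy => hy.2⟩
  have hΨ1 : ContDiffAt ℝ 1 (fderiv ℝ Ψ) (J x) := hΨ.fderiv_right (by norm_num)
  have hev : ∀ᶠ y in 𝓝 x, HasFDerivAt (fun y => Ψ (J y)) ((fderiv ℝ Ψ (J y)).comp (J' y)) y := by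
    have h1 : ∀ᶠ z in 𝓝 (J x), DifferentiableAt ℝ Ψ z := by
      filter_upwards [hΨ.eventually (by simp)] with z hz using hz.differentiableAt (by norm_num)
    filter_upwards [hJ, hJ1.continuousAt.eventually h1] with y hy hy'
    exact hy'.hasFDerivAt.comp y hy
  refine ⟨hev.mono fun y hy => hy.differentiableAt, ?_⟩
  have hpair : ∃ K, ∃ s ∈ 𝓝 x, LipschitzOnWith K (fun y => (J y, J' y)) s := by
    obtain ⟨K, s, hs, hK⟩ := hJ1.exists_lipschitzOnWith
    obtain ⟨K', s', hs', hK'⟩ := hJ'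
    exact ⟨_, s ∩ s', inter_mem hs hs', (hK.mono Set.inter_subset_left).prodMk
      (hK'.mono Set.inter_subset_right)⟩
  -- The derivative of the composition is a `C¹` function of the pair `(J, J')`, which is Lipschitz.
  have hΘ : ContDiffAt ℝ 1 (fun z : X × (V →L[ℝ] X) => (fderiv ℝ Ψ z.1).comp z.2) (J x, J' x) :=
    (hΨ1.comp (J x, J' x) contDiffAt_fst).clm_comp contDiffAt_snd
  obtain ⟨K, s, hs, hK⟩ := exists_lipschitzOnWith_comp hpair hΘ.exists_lipschitzOnWith
  refine ⟨K, s ∩ {y | fderiv ℝ (fun y => Ψ (J y)) y = (fderiv ℝ Ψ (J y)).comp (J' y)},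
    inter_mem hs (hev.mono fun y hy => hy.fderiv), fun y hy z hz => ?_⟩
  rw [hy.2, hz.2]
  exact hK hy.1 hz.1

variable {n : ℕ}

/-- The function `ζ²W` with `ζ = r² - |x - z|²`, in terms of the `2`-jet of `u`. -/
lemma contDiffAt_cutoff_trace (ε r : ℝ) (z x : E n) {p : E n →L[ℝ] ℝ}
    (M : E n →L[ℝ] E n →L[ℝ] ℝ) (hp : ‖riesz p‖ < 1) :
    ContDiffAt ℝ 2 (fun j : E n × (E n →L[ℝ] ℝ) × (E n →L[ℝ] E n →L[ℝ] ℝ) =>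
      (r ^ 2 - ‖j.1 - z‖ ^ 2) ^ 2 * (n - ε / √(1 - ‖rieszL n j.2.1‖ ^ 2) *
        (∑ i, j.2.2 (EuclideanSpace.single i 1) (EuclideanSpace.single i 1)
          + j.2.2 (rieszL n j.2.1) (rieszL n j.2.1) / (1 - ‖rieszL n j.2.1‖ ^ 2)))) (x, p, M) := by
  have hpos : 1 - ‖rieszL n p‖ ^ 2 ≠ 0 := by
    rw [rieszL_apply]
    have : 0 < 1 - ‖riesz p‖ ^ 2 := by nlinarith [norm_nonneg (riesz p)]
    exact this.ne'
  have hM : ContDiff ℝ 2 fun j : E n × (E n →L[ℝ] ℝ) × (E n →L[ℝ] E n →L[ℝ] ℝ) => j.2.2 :=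
    contDiff_snd.snd
  have hr : ContDiff ℝ 2 fun j : E n × (E n →L[ℝ] ℝ) × (E n →L[ℝ] E n →L[ℝ] ℝ) =>
      rieszL n j.2.1 := (rieszL n).contDiff.comp contDiff_snd.fst
  have hσ : ContDiff ℝ 2 fun j : E n × (E n →L[ℝ] ℝ) × (E n →L[ℝ] E n →L[ℝ] ℝ) =>
      1 - ‖rieszL n j.2.1‖ ^ 2 := contDiff_const.sub (hr.norm_sq ℝ)
  refine ContDiffAt.mul ?_ (contDiffAt_const.sub (ContDiffAt.mul ?_ (ContDiffAt.add ?_ ?_)))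
  · exact ((contDiff_const.sub ((contDiff_fst.sub contDiff_const).norm_sq ℝ)).pow 2).contDiffAt
  · exact contDiffAt_const.div (hσ.contDiffAt.sqrt hpos)
      (Real.sqrt_ne_zero'.2 (by
        rw [rieszL_apply]; nlinarith [norm_nonneg (riesz p)]))
  · exact (ContDiff.sum fun i _ =>
      (hM.clm_apply contDiff_const).clm_apply contDiff_const).contDiffAt
  · exact ((hM.clm_apply hr).clm_apply hr).contDiffAt.div hσ.contDiffAt hpos

/-- `ζ²W` is of class `C^{1,1}` near every point of `Ω`. -/
lemma exists_lipschitzOnWith_cutoff_trace {ε : ℝ} (hε : 0 < ε) {Ω : Set (E n)} (hΩ : IsOpen Ω)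
    {u : E n → ℝ} (hu : IsCLip1Loc 3 Ω u) (hp : ∀ y ∈ Ω, ‖gradient u y‖ < 1) (r : ℝ) (z : E n)
    {x : E n} (hx : x ∈ Ω) :
    ∃ R > 0, ∃ K, (∀ y ∈ Metric.closedBall x R,
        DifferentiableAt ℝ (fun y => (r ^ 2 - ‖y - z‖ ^ 2) ^ 2 * W ε u y) y) ∧
      LipschitzOnWith K (fderiv ℝ fun y => (r ^ 2 - ‖y - z‖ ^ 2) ^ 2 * W ε u y)
        (Metric.closedBall x R) := by
  -- The 2-jet of `u` is `C^{1,1}` because `D3 u` is locally Lipschitz, and `ζ²W` is a smooth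
  -- function of it where `|Du| < 1`.
  set J : E n → E n × (E n →L[ℝ] ℝ) × (E n →L[ℝ] E n →L[ℝ] ℝ) := fun y => (y, D1 u y, D2 u y)
    with hJ
  set J' : E n → E n →L[ℝ] E n × (E n →L[ℝ] ℝ) × (E n →L[ℝ] E n →L[ℝ] ℝ) := fun y =>
    (ContinuousLinearMap.id ℝ (E n)).prod ((D2 u y).prod (D3 u y)) with hJ'
  have hJd : ∀ᶠ y in 𝓝 x, HasFDerivAt J (J' y) y := by
    filter_upwards [hΩ.mem_nhds hx] with y hy
    exact (hasFDerivAt_id y).prodMk ((hasFDerivAt_D1 hΩ hu.1 hy).prodMk (hasFDerivAt_D2 hΩ hu.1 hy))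
  have hJL : ∃ K, ∃ s ∈ 𝓝 x, LipschitzOnWith K J' s := by
    obtain ⟨R, hR, -, K, hK⟩ := hu.exists_lipschitz_D3 hΩ hx
    obtain ⟨K', s, hs, hK'⟩ :=
      ((contDiffOn_D2 hΩ hu.1).contDiffAt (hΩ.mem_nhds hx)).exists_lipschitzOnWith
    refine ⟨_, s ∩ Metric.closedBall x R, inter_mem hs (Metric.closedBall_mem_nhds x hR),
      LipschitzOnWith.of_dist_le_mul (K := max K' K) fun y hy y' hy' => ?_⟩
    have h1 := hK'.dist_le_mul y hy.1 y' hy'.1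
    have h2 := hK.dist_le_mul y hy.2 y' hy'.2
    have h3 : J' y - J' y' =
        (0 : E n →L[ℝ] E n).prod ((D2 u y - D2 u y').prod (D3 u y - D3 u y')) := by
      ext v <;> simp [hJ']
    rw [dist_eq_norm, h3, ContinuousLinearMap.opNorm_prod, Prod.norm_mk,
      ContinuousLinearMap.opNorm_prod, Prod.norm_mk]
    rw [dist_eq_norm] at h1 h2
    refine max_le (by simp; positivity) (max_le (h1.trans ?_) (h2.trans ?_))
    · gcongr; exact le_max_left _ _
    · gcongr; exact le_max_right _ _
  have hΨ := contDiffAt_cutoff_trace ε r z x (p := D1 u x) (D2 u x) (hp x hx)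
  obtain ⟨hd, K, s, hs, hK⟩ := exists_lipschitzOnWith_fderiv_comp (J := J) hΨ hJd hJL
  have he : ∀ y ∈ Ω, (fun y => (r ^ 2 - ‖y - z‖ ^ 2) ^ 2 * W ε u y) =ᶠ[𝓝 y] fun y =>
      (r ^ 2 - ‖(J y).1 - z‖ ^ 2) ^ 2 * (n - ε / √(1 - ‖rieszL n (J y).2.1‖ ^ 2) *
        (∑ i, (J y).2.2 (EuclideanSpace.single i 1) (EuclideanSpace.single i 1)
          + (J y).2.2 (rieszL n (J y).2.1) (rieszL n (J y).2.1)
            / (1 - ‖rieszL n (J y).2.1‖ ^ 2))) := fun y hy => by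
    filter_upwards [hΩ.mem_nhds hy] with y hy
    rw [W_eq hε (hasFDerivAt_D1 hΩ hu.1 hy) (hp y hy)]
    rfl
  obtain ⟨R, hR, hsub⟩ := Metric.nhds_basis_closedBall.mem_iff.1
    (inter_mem (inter_mem hs hd) (hΩ.mem_nhds hx))
  refine ⟨R, hR, K, fun y hy => ?_, fun y hy y' hy' => ?_⟩
  · exact (hsub hy).1.2.congr_of_eventuallyEq (he y (hsub hy).2)
  · rw [(he y (hsub hy).2).fderiv_eq, (he y' (hsub hy').2).fderiv_eq]
    exact hK (hsub hy).1.1 (hsub hy').1.1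

end Regularity

/-! ### Second-order bounds for `f` and `g`. -/

section Density

variable {n : ℕ}

/-- A second-order bound for the error of the linear approximation of `h` near `x`, together with
the same bound for the gradient. -/
def QuadraticallyApproximable (K : ℝ) (h : E n → ℝ) (x : E n) : Prop :=
  ‖fderiv ℝ h x‖ ≤ K ∧ ∀ᶠ y in 𝓝 x, |h y - h x - fderiv ℝ h x (y - x)| ≤ K * ‖y - x‖ ^ 2

lemma QuadraticallyApproximable.mono {K K' : ℝ} {h : E n → ℝ} {x : E n}
    (H : QuadraticallyApproximable K h x) (hK : K ≤ K') : QuadraticallyApproximable K' h x :=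
  ⟨H.1.trans hK, H.2.mono fun y hy => hy.trans (by gcongr)⟩

lemma eventually_abs_sub_le_of_lipschitz {h : E n → ℝ} {x : E n} {K : NNReal} {s : Set (E n)}
    (hs : s ∈ 𝓝 x) (hd : ∀ y ∈ s, DifferentiableAt ℝ h y)
    (hL : LipschitzOnWith K (fderiv ℝ h) s) :
    ∀ᶠ y in 𝓝 x, |h y - h x - fderiv ℝ h x (y - x)| ≤ K * ‖y - x‖ ^ 2 := by
  obtain ⟨R, hR, hsub⟩ := Metric.nhds_basis_ball.mem_iff.1 hs
  filter_upwards [Metric.ball_mem_nhds x hR] with y hy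
  have hyx : Metric.closedBall x ‖y - x‖ ⊆ s := by
    refine (Metric.closedBall_subset_ball ?_).trans hsub
    rwa [← dist_eq_norm]
  have := (convex_closedBall x ‖y - x‖).norm_image_sub_le_of_norm_hasFDerivWithin_le'
    (f := h) (f' := fderiv ℝ h) (φ := fderiv ℝ h x) (C := K * ‖y - x‖)
    (fun z hz => (hd z (hyx hz)).hasFDerivAt.hasFDerivWithinAt) (fun z hz => ?_)
    (Metric.mem_closedBall_self (norm_nonneg _)) (by rw [Metric.mem_closedBall, dist_eq_norm])
  · rw [pow_two, ← mul_assoc]; exact this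
  · have h1 := hL.dist_le_mul z (hyx hz) x (hyx (Metric.mem_closedBall_self (norm_nonneg _)))
    rw [dist_eq_norm] at h1
    refine h1.trans ?_
    gcongr
    exact hz

/-- Induction on compact sets makes the constant uniform; the neighbourhood on which the quadratic
bound holds may still depend on the point. -/
lemma IsCLip1Loc.exists_quadraticallyApproximable {Ω S : Set (E n)} {f : E n → ℝ}
    (hΩ : IsOpen Ω) (hf : IsCLip1Loc 1 Ω f) (hS : IsCompact S) (hSΩ : S ⊆ Ω) :
    ∃ K, ∀ x ∈ S, QuadraticallyApproximable K f x := by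
  have hd : ∀ y ∈ Ω, DifferentiableAt ℝ f y := fun y hy =>
    (hf.1.contDiffAt (hΩ.mem_nhds hy)).differentiableAt (by norm_num)
  refine hS.induction_on (p := fun S => ∃ K, ∀ x ∈ S, QuadraticallyApproximable K f x)
    ⟨0, fun x hx => hx.elim⟩ (fun s t hst ⟨K, hK⟩ => ⟨K, fun x hx => hK x (hst hx)⟩)
    (fun s t ⟨K, hK⟩ ⟨K', hK'⟩ => ⟨max K K', fun x hx => hx.elim
      (fun h => (hK x h).mono (le_max_left _ _)) fun h => (hK' x h).mono (le_max_right _ _)⟩)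
    fun x hx => ?_
  obtain ⟨K, t, ht, hK⟩ := hf.lipschitz_fderiv (hSΩ hx)
  rw [hΩ.nhdsWithin_eq (hSΩ hx)] at ht
  obtain ⟨R, hR, hsub⟩ := Metric.nhds_basis_ball.mem_iff.1 (inter_mem ht (hΩ.mem_nhds (hSΩ hx)))
  refine ⟨Metric.ball x R, mem_nhdsWithin_of_mem_nhds (Metric.ball_mem_nhds x hR),
    max K (‖fderiv ℝ f x‖ + K * R), fun y hy => ⟨?_, ?_⟩⟩
  · refine le_trans ?_ (le_max_right _ _)
    have h1 := hK.dist_le_mul y (hsub hy).1 x (hsub (Metric.mem_ball_self hR)).1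
    rw [dist_eq_norm] at h1
    have h2 : (K : ℝ) * dist y x ≤ K * R := by gcongr; exact (Metric.mem_ball.1 hy).le
    linarith [norm_le_norm_add_norm_sub' (fderiv ℝ f y) (fderiv ℝ f x)]
  · filter_upwards [eventually_abs_sub_le_of_lipschitz (Metric.isOpen_ball.mem_nhds hy)
      (fun z hz => hd z (hsub hz).2) (hK.mono fun z hz => (hsub hz).1)] with z hz
    refine hz.trans ?_
    gcongr
    exact le_max_left _ _

lemma IsC11.exists_quadraticallyApproximable {Ω : Set (E n)} {g : E n → ℝ} (hΩ : IsOpen Ω)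
    (hg : IsC11 Ω g) : ∃ K, ∀ x ∈ Ω, QuadraticallyApproximable K g x := by
  obtain ⟨h1, ⟨K, hK⟩, K', hK'⟩ := hg
  refine ⟨max K K', fun x hx => ⟨(hK x hx).2.trans (le_max_left _ _), ?_⟩⟩
  filter_upwards [eventually_abs_sub_le_of_lipschitz (hΩ.mem_nhds hx) (fun y hy =>
    (h1.contDiffAt (hΩ.mem_nhds hy)).differentiableAt (by norm_num)) hK'] with z hz
  refine hz.trans ?_
  gcongr
  exact le_max_right _ _

/-- A lower barrier with a second-order expansion for `log (f / g)` along a pair of curves. -/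
lemma exists_jet_le_log_div {f g : E n → ℝ} {x v y b c : E n} {Y : ℝ → E n} {K K' : ℝ}
    (hf : QuadraticallyApproximable K f x) (hg : QuadraticallyApproximable K' g y)
    (hf0 : 0 < f x) (hg0 : 0 < g y) (hY : Jet Y y b c) :
    ∃ ψ : ℝ → ℝ, Jet ψ (Real.log (f x / g y))
        (fderiv ℝ f x v / f x - fderiv ℝ g y b / g y)
        (-2 * K * ‖v‖ ^ 2 / f x - (fderiv ℝ f x v / f x) ^ 2
          - (fderiv ℝ g y c + 2 * K' * ‖b‖ ^ 2) / g y) ∧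
      ∀ᶠ t in 𝓝 (0 : ℝ), ψ t ≤ Real.log (f (x + t • v) / g (Y t)) := by
  have hX := Jet.line x v
  have hP : Jet (fun t => f x + t * fderiv ℝ f x v + t * t * (-K * ‖v‖ ^ 2)) (f x)
      (fderiv ℝ f x v) (-2 * K * ‖v‖ ^ 2) :=
    (((Jet.const (f x)).add (Jet.id.mul (Jet.const _))).add
      ((Jet.id.mul Jet.id).mul (Jet.const _))).congr_coeff (by ring) (by ring) (by ring)
  have hY' : Jet (fun t => Y t - y) 0 b c := by simpa using hY.sub (Jet.const y)
  have hlin := hY'.clm (fderiv ℝ g y)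
  have hsq := (hY'.inner hY').const_mul K'
  have hg1 := (hlin.add hsq).const_mul (g y)⁻¹
  have hlow := (Jet.const (g y)).add (hlin.sub hsq)
  -- The numerator is replaced by a paraboloid below it; for the denominator, `log a ≤ a - 1` at `a
  -- = g (Y t) / g y` gives an upper bound without a logarithm.
  refine ⟨fun t => Real.log (f x + t * fderiv ℝ f x v + t * t * (-K * ‖v‖ ^ 2)) -
    (Real.log (g y) + (g y)⁻¹ * (fderiv ℝ g y (Y t - y)
      + K' * inner ℝ (Y t - y) (Y t - y))), ?_, ?_⟩
  · refine ((hP.log hf0).sub ((Jet.const (Real.log (g y))).add hg1)).congr_coeff ?_ ?_ ?_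
    · rw [Real.log_div hf0.ne' hg0.ne']; simp
    · simp; ring
    · simp only [inner_zero_left, inner_zero_right, real_inner_self_eq_norm_sq]; ring
  · have hg2 : 0 < g y + (fderiv ℝ g y 0 - K' * inner ℝ (0 : E n) 0) := by simpa using hg0
    filter_upwards [hX.tendsto.eventually hf.2, hY.tendsto.eventually hg.2,
      hP.tendsto.eventually (lt_mem_nhds hf0), hlow.tendsto.eventually (lt_mem_nhds hg2)]
      with t h1 h2 h3 h4
    have e : x + t • v - x = t • v := by abel
    rw [e, map_smul, norm_smul, mul_pow, Real.norm_eq_abs, sq_abs, smul_eq_mul, abs_le] at h1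
    rw [abs_le] at h2
    rw [real_inner_self_eq_norm_sq] at h4 ⊢
    have hfl : f x + t * fderiv ℝ f x v + t * t * (-K * ‖v‖ ^ 2) ≤ f (x + t • v) := by
      nlinarith [h1.1]
    have hgl : 0 < g (Y t) := by linarith [h2.1]
    rw [Real.log_div (h3.trans_le hfl).ne' hgl.ne']
    refine sub_le_sub (Real.log_le_log h3 hfl) ?_
    have h5 := Real.log_le_sub_one_of_pos (div_pos hgl hg0)
    rw [Real.log_div hgl.ne' hg0.ne'] at h5
    have h6 : g (Y t) / g y - 1 ≤ (g y)⁻¹ * (fderiv ℝ g y (Y t - y) + K' * ‖Y t - y‖ ^ 2) := by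
      rw [div_sub_one hg0.ne', div_eq_inv_mul]
      gcongr
      linarith [h2.2]
    linarith

end Density

/-! ### The maximum principle and the final algebra. -/

section Maximum

variable {n : ℕ}

/-- The first and second order conditions at a point where `ζ²w`, `ζ = r² - |x - z|²`, is touched
from above by a small quadratic polynomial. -/
lemma exists_cutoff_conditions {w : E n → ℝ} {x z γ : E n} {r τ : ℝ}
    (hζ : 0 < r ^ 2 - ‖x - z‖ ^ 2) (hr : 0 < r) (hw : 0 ≤ w x) (hγ : ‖γ‖ ≤ τ)
    (h₁ : τ ≤ (r ^ 2 - ‖x - z‖ ^ 2) * w x) (h₂ : τ ≤ (r ^ 2 - ‖x - z‖ ^ 2) * w x * r)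
    (hG : ∀ᶠ h in 𝓝 (0 : E n), (r ^ 2 - ‖x + h - z‖ ^ 2) ^ 2 * w (x + h) ≤
      (r ^ 2 - ‖x - z‖ ^ 2) ^ 2 * w x + inner ℝ γ h + τ * ‖h‖ ^ 2) :
    ∃ ω : E n, ‖ω‖ ≤ 5 * r * w x / (r ^ 2 - ‖x - z‖ ^ 2) ∧ ∀ (v : E n) (w₁ w₂ : ℝ),
      Jet (fun t : ℝ => w (x + t • v)) (w x) w₁ w₂ → w₁ = inner ℝ ω v ∧
        w₂ ≤ ‖v‖ ^ 2 * (46 * r ^ 2 * w x / (r ^ 2 - ‖x - z‖ ^ 2) ^ 2) := by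
  set ζ := r ^ 2 - ‖x - z‖ ^ 2 with hζdef
  set y := x - z with hy
  have hyr : ‖y‖ ≤ r :=
    (pow_le_pow_iff_left₀ (norm_nonneg y) hr.le two_ne_zero).1 (by linarith)
  have hζr : ζ ≤ r ^ 2 := sub_le_self _ (sq_nonneg _)
  -- `5 = 1 + 4`: the slope `γ`, controlled by `h₂`, and the gradient of `ζ²`.
  have hωn : ‖(ζ ^ 2)⁻¹ • γ + (4 * w x / ζ) • y‖ ≤ 5 * r * w x / ζ := by
    refine (norm_add_le _ _).trans ?_
    rw [norm_smul, norm_smul, Real.norm_of_nonneg (by positivity),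
      Real.norm_of_nonneg (by positivity)]
    calc (ζ ^ 2)⁻¹ * ‖γ‖ + 4 * w x / ζ * ‖y‖
        ≤ (ζ ^ 2)⁻¹ * (ζ * w x * r) + 4 * w x / ζ * r := by gcongr; exact hγ.trans h₂
      _ = 5 * r * w x / ζ := by field_simp; ring
  refine ⟨_, hωn, fun v w₁ w₂ hW => ?_⟩
  have hX := Jet.line y v
  have hZ := (Jet.const (r ^ 2)).sub (hX.inner hX)
  have hGj := (hZ.mul hZ).mul hW
  have hlin : Jet (fun t : ℝ => ζ ^ 2 * w x + t * inner ℝ γ v + t * t * (τ * ‖v‖ ^ 2))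
      (ζ ^ 2 * w x) (inner ℝ γ v) (2 * τ * ‖v‖ ^ 2) :=
    (((Jet.const _).add (Jet.id.mul (Jet.const _))).add
      ((Jet.id.mul Jet.id).mul (Jet.const _))).congr_coeff (by ring) (by ring) (by ring)
  have htend : Tendsto (fun t : ℝ => t • v) (𝓝 0) (𝓝 0) := by
    simpa using (Jet.line 0 v).tendsto
  have hm := Jet.minimum ((hlin.sub hGj).congr_coeff
    (by rw [real_inner_self_eq_norm_sq]; ring) rfl rfl) (by
      filter_upwards [htend.eventually hG] with t ht
      rw [inner_smul_right, norm_smul, mul_pow, Real.norm_eq_abs, sq_abs,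
        show x + t • v - z = y + t • v by rw [hy]; abel] at ht
      rw [real_inner_self_eq_norm_sq]
      linarith)
  obtain ⟨m₁, m₂⟩ := hm
  set k : ℝ := inner ℝ y v with hk
  have hvy : inner ℝ v y = k := real_inner_comm _ _
  simp only [inner_zero_left, inner_zero_right, real_inner_self_eq_norm_sq, hvy, ← hζdef] at m₁ m₂
  have hw₁ : w₁ = inner ℝ ((ζ ^ 2)⁻¹ • γ + (4 * w x / ζ) • y) v := by
    rw [inner_add_left, real_inner_smul_left, real_inner_smul_left, ← hk]
    field_simp
    linarith
  refine ⟨hw₁, ?_⟩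
  have hk1 : |k| ≤ r * ‖v‖ := (abs_real_inner_le_norm _ _).trans (by gcongr)
  have hw₁' : |w₁| ≤ 5 * r * w x / ζ * ‖v‖ := by
    rw [hw₁]; exact (abs_real_inner_le_norm _ _).trans (by gcongr)
  have hkw : k * w₁ ≤ r * ‖v‖ * (5 * r * w x / ζ * ‖v‖) :=
    (le_abs_self _).trans (by rw [abs_mul]; gcongr)
  have hkw' : ζ * (k * w₁) ≤ 5 * r ^ 2 * w x * ‖v‖ ^ 2 := by
    calc ζ * (k * w₁) ≤ ζ * (r * ‖v‖ * (5 * r * w x / ζ * ‖v‖)) := by gcongr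
      _ = _ := by field_simp
  -- The final `46` is `2 + 4 + 8 · 5`, from `τ`, the Hessian of `ζ²` and the cross term.
  have h3 : ζ ^ 2 * w₂ ≤ 2 * τ * ‖v‖ ^ 2 - 8 * k ^ 2 * w x + 4 * ζ * ‖v‖ ^ 2 * w x
      + 8 * (ζ * (k * w₁)) := by linarith
  have h4 : τ * ‖v‖ ^ 2 ≤ r ^ 2 * w x * ‖v‖ ^ 2 := by
    gcongr; exact h₁.trans (by gcongr)
  have h5 : ζ * ‖v‖ ^ 2 * w x ≤ r ^ 2 * ‖v‖ ^ 2 * w x := by gcongr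
  have h6 : 0 ≤ k ^ 2 * w x := by positivity
  rw [← mul_div_assoc, le_div_iff₀ (by positivity)]
  linarith

/-- Expresses the good term of `trace_inequality` through `∑ 1/λ`, `∑ λ` and `∑ λ²`, the only
quantities used in the final estimate. -/
lemma sum_scaled_curvature {ε : ℝ} {κ l i : Fin n → ℝ} (hl : ∀ c, l c = 1 - ε * κ c)
    (hil : ∀ c, i c * l c = 1) :
    ε * ∑ c, κ c = n - ∑ c, l c ∧ ε * ∑ c, κ c * i c = ∑ c, i c - n ∧
      ε * ∑ c, l c * κ c = ∑ c, l c - ∑ c, l c ^ 2 ∧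
      ε ^ 2 * ∑ c, ∑ d, κ d * κ c * (1 - l d * i c) =
        (∑ c, i c - n) * (∑ c, l c ^ 2 - ∑ c, l c) + (∑ c, l c - n) ^ 2 := by
  have hcard : ∑ _c : Fin n, (1 : ℝ) = n := by simp
  have hεH : ε * ∑ c, κ c = n - ∑ c, l c := by
    rw [← hcard, ← Finset.sum_sub_distrib, Finset.mul_sum]
    exact Finset.sum_congr rfl fun c _ => by rw [hl]; ring
  have hεκi : ε * ∑ c, κ c * i c = ∑ c, i c - n := by
    rw [← hcard, ← Finset.sum_sub_distrib, Finset.mul_sum]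
    refine Finset.sum_congr rfl fun c _ => ?_
    linear_combination -hil c + i c * hl c
  have hεlκ : ε * ∑ c, l c * κ c = ∑ c, l c - ∑ c, l c ^ 2 := by
    rw [← Finset.sum_sub_distrib, Finset.mul_sum]
    exact Finset.sum_congr rfl fun c _ => by linear_combination l c * hl c
  refine ⟨hεH, hεκi, hεlκ, ?_⟩
  have e : ∀ c, ∑ d, κ d * κ c * (1 - l d * i c) =
      (∑ d, κ d) * κ c - (∑ d, l d * κ d) * (κ c * i c) := fun c => by
    rw [Finset.sum_mul, Finset.sum_mul, ← Finset.sum_sub_distrib]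
    exact Finset.sum_congr rfl fun d _ => by ring
  rw [Finset.sum_congr rfl fun c _ => e c, Finset.sum_sub_distrib, ← Finset.mul_sum,
    ← Finset.mul_sum]
  linear_combination (ε * ∑ d, κ d + n - ∑ c, l c) * hεH - ε * (∑ d, l d * κ d) * hεκi
    - (∑ c, i c - n) * hεlκ

/-- The second-order part of the expansion of `T` is controlled by the derivative of the trace. -/
lemma sum_second_order_T {ε : ℝ} {Q : E n} {v : Fin n → E n} {q κ l W₁ : Fin n → ℝ}
    {t : Fin n → Fin n → Fin n → ℝ} (hl : ∀ c, l c = 1 - ε * κ c) (hQ : Q = ∑ c, q c • v c)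
    (ht : ∀ c d, t d d c = t c d d)
    (hW₁ : ∀ c, W₁ c = -ε * (∑ d, t c d d + κ c * q c * ∑ d, κ d + 2 * κ c ^ 2 * q c)) :
    ∑ c, (-ε • (κ c ^ 2 • Q + (2 * κ c ^ 2 * q c) • v c + ∑ d, t c c d • v d))
      + (∑ d, κ d) • ∑ c, (q c * l c) • v c = ∑ c, W₁ c • v c + (∑ c, l c * κ c) • Q := by
  generalize hH : ∑ d, κ d = H at hW₁
  -- By symmetry the third derivatives in the second-order part of `T` become the traces that occur
  -- in `W₁`.
  have e1 : ∑ c, ∑ d, t c c d • v d = ∑ d, (∑ c, t d c c) • v d := by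
    rw [Finset.sum_comm]
    refine Finset.sum_congr rfl fun d _ => ?_
    rw [Finset.sum_smul]
    exact Finset.sum_congr rfl fun c _ => by rw [ht d c]
  have e2 : ∑ c, W₁ c • v c = -ε • ∑ d, (∑ c, t d c c) • v d
      + -ε • ∑ c, (κ c * q c * H + 2 * κ c ^ 2 * q c) • v c := by
    rw [← smul_add, ← Finset.sum_add_distrib, Finset.smul_sum]
    refine Finset.sum_congr rfl fun c _ => ?_
    rw [hW₁, ← add_smul, smul_smul]; congr 1; ring
  have e3 : H • Q = H • ∑ c, (q c * l c) • v c + ε • H • ∑ c, (κ c * q c) • v c := by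
    rw [hQ, smul_comm ε H, ← smul_add, Finset.smul_sum (r := ε), ← Finset.sum_add_distrib]
    congr 1
    refine Finset.sum_congr rfl fun c _ => ?_
    rw [smul_smul, ← add_smul]; congr 1; rw [hl]; ring
  have e4 : ∑ c, (κ c * q c * H + 2 * κ c ^ 2 * q c) • v c =
      H • ∑ c, (κ c * q c) • v c + ∑ c, (2 * κ c ^ 2 * q c) • v c := by
    rw [Finset.smul_sum, ← Finset.sum_add_distrib]
    refine Finset.sum_congr rfl fun c _ => ?_
    rw [smul_smul, ← add_smul]; congr 1; ring
  have e5 : (∑ c, l c * κ c) • Q = H • Q - ε • (∑ c, κ c ^ 2) • Q := by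
    rw [smul_smul, ← sub_smul, ← hH, Finset.mul_sum, ← Finset.sum_sub_distrib]
    congr 1
    exact Finset.sum_congr rfl fun c _ => by rw [hl]; ring
  rw [← Finset.smul_sum, Finset.sum_add_distrib, Finset.sum_add_distrib, e1, ← Finset.sum_smul,
    e2, e4, e5, e3]
  simp only [smul_add, neg_smul]
  abel
/-- The trace inequality in scaled form. -/
lemma scaled_trace_bound {ε a b : ℝ} {Q ω : E n} {v : Fin n → E n}
    {q κ l i φ₁ φ₂ W₁ W₂ : Fin n → ℝ} {t : Fin n → Fin n → Fin n → ℝ} {α β : E n →L[ℝ] ℝ}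
    (hl : ∀ c, l c = 1 - ε * κ c) (hil : ∀ c, i c * l c = 1) (hQ : Q = ∑ c, q c • v c)
    (ht : ∀ c d, t d d c = t c d d)
    (hW₁ : ∀ c, W₁ c = -ε * (∑ d, t c d d + κ c * q c * ∑ d, κ d + 2 * κ c ^ 2 * q c))
    (hW₁ω : ∀ c, W₁ c = inner ℝ ω (v c))
    (hφ₁ : ∀ c, φ₁ c = α (v c) - β (l c • v c))
    (hφ₂ : ∀ c, φ₂ c = -a * ‖v c‖ ^ 2 - α (v c) ^ 2
      - (β (-ε • (κ c ^ 2 • Q + (2 * κ c ^ 2 * q c) • v c + ∑ d, t c c d • v d))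
        + b * ‖l c • v c‖ ^ 2))
    (htr : ∑ c, φ₂ c + (∑ d, κ d) * ∑ c, q c * φ₁ c
        - (∑ c, κ c * i c) * ∑ c, q c * W₁ c + ∑ c, ∑ d, κ d * κ c * (1 - l d * i c)
      ≤ ∑ c, W₂ c * i c) :
    (∑ c, i c - n) * (∑ c, l c ^ 2 - ∑ c, l c) + (∑ c, l c - n) ^ 2 ≤ ε ^ 2 * ∑ c, W₂ c * i c
      + a * (ε ^ 2 * ∑ c, ‖v c‖ ^ 2) + ε ^ 2 * ∑ c, α (v c) ^ 2 + b * (ε ^ 2 * ∑ c, ‖l c • v c‖ ^ 2)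
      + ε ^ 2 * β (∑ c, W₁ c • v c + (∑ c, l c * κ c) • Q)
      - (n - ∑ c, l c) * (ε * α Q) + (∑ c, i c - n) * (ε * inner ℝ ω Q) := by
  obtain ⟨hεH, hεκi, -, hcurv⟩ := sum_scaled_curvature hl hil
  have hqφ : ∑ c, q c * φ₁ c = α Q - β (∑ c, (q c * l c) • v c) := by
    rw [hQ, map_sum, map_sum, ← Finset.sum_sub_distrib]
    refine Finset.sum_congr rfl fun c _ => ?_
    rw [hφ₁, map_smul, map_smul, map_smul]
    simp only [smul_eq_mul]; ring
  have hqW : ∑ c, q c * W₁ c = inner ℝ ω Q := by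
    rw [hQ, inner_sum]
    exact Finset.sum_congr rfl fun c _ => by rw [hW₁ω, inner_smul_right]
  have hφ₂s : ∑ c, φ₂ c = -a * ∑ c, ‖v c‖ ^ 2 - ∑ c, α (v c) ^ 2
      - β (∑ c, (-ε • (κ c ^ 2 • Q + (2 * κ c ^ 2 * q c) • v c + ∑ d, t c c d • v d)))
      - b * ∑ c, ‖l c • v c‖ ^ 2 := by
    rw [Finset.mul_sum, Finset.mul_sum, map_sum, ← Finset.sum_sub_distrib,
      ← Finset.sum_sub_distrib, ← Finset.sum_sub_distrib]
    exact Finset.sum_congr rfl fun c _ => by rw [hφ₂]; ring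
  have hβvec := congrArg β (sum_second_order_T hl hQ ht hW₁)
  rw [map_add, map_smul, smul_eq_mul] at hβvec
  rw [← hcurv, ← hβvec, ← hεH, ← hεκi]
  rw [hφ₂s, hqφ, hqW] at htr
  -- The factor `ε²` supplies an `ε` for each frame vector and each slope, and turns curvatures into
  -- the `λ`.
  have := mul_le_mul_of_nonneg_left htr (sq_nonneg ε)
  linarith

/-- The trace inequality with all first- and second-order terms estimated. -/
lemma scaled_trace_inequality {ε D M Y θ a b : ℝ} {Q ω : E n} {v : Fin n → E n}
    {q κ l i φ₁ φ₂ W₁ W₂ : Fin n → ℝ} {t : Fin n → Fin n → Fin n → ℝ} {α β : E n →L[ℝ] ℝ}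
    (hl : ∀ c, l c = 1 - ε * κ c)
    (hil : ∀ c, i c * l c = 1) (hl0 : ∀ c, 0 < l c) (hε : 0 < ε) (hQ : Q = ∑ c, q c • v c)
    (hQD : ε * ‖Q‖ ≤ D)
    (hv : ∀ c, ε * ‖v c‖ ≤ D) (hD : 1 ≤ D) (hM : 1 ≤ M) (hα : ‖α‖ ≤ M) (hβ : ‖β‖ ≤ M)
    (ha : a ≤ M) (hb : b ≤ M) (hω : ‖ω‖ ≤ θ) (hY : 0 ≤ Y)
    (ht : ∀ c d, t d d c = t c d d)
    (hW₁ : ∀ c, W₁ c = -ε * (∑ d, t c d d + κ c * q c * ∑ d, κ d + 2 * κ c ^ 2 * q c))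
    (hW₁ω : ∀ c, W₁ c = inner ℝ ω (v c)) (hW₂ : ∀ c, W₂ c ≤ ‖v c‖ ^ 2 * Y)
    (hφ₁ : ∀ c, φ₁ c = α (v c) - β (l c • v c))
    (hφ₂ : ∀ c, φ₂ c = -a * ‖v c‖ ^ 2 - α (v c) ^ 2
      - (β (-ε • (κ c ^ 2 • Q + (2 * κ c ^ 2 * q c) • v c + ∑ d, t c c d • v d))
        + b * ‖l c • v c‖ ^ 2))
    (htr : ∑ c, φ₂ c + (∑ d, κ d) * ∑ c, q c * φ₁ c
        - (∑ c, κ c * i c) * ∑ c, q c * W₁ c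
        + ∑ c, ∑ d, κ d * κ c * (1 - l d * i c)
      ≤ ∑ c, W₂ c * i c) :
    (∑ c, i c - n) * (∑ c, l c ^ 2 - ∑ c, l c)
        + (∑ c, l c - n) ^ 2 ≤
      (∑ c, i c) * (D ^ 2 * Y) + (∑ c, i c + n) * (θ * D)
        + n * D ^ 2 * M * θ
        + M ^ 2 * D ^ 2 * (3 * n + 2 * ∑ c, l c ^ 2 + 2 * ∑ c, l c) := by
  have hmain := scaled_trace_bound hl hil hQ ht hW₁ hW₁ω hφ₁ hφ₂ htr
  obtain ⟨-, -, hεlκ, -⟩ := sum_scaled_curvature hl hil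
  have hi0 : ∀ c, 0 < i c := fun c => pos_of_mul_pos_left (by rw [hil]; exact one_pos) (hl0 c).le
  clear hφ₁ hφ₂ htr ht hW₁ hil hl hQ
  generalize hP : ∑ c, i c = P at hmain ⊢
  generalize hN : ∑ c, l c ^ 2 = N at hmain hεlκ ⊢
  generalize hw : ∑ c, l c = w at hmain hεlκ ⊢
  have hP0 : 0 ≤ P := hP ▸ Finset.sum_nonneg fun c _ => (hi0 c).le
  have hN0 : 0 ≤ N := hN ▸ Finset.sum_nonneg fun c _ => sq_nonneg _
  have hw0 : 0 ≤ w := hw ▸ Finset.sum_nonneg fun c _ => (hl0 c).le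
  have hθ : 0 ≤ θ := (norm_nonneg _).trans hω
  have hcard : ∑ _c : Fin n, (1 : ℝ) = n := by simp
  have hv2 : ∀ c, ε ^ 2 * ‖v c‖ ^ 2 ≤ D ^ 2 := fun c => by
    rw [← mul_pow]; exact pow_le_pow_left₀ (by positivity) (hv c) 2
  have b₁ : a * (ε ^ 2 * ∑ c, ‖v c‖ ^ 2) ≤ M * (n * D ^ 2) := by
    have : ε ^ 2 * ∑ c, ‖v c‖ ^ 2 ≤ n * D ^ 2 := by
      rw [← hcard, Finset.sum_mul, Finset.mul_sum]
      exact Finset.sum_le_sum fun c _ => by rw [one_mul]; exact hv2 c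
    calc _ ≤ M * (ε ^ 2 * ∑ c, ‖v c‖ ^ 2) := by gcongr
      _ ≤ _ := by gcongr
  have b₂ : ε ^ 2 * ∑ c, α (v c) ^ 2 ≤ n * (M ^ 2 * D ^ 2) := by
    rw [← hcard, Finset.sum_mul, Finset.mul_sum]
    refine Finset.sum_le_sum fun c _ => ?_
    have : α (v c) ^ 2 ≤ (M * ‖v c‖) ^ 2 := by
      rw [← sq_abs]
      exact pow_le_pow_left₀ (abs_nonneg _) ((α.le_opNorm _).trans (by gcongr)) 2
    calc ε ^ 2 * α (v c) ^ 2 ≤ ε ^ 2 * (M * ‖v c‖) ^ 2 := by gcongr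
      _ = M ^ 2 * (ε ^ 2 * ‖v c‖ ^ 2) := by ring
      _ ≤ 1 * (M ^ 2 * D ^ 2) := by rw [one_mul]; gcongr; exact hv2 c
  have b₃ : b * (ε ^ 2 * ∑ c, ‖l c • v c‖ ^ 2) ≤ M * (N * D ^ 2) := by
    have : ε ^ 2 * ∑ c, ‖l c • v c‖ ^ 2 ≤ N * D ^ 2 := by
      rw [← hN, Finset.sum_mul, Finset.mul_sum]
      refine Finset.sum_le_sum fun c _ => ?_
      rw [norm_smul, mul_pow, Real.norm_eq_abs, sq_abs, mul_left_comm]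
      gcongr; exact hv2 c
    calc _ ≤ M * (ε ^ 2 * ∑ c, ‖l c • v c‖ ^ 2) := by gcongr
      _ ≤ _ := by gcongr
  have b₄ : ε ^ 2 * β (∑ c, W₁ c • v c + (∑ c, l c * κ c) • Q) ≤
      M * (n * (θ * D ^ 2)) + M * ((w + N) * D) := by
    have h1 : ε ^ 2 * ‖∑ c, W₁ c • v c‖ ≤ n * (θ * D ^ 2) := by
      calc ε ^ 2 * ‖∑ c, W₁ c • v c‖ ≤ ε ^ 2 * ∑ c, ‖W₁ c • v c‖ := by
            gcongr; exact norm_sum_le _ _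
        _ = ∑ c, ε ^ 2 * ‖W₁ c • v c‖ := Finset.mul_sum _ _ _
        _ ≤ ∑ _c : Fin n, 1 * (θ * D ^ 2) := Finset.sum_le_sum fun c _ => by
            have : |W₁ c| ≤ θ * ‖v c‖ := by
              rw [hW₁ω]; exact (abs_real_inner_le_norm _ _).trans (by gcongr)
            rw [norm_smul, Real.norm_eq_abs]
            calc ε ^ 2 * (|W₁ c| * ‖v c‖) ≤ ε ^ 2 * (θ * ‖v c‖ * ‖v c‖) := by gcongr
              _ = θ * (ε ^ 2 * ‖v c‖ ^ 2) := by ring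
              _ ≤ 1 * (θ * D ^ 2) := by rw [one_mul]; gcongr; exact hv2 c
        _ = n * (θ * D ^ 2) := by rw [← Finset.sum_mul, hcard]
    have h2 : ε ^ 2 * ‖(∑ c, l c * κ c) • Q‖ ≤ (w + N) * D := by
      calc ε ^ 2 * ‖(∑ c, l c * κ c) • Q‖ = |ε * ∑ c, l c * κ c| * (ε * ‖Q‖) := by
            rw [norm_smul, Real.norm_eq_abs, abs_mul, abs_of_pos hε]; ring
        _ ≤ (w + N) * D := by
            gcongr
            rw [hεlκ, abs_le]; constructor <;> linarith
    calc ε ^ 2 * β (∑ c, W₁ c • v c + (∑ c, l c * κ c) • Q)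
        ≤ ε ^ 2 * (M * (‖∑ c, W₁ c • v c‖ + ‖(∑ c, l c * κ c) • Q‖)) := by
          gcongr
          refine (le_abs_self _).trans ((β.le_opNorm _).trans ?_)
          gcongr
          exact norm_add_le _ _
      _ = M * (ε ^ 2 * ‖∑ c, W₁ c • v c‖) + M * (ε ^ 2 * ‖(∑ c, l c * κ c) • Q‖) := by ring
      _ ≤ _ := by gcongr
  have b₅ : -((n - w) * (ε * α Q)) ≤ (n + w) * (M * D) := by
    refine (neg_le_abs _).trans ?_
    rw [abs_mul, abs_mul ε, abs_of_pos hε]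
    have h1 : |(n : ℝ) - w| ≤ n + w := by
      rw [abs_le]; constructor <;> linarith [(Nat.cast_nonneg n : (0 : ℝ) ≤ n)]
    have h2 : ε * |α Q| ≤ M * D := by
      calc ε * |α Q| ≤ ε * (M * ‖Q‖) := by
            gcongr; exact (α.le_opNorm _).trans (by gcongr)
        _ = M * (ε * ‖Q‖) := by ring
        _ ≤ M * D := by gcongr
    gcongr
  have b₆ : (P - n) * (ε * inner ℝ ω Q) ≤ (P + n) * (θ * D) := by
    refine (le_abs_self _).trans ?_
    rw [abs_mul, abs_mul ε, abs_of_pos hε]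
    have h1 : |P - n| ≤ P + n := by
      rw [abs_le]; constructor <;> linarith [(Nat.cast_nonneg n : (0 : ℝ) ≤ n)]
    have h2 : ε * |inner ℝ ω Q| ≤ θ * D := by
      calc ε * |inner ℝ ω Q| ≤ ε * (θ * ‖Q‖) := by
            gcongr; exact (abs_real_inner_le_norm _ _).trans (by gcongr)
        _ = θ * (ε * ‖Q‖) := by ring
        _ ≤ θ * D := by gcongr
    gcongr
  have b₇ : ε ^ 2 * ∑ c, W₂ c * i c ≤ P * (D ^ 2 * Y) := by
    rw [← hP, Finset.sum_mul, Finset.mul_sum]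
    refine Finset.sum_le_sum fun c _ => ?_
    calc ε ^ 2 * (W₂ c * i c) ≤ ε ^ 2 * (‖v c‖ ^ 2 * Y * i c) := by
          gcongr
          exacts [(hi0 c).le, hW₂ c]
      _ = i c * ((ε ^ 2 * ‖v c‖ ^ 2) * Y) := by ring
      _ ≤ i c * (D ^ 2 * Y) := by
          have := (hi0 c).le
          gcongr; exact hv2 c
  have hn0 : (0 : ℝ) ≤ n := Nat.cast_nonneg n
  have hMD : M * D ≤ M ^ 2 * D ^ 2 := by
    rw [← mul_pow]
    exact le_self_pow₀ (one_le_mul_of_one_le_of_one_le hM hD) two_ne_zero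
  have hMD2 : M * D ^ 2 ≤ M ^ 2 * D ^ 2 := by
    have : M ≤ M ^ 2 := le_self_pow₀ hM two_ne_zero
    gcongr
  have c₁ := mul_le_mul_of_nonneg_right hMD2 hn0
  have c₂ := mul_le_mul_of_nonneg_right hMD2 hN0
  have c₃ := mul_le_mul_of_nonneg_right hMD (add_nonneg hn0 hw0)
  have c₄ := mul_le_mul_of_nonneg_right hMD (add_nonneg hw0 hN0)
  linarith

/-- An algebraic consequence of the trace inequality: `ζ²W` is bounded. -/
lemma cutoff_trace_le {l : Fin n → ℝ} (hl : ∀ c, 0 < l c) (hn : 1 ≤ n) {r ζ D M Φ : ℝ}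
    (hr : 0 < r) (hζ : 0 < ζ) (hζr : ζ ≤ r ^ 2) (hD : 1 ≤ D) (hM : 1 ≤ M) (hΦ : ∏ c, l c ≤ Φ)
    (h : (∑ c, (l c)⁻¹ - n) * (∑ c, l c ^ 2 - ∑ c, l c) + (∑ c, l c - n) ^ 2 ≤
      (∑ c, (l c)⁻¹) * (D ^ 2 * (46 * r ^ 2 * (∑ c, l c) / ζ ^ 2))
        + (∑ c, (l c)⁻¹ + n) * (5 * r * (∑ c, l c) / ζ * D)
        + n * D ^ 2 * M * (5 * r * (∑ c, l c) / ζ)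
        + M ^ 2 * D ^ 2 * (3 * n + 2 * ∑ c, l c ^ 2 + 2 * ∑ c, l c)) :
    ζ ^ 2 * ∑ c, l c ≤ 8 * n * (46 * D ^ 2 * r ^ 2 + 10 * r ^ 3 * D + 5 * r ^ 3 * D ^ 2 * M)
      + (r ^ 2) ^ 2 * (2 * n)
      + (r ^ 2) ^ 2 * (n * (Φ * (2 * n + 32 * M ^ 2 * D ^ 2) ^ (n - 1))) := by
  set B := 46 * D ^ 2 * r ^ 2 + 10 * r ^ 3 * D + 5 * r ^ 3 * D ^ 2 * M with hB
  set P := ∑ c, (l c)⁻¹ with hP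
  set N := ∑ c, l c ^ 2 with hN
  set w := ∑ c, l c with hw
  have hn' : (1 : ℝ) ≤ n := by exact_mod_cast hn
  have hw0 : 0 < w := Finset.sum_pos (fun c _ => hl c) ⟨⟨0, hn⟩, Finset.mem_univ _⟩
  have hΦ0 : 0 ≤ Φ := (Finset.prod_nonneg fun c _ => (hl c).le).trans hΦ
  have hζ2 : ζ ^ 2 ≤ (r ^ 2) ^ 2 := by gcongr
  have p₁ : 0 ≤ 8 * n * B := by positivity
  have p₂ : 0 ≤ (r ^ 2) ^ 2 * (2 * (n : ℝ)) := by positivity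
  have p₃ : 0 ≤ (r ^ 2) ^ 2 * (n * (Φ * (2 * n + 32 * M ^ 2 * D ^ 2) ^ (n - 1))) := by positivity
  -- Three cases: small `W`; bounded `P`, where the product bounds each `λ`; large `W` and `P`,
  -- where the good term dominates.
  rcases lt_or_ge w (2 * n) with hwn | hwn
  · have : ζ ^ 2 * w ≤ (r ^ 2) ^ 2 * (2 * n) := by gcongr
    linarith
  rcases lt_or_ge P (2 * n + 32 * M ^ 2 * D ^ 2) with hP0 | hP0
  · have hle : ∀ c, l c ≤ Φ * (2 * n + 32 * M ^ 2 * D ^ 2) ^ (n - 1) := fun c => by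
      have hi : ∀ d, (l d)⁻¹ ≤ 2 * n + 32 * M ^ 2 * D ^ 2 := fun d =>
        (Finset.single_le_sum (f := fun d => (l d)⁻¹) (fun d _ => (inv_pos.2 (hl d)).le)
          (Finset.mem_univ d)).trans hP0.le
      have hprod : ∏ d ∈ Finset.univ.erase c, (l d)⁻¹ ≤ (2 * n + 32 * M ^ 2 * D ^ 2) ^ (n - 1) := by
        refine (Finset.prod_le_prod (fun d _ => (inv_pos.2 (hl d)).le) fun d _ => hi d).trans_eq ?_
        rw [Finset.prod_const, Finset.card_erase_of_mem (Finset.mem_univ c), Finset.card_univ,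
          Fintype.card_fin]
      have hpos : 0 < ∏ d ∈ Finset.univ.erase c, l d := Finset.prod_pos fun d _ => hl d
      calc l c = (∏ d, l d) * ∏ d ∈ Finset.univ.erase c, (l d)⁻¹ := by
            rw [← Finset.mul_prod_erase _ _ (Finset.mem_univ c), Finset.prod_inv_distrib,
              mul_assoc, mul_inv_cancel₀ hpos.ne', mul_one]
        _ ≤ _ := by
            gcongr
            exact Finset.prod_nonneg fun d _ => (inv_pos.2 (hl d)).le
    have hwle : w ≤ n * (Φ * (2 * n + 32 * M ^ 2 * D ^ 2) ^ (n - 1)) := by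
      refine (Finset.sum_le_sum fun c _ => hle c).trans_eq ?_
      simp
    have : ζ ^ 2 * w ≤ (r ^ 2) ^ 2 * (n * (Φ * (2 * n + 32 * M ^ 2 * D ^ 2) ^ (n - 1))) := by
      gcongr
    linarith
  · have hNw : w ^ 2 ≤ n * N := by
      have := sq_sum_le_card_mul_sum_sq (s := Finset.univ) (f := l)
      simpa using this
    have hN2 : 2 * w ≤ N := by
      have : (n : ℝ) * (2 * w) ≤ n * N := by
        calc (n : ℝ) * (2 * w) = 2 * n * w := by ring
          _ ≤ w * w := by gcongr
          _ ≤ n * N := by rwa [← pow_two]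
      exact le_of_mul_le_mul_left this (by linarith)
    have hX : 0 < w / ζ ^ 2 := by positivity
    set X := w / ζ ^ 2 with hXdef
    have hwζ : 5 * r * w / ζ ≤ 5 * r ^ 3 * X := by
      have : w / ζ ≤ r ^ 2 * X := by
        rw [hXdef, ← mul_div_assoc, div_le_div_iff₀ hζ (by positivity)]
        calc w * ζ ^ 2 = w * ζ * ζ := by ring
          _ ≤ w * ζ * r ^ 2 := by gcongr
          _ = _ := by ring
      calc 5 * r * w / ζ = 5 * r * (w / ζ) := by ring
        _ ≤ 5 * r * (r ^ 2 * X) := by gcongr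
        _ = _ := by ring
    have hMD : 1 ≤ M ^ 2 * D ^ 2 :=
      one_le_mul_of_one_le_of_one_le (one_le_pow₀ hM) (one_le_pow₀ hD)
    have hPn : (n : ℝ) ≤ P / 2 := by linarith
    have hPpos : 0 < P := by linarith
    have t₁ : P * (D ^ 2 * (46 * r ^ 2 * w / ζ ^ 2)) = P * X * (46 * D ^ 2 * r ^ 2) := by
      rw [hXdef]; ring
    have t₂ : (P + n) * (5 * r * w / ζ * D) ≤ P * X * (10 * r ^ 3 * D) := by
      calc (P + n) * (5 * r * w / ζ * D) ≤ (P + P) * (5 * r ^ 3 * X * D) := by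
            gcongr; linarith
        _ = _ := by ring
    have t₃ : n * D ^ 2 * M * (5 * r * w / ζ) ≤ P * X * (5 * r ^ 3 * D ^ 2 * M) := by
      calc n * D ^ 2 * M * (5 * r * w / ζ) ≤ P * D ^ 2 * M * (5 * r ^ 3 * X) := by
            gcongr; linarith
        _ = _ := by ring
    -- The threshold `32 M² D² ≤ P` makes this at most half of the lower bound `P N / 4` for the
    -- good term.
    have t₄ : M ^ 2 * D ^ 2 * (3 * n + 2 * N + 2 * w) ≤ P / 8 * N := by
      calc M ^ 2 * D ^ 2 * (3 * n + 2 * N + 2 * w) ≤ M ^ 2 * D ^ 2 * (4 * N) := by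
            gcongr; linarith
        _ = 4 * (M ^ 2 * D ^ 2) * N := by ring
        _ ≤ P / 8 * N := by gcongr; linarith
    have t₅ : P / 4 * N ≤ (P - n) * (N - w) := by
      calc P / 4 * N = P / 2 * (N / 2) := by ring
        _ ≤ (P - n) * (N - w) := by gcongr <;> linarith
    have key : P * (N / 8) ≤ P * (X * B) := by
      linarith [sq_nonneg (w - n)]
    have key2 := le_of_mul_le_mul_left key hPpos
    have key3 : ζ ^ 2 * w * w ≤
        8 * n * B * w := by
      have hXζ : ζ ^ 2 * X = w := by rw [hXdef]; field_simp
      calc ζ ^ 2 * w * w = ζ ^ 2 * w ^ 2 := by ring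
        _ ≤ ζ ^ 2 * (8 * n * (N / 8)) := by gcongr; linarith
        _ ≤ ζ ^ 2 * (8 * n * (X * B)) := by
            gcongr
        _ = 8 * n * B * (ζ ^ 2 * X) := by
            ring
        _ = _ := by rw [hXζ]
    have := le_of_mul_le_mul_right key3 hw0
    linarith

end Maximum

/-! ### The estimate at a touching point. -/

section Pointwise

variable {n : ℕ}

/-- Cauchy–Schwarz gives `I - p ⊗ p ≥ s² I`. -/
lemma IsFrame.norm_le {p : E n} {s : ℝ} {M : E n →L[ℝ] E n →L[ℝ] ℝ} {v : Fin n → E n}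
    {κ : Fin n → ℝ} (F : IsFrame p s M v κ) (hs : 0 < s) (hsp : ‖p‖ ^ 2 = 1 - s ^ 2) (a : Fin n) :
    ‖v a‖ ≤ s⁻¹ := by
  have h := F.orth a a
  rw [if_pos rfl, real_inner_self_eq_norm_sq, ← pow_two] at h
  have h1 : inner ℝ p (v a) ^ 2 ≤ (1 - s ^ 2) * ‖v a‖ ^ 2 := by
    rw [← hsp, ← mul_pow, ← sq_abs]
    exact pow_le_pow_left₀ (abs_nonneg _) (abs_real_inner_le_norm _ _) 2
  have h2 : (s * ‖v a‖) ^ 2 ≤ 1 ^ 2 := by rw [mul_pow]; linarith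
  have h3 := (pow_le_pow_iff_left₀ (by positivity) zero_le_one two_ne_zero).1 h2
  rwa [← one_div, le_div_iff₀' hs]

/-- The estimate of `ζ²W` at a point where it is touched from above by a small quadratic
polynomial. -/
lemma IsPotential.cutoff_trace_le {ε : ℝ} (hε : 0 < ε) (hn : 1 ≤ n) {Ω Ωs : Set (E n)}
    (hΩ : IsOpen Ω) {f g u : E n → ℝ} (hP : IsPotential ε Ω Ωs f g u)
    (hf0 : ∀ y ∈ Ω, 0 < f y) (hg0 : ∀ y ∈ Ωs, 0 < g y) {x z γ : E n} (hx : x ∈ Ω)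
    (h4 : DifferentiableAt ℝ (D3 u) x) {K m M Φ D r τ : ℝ}
    (hf : QuadraticallyApproximable K f x) (hg : QuadraticallyApproximable K g (T ε u x))
    (hm : 0 < m) (hmf : m ≤ f x) (hmg : m ≤ g (T ε u x)) (hM : 1 ≤ M) (hKM : 2 * K ≤ M * m)
    (hΦ : f x / g (T ε u x) ≤ Φ) (hD : 1 ≤ D) (hLD : L ε u x ≤ D)
    (hζ : 0 < r ^ 2 - ‖x - z‖ ^ 2) (hr : 0 < r) (hγ : ‖γ‖ ≤ τ)
    (h₁ : τ ≤ (r ^ 2 - ‖x - z‖ ^ 2) * W ε u x) (h₂ : τ ≤ (r ^ 2 - ‖x - z‖ ^ 2) * W ε u x * r)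
    (hG : ∀ᶠ h in 𝓝 (0 : E n), (r ^ 2 - ‖x + h - z‖ ^ 2) ^ 2 * W ε u (x + h) ≤
      (r ^ 2 - ‖x - z‖ ^ 2) ^ 2 * W ε u x + inner ℝ γ h + τ * ‖h‖ ^ 2) :
    (r ^ 2 - ‖x - z‖ ^ 2) ^ 2 * W ε u x ≤
      8 * n * (46 * D ^ 2 * r ^ 2 + 10 * r ^ 3 * D + 5 * r ^ 3 * D ^ 2 * M)
      + (r ^ 2) ^ 2 * (2 * n)
      + (r ^ 2) ^ 2 * (n * (Φ * (2 * n + 32 * M ^ 2 * D ^ 2) ^ (n - 1))) := by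
  have hu := hP.regular.1
  have hcon := fun y hy => hP.concave.contact hε hΩ hu (x := y) hy
  have hp : ∀ y ∈ Ω, ‖gradient u y‖ < 1 := fun y hy => (hcon y hy).1
  have hB : ∀ y ∈ Ω, ∀ v, 0 ≤ Bform ε u y v v := fun y hy v => by
    have := (hcon y hy).2.2 v
    rw [inner_gradient] at this
    rw [Bform, real_inner_self_eq_norm_sq]
    linarith
  have hφ : ∀ y ∈ Ω, 0 < f y / g (T ε u y) := fun y hy =>
    div_pos (hf0 y hy) (hg0 _ (hP.mapsTo y hy))
  set s := √(sig u x) with hsdef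
  have hs : 0 < s := Real.sqrt_pos.2 (sig_pos (hp x hx))
  have hσ : sig u x = s ^ 2 := (Real.sq_sqrt (sig_pos (hp x hx)).le).symm
  have hsp := norm_gradient_sq hσ
  obtain ⟨v, κ, F⟩ := exists_isFrame hs hsp (D2 u x) (D2_symm hΩ hu hx)
  have hlam := lam_pos hΩ hu hx hs hσ F hε hp hB hφ hP.equation
  have hprod := prod_lam hΩ hu hx hs hσ F hε hp hP.equation
  have hWx : W ε u x = ∑ a, (1 - ε * κ a) := by
    have := (jet_W hΩ hu hx hs hσ F hε hp h4 ⟨0, hn⟩).apply_zero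
    rw [zero_smul, add_zero] at this
    rw [this, Finset.sum_sub_distrib, ← Finset.mul_sum]
    simp
  have hW0 : 0 ≤ W ε u x := by
    rw [hWx]; exact Finset.sum_nonneg fun a _ => (hlam a).le
  obtain ⟨ω, hω, hωW⟩ := exists_cutoff_conditions hζ hr hW0 hγ h₁ h₂ hG
  have hK : 0 ≤ K := (norm_nonneg _).trans hf.1
  have hbound : ∀ y, m ≤ y → 2 * K / y ≤ M := fun y hy => by
    rw [div_le_iff₀ (hm.trans_le hy)]
    exact hKM.trans (by gcongr)
  have hnorm : ∀ (l : E n →L[ℝ] ℝ) (y : ℝ), ‖l‖ ≤ K → m ≤ y → ‖y⁻¹ • l‖ ≤ M := fun l y hl hy => by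
    have hy0 := hm.trans_le hy
    rw [norm_smul, Real.norm_of_nonneg (inv_nonneg.2 hy0.le), ← div_eq_inv_mul]
    refine le_trans ?_ (hbound y hy)
    gcongr; linarith
  have hfx := hm.trans_le hmf
  have hgx := hm.trans_le hmg
  -- The coefficients of these barriers play the roles of `φ₁` and `φ₂` in the trace inequality.
  choose ψ hψ hψle using fun c => exists_jet_le_log_div (v := v c) hf hg hfx hgx
    (jet_T hΩ hu hx hs hσ F hp (ε := ε) c)
  have hdir := fun c => directional_concavity hΩ hu hx hs hσ F hε hp hB hφ hP.equation h4 c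
    (hψ c) (hψle c)
  have hjW := fun c => hωW (v c) _ _ ((jet_W hΩ hu hx hs hσ F hε hp h4 c).congr_coeff
    (by rw [hWx, Finset.sum_sub_distrib, ← Finset.mul_sum]; simp) rfl rfl)
  have ht₁₂ : ∀ a b c, s⁻¹ * D3 u x (v a) (v b) (v c) = s⁻¹ * D3 u x (v b) (v a) (v c) :=
    fun a b c => by rw [D3_symm₁₂ hΩ hu hx]
  have ht₂₃ : ∀ a b c, s⁻¹ * D3 u x (v a) (v b) (v c) = s⁻¹ * D3 u x (v a) (v c) (v b) :=
    fun a b c => by rw [D3_symm₂₃ hΩ hu hx]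
  have htr := trace_inequality (ε := ε) (s := s)
    (q := fun c => s * inner ℝ (gradient u x) (v c)) (κ := κ)
    (U := fun c => s⁻¹ * D3 u x (v c) (v c) (s⁻¹ • gradient u x))
    (t := fun a b c => s⁻¹ * D3 u x (v a) (v b) (v c))
    (r := fun c a => s⁻¹ * D4 u x (v c) (v c) (v a) (v a)) ht₁₂ ht₂₃
    (fun a c => by rw [D4_swap hΩ hu hx h4])
    (fun c => by
      conv_lhs => rw [F.slope_eq hs hsp, map_sum, Finset.mul_sum]
      exact Finset.sum_congr rfl fun b _ => by rw [map_smul, smul_eq_mul]; ring)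
    hlam (fun c => rfl) (fun c => rfl) (fun c => (hdir c).1) (fun c => (hdir c).2)
  have hL : L ε u x = ε * s⁻¹ := by rw [L_eq_rho (hp x hx), rho_eq hs hσ]
  -- Uniformity in `ε`: `1/s` may blow up, but `ε/s = L` is bounded by `D`.
  have hεs : ε * s⁻¹ ≤ D := hL ▸ hLD
  have hQn : ‖s⁻¹ • gradient u x‖ ≤ s⁻¹ := by
    rw [norm_smul, Real.norm_of_nonneg (inv_nonneg.2 hs.le)]
    exact mul_le_of_le_one_right (inv_nonneg.2 hs.le) (hp x hx).le
  have hfin := scaled_trace_inequality (ε := ε) (D := D) (M := M) (ω := ω) (v := v)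
    (q := fun c => s * inner ℝ (gradient u x) (v c)) (κ := κ)
    (t := fun a b c => s⁻¹ * D3 u x (v a) (v b) (v c))
    (a := 2 * K / f x) (b := 2 * K / g (T ε u x)) (Q := s⁻¹ • gradient u x)
    (α := (f x)⁻¹ • fderiv ℝ f x) (β := (g (T ε u x))⁻¹ • fderiv ℝ g (T ε u x))
    (fun c => rfl) (fun c => inv_mul_cancel₀ (hlam c).ne') hlam hε (F.slope_eq hs hsp)
    ((mul_le_mul_of_nonneg_left hQn hε.le).trans hεs)
    (fun c => (mul_le_mul_of_nonneg_left (F.norm_le hs hsp c) hε.le).trans hεs) hD hM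
    (hnorm _ _ hf.1 hmf) (hnorm _ _ hg.1 hmg) (hbound _ hmf) (hbound _ hmg) hω
    (by positivity) (fun c d => by rw [ht₂₃, ht₁₂]) (fun c => rfl) (fun c => (hjW c).1)
    (fun c => (hjW c).2)
    (fun c => by
      rw [smul_apply, smul_apply, smul_eq_mul, smul_eq_mul,
        ← div_eq_inv_mul, ← div_eq_inv_mul])
    (fun c => by
      rw [smul_apply, smul_apply, smul_eq_mul, smul_eq_mul]
      ring) htr
  rw [hWx] at hfin ⊢
  exact MongeReg.cutoff_trace_le hlam hn hr hζ (sub_le_self _ (sq_nonneg _)) hD hM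
    (hprod.trans_le hΦ) hfin

end Pointwise

/-! ### From touching points to the center of the ball. -/

section Interior

variable {n : ℕ}

lemma ball_infDist_frontier_subset {Ω : Set (E n)} {x : E n} (hx : x ∈ Ω) :
    Metric.ball x (Metric.infDist x (frontier Ω)) ⊆ Ω := by
  intro y hy
  by_contra hyΩ
  obtain ⟨b, hb, hxb⟩ := exists_mem_frontier_infDist_compl_eq_dist hx
    (fun h => hyΩ (h ▸ Set.mem_univ y))
  have h1 := Metric.infDist_le_dist_of_mem (x := x) hb
  have h2 := Metric.infDist_le_dist_of_mem (x := x) (Set.mem_compl hyΩ)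
  rw [Metric.mem_ball, dist_comm] at hy
  linarith

/-- The interior estimate `ζ²W ≤ C₀` at the center of a ball, from the estimate at the points
where `ζ²W` is touched from above. -/
lemma IsPotential.trace_le_of_touching {ε : ℝ} (hε : 0 < ε) {Ω Ωs : Set (E n)} (hΩ : IsOpen Ω)
    {f g u : E n → ℝ} (hP : IsPotential ε Ω Ωs f g u) {z : E n} {r C : ℝ} (hr : 0 < r)
    (hC : 1 ≤ C) (hball : Metric.closedBall z r ⊆ Ω)
    (h : ∀ (x γ : E n) (τ : ℝ), x ∈ Metric.ball z r → DifferentiableAt ℝ (D3 u) x → ‖γ‖ ≤ τ →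
      τ ≤ (r ^ 2 - ‖x - z‖ ^ 2) * W ε u x → τ ≤ (r ^ 2 - ‖x - z‖ ^ 2) * W ε u x * r →
      (∀ᶠ h in 𝓝 (0 : E n), (r ^ 2 - ‖x + h - z‖ ^ 2) ^ 2 * W ε u (x + h) ≤
        (r ^ 2 - ‖x - z‖ ^ 2) ^ 2 * W ε u x + inner ℝ γ h + τ * ‖h‖ ^ 2) →
      (r ^ 2 - ‖x - z‖ ^ 2) ^ 2 * W ε u x ≤ C) :
    W ε u z ≤ C / (r ^ 2) ^ 2 := by
  have hp : ∀ y ∈ Ω, ‖gradient u y‖ < 1 := fun y hy =>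
    (hP.concave.contact hε hΩ hP.regular.1 hy).1
  set G : E n → ℝ := fun y => (r ^ 2 - ‖y - z‖ ^ 2) ^ 2 * W ε u y with hGdef
  have hreg := fun x (hx : x ∈ Ω) =>
    exists_lipschitzOnWith_cutoff_trace hε hΩ hP.regular hp r z hx
  have hcont : ∀ x ∈ Ω, ContinuousAt G x := fun x hx => by
    obtain ⟨R, hR, K, hd, -⟩ := hreg x hx
    exact (hd x (Metric.mem_closedBall_self hR.le)).continuousAt
  obtain ⟨x₀, hx₀, hmax⟩ := (isCompact_closedBall z r).exists_isMaxOn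
    ⟨z, Metric.mem_closedBall_self hr.le⟩
    (fun y hy => (hcont y (hball hy)).continuousWithinAt : ContinuousOn G (Metric.closedBall z r))
  have hGz : G z = (r ^ 2) ^ 2 * W ε u z := by simp [hGdef]
  have hzx : G z ≤ G x₀ := hmax (Metric.mem_closedBall_self hr.le)
  suffices hle : G x₀ ≤ C by
    rw [le_div_iff₀ (by positivity), mul_comm, ← hGz]; exact hzx.trans hle
  -- If the maximum exceeds `C`, so does `G` at all nearby points, including a touching point off
  -- the null set where `D3 u` is not differentiable.
  by_contra! hlt
  have hx₀b : x₀ ∈ Metric.ball z r := by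
    rw [Metric.mem_closedBall, dist_eq_norm] at hx₀
    rw [Metric.mem_ball, dist_eq_norm]
    refine lt_of_le_of_ne hx₀ fun he => ?_
    have : G x₀ = 0 := by simp [hGdef, he]
    linarith
  obtain ⟨R, hR, K, hd, hK⟩ := hreg x₀ (hball hx₀)
  obtain ⟨R', hR', -, K', hK'⟩ := hP.regular.exists_lipschitz_D3 hΩ (hball hx₀)
  obtain ⟨ρ, hρ, hsub⟩ := Metric.nhds_basis_closedBall.mem_iff.1 (inter_mem
    (inter_mem (Metric.closedBall_mem_nhds x₀ hR) (Metric.ball_mem_nhds x₀ hR'))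
    (inter_mem (Metric.isOpen_ball.mem_nhds hx₀b)
      ((hcont x₀ (hball hx₀)).eventually (lt_mem_nhds hlt))))
  -- In the choice of `τ`, `ρ` keeps `x` where `ζ²W > C ≥ 1`; as `ζ ≤ r²`, this gives `ζW ≥ 1/r²`
  -- and `ζWr ≥ 1/r`, the smallness of `τ` required by `h`.
  obtain ⟨x, hxN, hxx, γ, hγ, htouch⟩ := exists_touching_above hρ
    (fun y hy => hd y (hsub hy).1.1) (hK.mono fun y hy => (hsub hy).1.1)
    (fun y hy => hmax (Metric.ball_subset_closedBall (hsub hy).2.1))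
    (volume_not_differentiableAt hK')
    (τ := min ρ (min (1 / r ^ 2) (1 / r))) (by positivity)
  obtain ⟨⟨-, hxR'⟩, hxb, hxC⟩ := hsub
    (Metric.mem_closedBall.2 (hxx.le.trans (min_le_left _ _)))
  have h4 : DifferentiableAt ℝ (D3 u) x := by
    by_contra h4
    exact hxN ⟨hxR', h4⟩
  have hxz : ‖x - z‖ < r := by rwa [← dist_eq_norm]
  have hζ : 0 < r ^ 2 - ‖x - z‖ ^ 2 :=
    sub_pos.2 (pow_lt_pow_left₀ hxz (norm_nonneg _) two_ne_zero)
  have hζr : r ^ 2 - ‖x - z‖ ^ 2 ≤ r ^ 2 := sub_le_self _ (sq_nonneg _)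
  have hζW : 1 / r ^ 2 ≤ (r ^ 2 - ‖x - z‖ ^ 2) * W ε u x := by
    have h1 : 1 ≤ (r ^ 2 - ‖x - z‖ ^ 2) * ((r ^ 2 - ‖x - z‖ ^ 2) * W ε u x) := by
      rw [← mul_assoc, ← pow_two]; exact hC.trans hxC.le
    have h2 : 0 < (r ^ 2 - ‖x - z‖ ^ 2) * W ε u x :=
      pos_of_mul_pos_right (one_pos.trans_le h1) hζ.le
    rw [div_le_iff₀ (by positivity), mul_comm]
    exact h1.trans (by gcongr)
  refine absurd (h x γ _ hxb h4 hγ ?_ ?_ htouch) (not_le.2 hxC)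
  · exact (min_le_right _ _).trans ((min_le_left _ _).trans hζW)
  · refine (min_le_right _ _).trans ((min_le_right _ _).trans ?_)
    calc 1 / r = 1 / r ^ 2 * r := by field_simp
      _ ≤ _ := by gcongr

end Interior

end MongeReg

end

theorem theorem1 (n : ℕ) (hn : 2 ≤ n) (Ω Ωs : Set (MongeReg.E n))
    (hΩ : MongeReg.IsBoundedDomain Ω) (hΩs : MongeReg.IsBoundedDomain Ωs)
    (f g : MongeReg.E n → ℝ)
    (hf : MongeReg.IsCLip1Loc 1 Ω f) (hg : MongeReg.IsC11 Ωs g)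
    (hfb : MongeReg.HasPosBounds Ω f) (hgb : MongeReg.HasPosBounds Ωs g)
    (hmass : ∫ x in Ω, f x = ∫ y in Ωs, g y)
    (δ : ℝ) (hδ : 0 < δ) :
    ∃ C : ℝ, ∀ ε : ℝ, 0 < ε → ε ≤ 1 → ∀ u : MongeReg.E n → ℝ,
      MongeReg.IsPotential ε Ω Ωs f g u →
        ∀ x ∈ Ω, δ ≤ Metric.infDist x (frontier Ω) → MongeReg.W ε u x ≤ C := by
  obtain ⟨hΩo, -, hΩb⟩ := hΩ
  obtain ⟨hΩso, -, hΩsb⟩ := hΩs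
  obtain ⟨mf, Mf, hmf, hfb⟩ := hfb
  obtain ⟨mg, Mg, hmg, hgb⟩ := hgb
  -- Since `f` is only locally `C^{1,1}`, its bounds are taken on a compact set that contains every
  -- ball of radius `δ / 2` about an admissible point.
  set S : Set (MongeReg.E n) := closure Ω ∩ {x | δ / 2 ≤ Metric.infDist x (frontier Ω)} with hS
  have hSc : IsCompact S := hΩb.isCompact_closure.inter_right
    (isClosed_le continuous_const (Metric.continuous_infDist_pt _))
  have hSΩ : S ⊆ Ω := fun x hx => by
    by_contra hxΩ
    have hxf : x ∈ frontier Ω := by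
      rw [frontier, hΩo.interior_eq]; exact ⟨hx.1, hxΩ⟩
    have := hx.2
    rw [Set.mem_ofPred_eq, Metric.infDist_zero_of_mem hxf] at this
    linarith
  obtain ⟨Kf, hKf⟩ := hf.exists_quadraticallyApproximable hΩo hSc hSΩ
  obtain ⟨Kg, hKg⟩ := hg.exists_quadraticallyApproximable hΩso
  obtain ⟨R, hR⟩ := (Metric.isBounded_iff_subset_closedBall 0).1 hΩb
  obtain ⟨Rs, hRs⟩ := (Metric.isBounded_iff_subset_closedBall 0).1 hΩsb
  set r := δ / 2 with hr
  set m := min mf mg with hm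
  set K := max Kf Kg with hK
  set M := max 1 (2 * K / m) with hM
  -- Bounds `c_ε(x, Tx)` for all `ε ≤ 1`, as `Ω` and `Ωs` lie in balls of radius `R` and `Rs` about
  -- `0`.
  set D := √(1 + (R + Rs) ^ 2) with hD
  have hm0 : 0 < m := lt_min hmf hmg
  refine ⟨max 1 (8 * n * (46 * D ^ 2 * r ^ 2 + 10 * r ^ 3 * D + 5 * r ^ 3 * D ^ 2 * M)
      + (r ^ 2) ^ 2 * (2 * n)
      + (r ^ 2) ^ 2 * (n * (Mf / mg * (2 * n + 32 * M ^ 2 * D ^ 2) ^ (n - 1)))) / (r ^ 2) ^ 2,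
    fun ε hε hε1 u hu z hz hzδ => ?_⟩
  have hdist : ∀ x ∈ Metric.closedBall z r, x ∈ Metric.ball z (Metric.infDist z (frontier Ω)) :=
    fun x hx => Metric.closedBall_subset_ball (by linarith) hx
  have hball : Metric.closedBall z r ⊆ Ω := fun x hx =>
    MongeReg.ball_infDist_frontier_subset hz (hdist x hx)
  have hballS : Metric.closedBall z r ⊆ S := fun x hx => ⟨subset_closure (hball hx), by
    have := Metric.infDist_le_infDist_add_dist (s := frontier Ω) (x := z) (y := x)
    rw [Metric.mem_closedBall, dist_comm] at hx
    rw [Set.mem_ofPred_eq]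
    linarith⟩
  refine hu.trace_le_of_touching hε hΩo (half_pos hδ) (le_max_left _ _) hball
    fun x γ τ hx h4 hγ h₁ h₂ hG => le_trans ?_ (le_max_right _ _)
  have hxc := Metric.ball_subset_closedBall hx
  have hxΩ := hball hxc
  have hTs := hu.mapsTo x hxΩ
  refine hu.cutoff_trace_le hε (by omega) hΩo (fun y hy => hmf.trans_le (hfb y hy).1)
    (fun y hy => hmg.trans_le (hgb y hy).1) hxΩ h4 ((hKf x (hballS hxc)).mono (le_max_left _ _))
    ((hKg _ hTs).mono (le_max_right _ _)) hm0 ((min_le_left _ _).trans (hfb x hxΩ).1)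
    ((min_le_right _ _).trans (hgb _ hTs).1) (le_max_left _ _) ?_ ?_ ?_ ?_ ?_
    (half_pos hδ) hγ h₁ h₂ hG
  · rw [← div_le_iff₀ hm0]; exact le_max_right _ _
  · have hMf : 0 ≤ Mf := hmf.le.trans ((hfb x hxΩ).1.trans (hfb x hxΩ).2)
    exact div_le_div₀ hMf (hfb x hxΩ).2 hmg (hgb _ hTs).1
  · rw [hD, Real.one_le_sqrt]; linarith [sq_nonneg (R + Rs)]
  · rw [(hu.concave.contact hε hΩo hu.regular.1 hxΩ).2.1, MongeReg.cost]
    have h1 : ‖x - MongeReg.T ε u x‖ ≤ R + Rs := by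
      refine (norm_sub_le _ _).trans (add_le_add ?_ ?_)
      · simpa using hR hxΩ
      · simpa using hRs hTs
    refine Real.sqrt_le_sqrt (add_le_add (pow_le_one₀ hε.le hε1) ?_)
    exact pow_le_pow_left₀ (norm_nonneg _) h1 2
  · rw [Metric.mem_ball, dist_eq_norm] at hx
    exact sub_pos.2 (pow_lt_pow_left₀ hx (norm_nonneg _) two_ne_zero)
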